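/- Setting. On a probability space let $\tau_0=0<\tau_1<\tau_2<\dots$ be the jump times of a Poisson process with intensity $\lambda>0$ and let $Z_1,Z_2,\dots$ be random variables with values in $(-1,\infty)$ (returns of a stock between consecutive observation times). The process is Poisson relative to the observations: for each $k\ge1$, $\tau_k-\tau_{k-1}$ is exponential with parameter $\lambda$ and independent of $\{(\tau_i,Z_i)\}_{i<k}$; and, conditionally on $\tau_k-\tau_{k-1}=t$, $Z_k$ is independent of $\{(\tau_i,Z_i)\}_{i<k}$ and has distribution $p(t,dz)$, where $p$ is a measurable family of probability measures. There are $\underline z\in(0,1]$ and $\bar z\in(0,\infty]$ such that for every $t\ge 0$ the support of $p(t,dz)$ is either an interval with interior $(-\underline z,\bar z)$, or finite with least element $-\underline z$ and greatest element $\bar z<\infty$. Moreover $\int z\,p(t,dz)\ge0$ and $\int(1+z)\,p(t,dz)\le ke^{bt}$ for all $t\ge0$, with constants $k,b\ge0$, and $t\mapsto\int w(z)\,p(t,dz)$ is continuous on $[0,\infty)$ for every measurable $w$ of linear growth. The function $U:[0,\infty)\to\mathbb R$ is strictly increasing, strictly concave, $C^1$ on $(0,\infty)$, with $U(0)=0$,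 $U'(0^+)=+\infty$, $U'(+\infty)=0$ and $U(x)\le K_1x^\gamma$ for some $K_1>0$, $\gamma\in(0,1)$; and the discount rate $\rho>0$ satisfies $\rho>b\gamma+\lambda\big(k^\gamma/\underline z^\gamma-1\big)$. Let $\mathcal G_t=\sigma\{(\tau_i,Z_i):\tau_i\le t\}$ and $\mathcal G_{\tau_k}=\sigma\{(\tau_i,Z_i):i\le k\}$. For $x\ge0$ let $\mathcal A(x)$ be the set of pairs $(\alpha,c)$, where $\alpha=(\alpha_k)_{k\ge1}$ is real-valued with $\alpha_k$ being $\mathcal G_{\tau_{k-1}}$-measurable, $c=(c_t)_{t\ge0}$ is nonnegative and $(\mathcal G_t)$-predictable, and almost surely $x-\int_0^{\tau_k}c_t\,dt+\sum_{i=1}^k\alpha_iZ_i\ge0$ for all $k\ge1$. Put $$v(x)=\sup_{(\alpha,c)\in\mathcal A(x)}\mathbb E\Big[\int_0^\infty e^{-\rho t}U(c_t)\,dt\Big].$$ Let $A=\mathbb R$ and $l(a)=\max(a\underline z,-a\bar z)$ if $\bar z<\infty$, and $A=[0,\infty)$ and $l(a)=a\underline z$ if $\bar z=\infty$. For $t\ge0$,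 $a\in A$ and $x\ge l(a)$ let $\mathcal C_a(t,x)$ be the set of deterministic nonnegative measurable $c=(c_s)_{s\ge t}$ with $\int_t^sc_u\,du\le x-l(a)$ for all $s\ge t$, and put $$\hat v(t,x,a)=\sup_{c\in\mathcal C_a(t,x)}\int_t^\infty e^{-(\rho+\lambda)(s-t)}\Big[U(c_s)+\lambda\int v\Big(x-\int_t^sc_u\,du+az\Big)p(s,dz)\Big]ds.$$ Theorem. Assume that $p(t,dz)=p(dz)$ does not depend on $t\ge 0$ (so that $\hat v(t,x,a)=\hat v(x,a)$ does not depend on $t$ either). Then $v$ and $\hat v$ are finite, $v(x)=\sup_{a\in[-x/\bar z,\,x/\underline z]}\hat v(x,a)$ for all $x\ge0$ (with $-x/\bar z=0$ if $\bar z=\infty$), and: 1. $v\in C^1(0,\infty)$ and $v'(0^+)=+\infty$. For every $x>0$, every maximiser $a_x$ of $a\mapsto\hat v(x,a)$ over $[-x/\bar z,x/\underline z]$ is interior, that is, $x>l(a_x)$; equivalently, $a_x$ is in the interior of $[-x/\bar z,x/\underline z]$ relative to $A$. 2. For every $a\in A$, $\hat v(\cdot,a)\in C^2(l(a),\infty)$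 and $\frac{\partial\hat v}{\partial x}(l(a)^+,a)=+\infty$. -/

import Mathlib

open Set Filter Topology MeasureTheory ProbabilityTheory
open scoped NNReal ENNReal

noncomputable section

/-- The data of the illiquid market: observation times `τ 0 = 0 < τ 1 < τ 2 < …`, returns
`Z 1, Z 2, …` in `(-1, ∞)` of the stock between consecutive observation times (`Z 0` plays no
role), the intensity `lam` of the observation times, the family `p t` of return distributions,
the bounds `-zlow` and `zbar` of the returns, the discount rate `rho` and the utility `U`. -/
structure IlliquidMarket (Ω : Type*) [MeasurableSpace Ω] where
  τ : ℕ → Ω → ℝ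
  Z : ℕ → Ω → ℝ
  measurable_τ : ∀ k, Measurable (τ k)
  measurable_Z : ∀ k, Measurable (Z k)
  τ_zero : ∀ ω, τ 0 ω = 0
  τ_strictMono : ∀ ω, StrictMono fun k => τ k ω
  neg_one_lt_Z : ∀ k, 1 ≤ k → ∀ ω, -1 < Z k ω
  lam : ℝ
  p : Kernel ℝ ℝ
  zlow : ℝ
  zbar : EReal
  rho : ℝ
  U : ℝ → ℝ

namespace IlliquidMarket

variable {Ω : Type*} [mΩ : MeasurableSpace Ω] (M : IlliquidMarket Ω)

/-- The waiting time `τ (k+1) - τ k`. -/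
def waiting (k : ℕ) (ω : Ω) : ℝ := M.τ (k + 1) ω - M.τ k ω

/-- `𝒢_{τ_k}`: the information generated by `(τ i, Z i)`, `1 ≤ i ≤ k`. -/
@[reducible]
def discreteObs (k : ℕ) : MeasurableSpace Ω :=
  ⨆ i ∈ Set.Icc 1 k, MeasurableSpace.comap (fun ω => (M.τ i ω, M.Z i ω)) inferInstance

/-- The continuous observation filtration `𝒢_t = σ{(τ i, Z i) : τ i ≤ t}`: the internal filtration
of the marked point process `(τ i, Z i)`, `i ≥ 1`. -/
def continuousObs : Filtration ℝ≥0 mΩ where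
  seq t := MeasurableSpace.generateFrom
    {A | ∃ i : ℕ, 1 ≤ i ∧ ∃ s : ℝ, s ≤ t ∧ ∃ B : Set ℝ, MeasurableSet B ∧
      A = {ω | M.τ i ω ≤ s ∧ M.Z i ω ∈ B}}
  mono' := by
    intro t t' h
    apply MeasurableSpace.generateFrom_mono
    rintro A ⟨i, hi, s, hs, B, hB, rfl⟩
    exact ⟨i, hi, s, hs.trans (by exact_mod_cast h), B, hB, rfl⟩
  le' := by
    intro t
    apply MeasurableSpace.generateFrom_le
    rintro A ⟨i, _, s, _, B, hB, rfl⟩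
    exact (measurableSet_le (M.measurable_τ i) measurable_const).inter (M.measurable_Z i hB)

/-- The wealth `X_k = x - ∫_0^{τ_k} c_t dt + ∑_{i=1}^k α_i Z_i`. -/
def wealth (x : ℝ) (α : ℕ → Ω → ℝ) (c : ℝ≥0 → Ω → ℝ) (k : ℕ) (ω : Ω) : ℝ :=
  x - (∫ t in (0 : ℝ)..M.τ k ω, c t.toNNReal ω) + ∑ i ∈ Finset.Icc 1 k, α i ω * M.Z i ω

/-- Admissible control policies `(α, c) ∈ 𝒜(x)`: the amount `α k` invested over `(τ (k-1), τ k]` is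
observable at `τ (k-1)`, the consumption rate `c` is nonnegative and predictable for the continuous
observation filtration, and almost surely all the wealths `X_k` are well defined and
nonnegative. -/
structure IsAdmissible (P : Measure Ω) (x : ℝ) (α : ℕ → Ω → ℝ) (c : ℝ≥0 → Ω → ℝ) : Prop where
  measurable_α : ∀ k, Measurable[M.discreteObs k] (α (k + 1))
  predictable_c : IsStronglyPredictable M.continuousObs c
  nonneg_c : ∀ t ω, 0 ≤ c t ω
  integrable_c : ∀ᵐ ω ∂P, ∀ k, 1 ≤ k →
    IntervalIntegrable (fun t : ℝ => c t.toNNReal ω) volume 0 (M.τ k ω)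
  wealth_nonneg : ∀ᵐ ω ∂P, ∀ k, 1 ≤ k → 0 ≤ M.wealth x α c k ω

/-- The value function `v(x) = sup_{(α,c) ∈ 𝒜(x)} E ∫_0^∞ e^{-ρt} U(c_t) dt`, in `[0, ∞]`. -/
def value (P : Measure Ω) (x : ℝ) : ℝ≥0∞ :=
  ⨆ (α : ℕ → Ω → ℝ) (c : ℝ≥0 → Ω → ℝ) (_ : M.IsAdmissible P x α c),
    ∫⁻ ω, (∫⁻ t in Set.Ici (0 : ℝ),
      ENNReal.ofReal (Real.exp (-M.rho * t) * M.U (c t.toNNReal ω))) ∂P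

open Classical in
/-- `l(a) = max(a zlow, -a zbar)`, with the convention `l(a) = a zlow` if `zbar = ∞`. -/
def l (a : ℝ) : ℝ :=
  if M.zbar = ⊤ then a * M.zlow else max (a * M.zlow) (-a * M.zbar.toReal)

/-- The set `A` of portfolios: `ℝ` if `zbar < ∞`, and `[0, ∞)` if `zbar = ∞`. -/
def portfolios : Set ℝ := {a | M.zbar = ⊤ → 0 ≤ a}

open Classical in
/-- The interval `[-x/zbar, x/zlow]`, where `-x/zbar = 0` if `zbar = ∞`. -/
def portfolioInterval (x : ℝ) : Set ℝ :=
  Set.Icc (if M.zbar = ⊤ then 0 else -x / M.zbar.toReal) (x / M.zlow)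

/-- The set `𝒞_a(t,x)` of deterministic nonnegative consumption rates `c` on `[t, ∞)` with
`∫_t^s c_u du ≤ x - l(a)` for all `s ≥ t`. -/
structure IsConsumption (t x a : ℝ) (c : ℝ → ℝ) : Prop where
  measurable : Measurable c
  nonneg : ∀ s, 0 ≤ c s
  integrable : ∀ s, t ≤ s → IntervalIntegrable c volume t s
  integral_le : ∀ s, t ≤ s → ∫ u in t..s, c u ≤ x - M.l a

/-- The auxiliary value function, in `[0, ∞]`,
`v̂(t,x,a) = sup_{c ∈ 𝒞_a(t,x)} ∫_t^∞ e^{-(ρ+λ)(s-t)} [U(c_s) + λ ∫ v(Y_s + a z) p(s,dz)] ds`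
with `Y_s = x - ∫_t^s c_u du`. -/
def auxValue (P : Measure Ω) (t x a : ℝ) : ℝ≥0∞ :=
  ⨆ (c : ℝ → ℝ) (_ : M.IsConsumption t x a c),
    ∫⁻ s in Set.Ici t, ENNReal.ofReal (Real.exp (-(M.rho + M.lam) * (s - t))) *
      (ENNReal.ofReal (M.U (c s)) + ENNReal.ofReal M.lam *
        ∫⁻ z, M.value P ((x - ∫ u in t..s, c u) + a * z) ∂(M.p s))

/-- The assumptions on the observation times and returns. -/
structure ReturnAssumptions (P : Measure Ω) (k b : ℝ) : Prop where
  lam_pos : 0 < M.lam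
  /-- `(τ k)` are the jump times of a Poisson process of intensity `lam` relative to the
  observations: each waiting time is exponential and independent of what was observed before. -/
  law_waiting : ∀ n, P.map (M.waiting n) = expMeasure M.lam
  indep_waiting : ∀ n,
    Indep (M.discreteObs n) (MeasurableSpace.comap (M.waiting n) inferInstance) P
  /-- Given the waiting time `t` before it, each return is independent of the earlier observations
  and has distribution `p t`. -/
  condDistrib_return : ∀ n, ∀ B : Set ℝ, MeasurableSet B →
    P⟦M.Z (n + 1) ⁻¹' B | M.discreteObs n ⊔ MeasurableSpace.comap (M.waiting n) inferInstance⟧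
      =ᵐ[P] fun ω => (M.p (M.waiting n ω)).real B
  isProb : ∀ t, 0 ≤ t → IsProbabilityMeasure (M.p t)
  zlow_mem : M.zlow ∈ Set.Ioc (0 : ℝ) 1
  zbar_pos : 0 < M.zbar
  /-- The support of `p t` is an interval with interior `(-zlow, zbar)`, or it is finite with least
  element `-zlow` and greatest element `zbar`. -/
  support_eq : ∀ t, 0 ≤ t →
    ((M.p t).support.OrdConnected ∧
      interior (M.p t).support = {z : ℝ | -M.zlow < z ∧ (z : EReal) < M.zbar}) ∨
    ((M.p t).support.Finite ∧ M.zbar ≠ ⊤ ∧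
      IsLeast (M.p t).support (-M.zlow) ∧ IsGreatest (M.p t).support M.zbar.toReal)
  k_nonneg : 0 ≤ k
  b_nonneg : 0 ≤ b
  integrable_return : ∀ t, 0 ≤ t → Integrable (fun z : ℝ => z) (M.p t)
  mean_nonneg : ∀ t, 0 ≤ t → 0 ≤ ∫ z, z ∂(M.p t)
  mean_le : ∀ t, 0 ≤ t → ∫ z, (1 + z) ∂(M.p t) ≤ k * Real.exp (b * t)
  continuity : ∀ w : ℝ → ℝ, Measurable w → (∃ C : ℝ, ∀ z, |w z| ≤ C * (1 + |z|)) →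
    ContinuousOn (fun t => ∫ z, w z ∂(M.p t)) (Set.Ici 0)

/-- The assumptions on the utility function and on the discount rate. -/
structure UtilityAssumptions (k b γ K₁ : ℝ) : Prop where
  rho_pos : 0 < M.rho
  strictMono : StrictMonoOn M.U (Set.Ici 0)
  strictConcave : StrictConcaveOn ℝ (Set.Ici 0) M.U
  contDiff : ContDiffOn ℝ 1 M.U (Set.Ioi 0)
  map_zero : M.U 0 = 0
  inada_zero : Tendsto (deriv M.U) (𝓝[>] 0) atTop
  inada_top : Tendsto (deriv M.U) atTop (𝓝 0)
  γ_mem : γ ∈ Set.Ioo (0 : ℝ) 1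
  K₁_pos : 0 < K₁
  growth : ∀ x, 0 ≤ x → M.U x ≤ K₁ * x ^ γ
  discount : b * γ + M.lam * (k ^ γ / M.zlow ^ γ - 1) < M.rho

end IlliquidMarket

end

/-! In the stationary case the next waiting time and the next return are independent of the past and
of each other, so at an observation time only the current wealth matters. Hence `v` should be a
fixed point of `bellman`: choose a portfolio `a`, consume at a deterministic rate, and collect `w`
of the wealth reached at an independent exponential time. Averaging over that time gives
`objective`, with discount rate `β = ρ + λ` and running reward `U(c) + λ ∫ w(y + a z) p(dz)`.

Fixed point. The iterates of `bellman` started from `0` increase. They stay monotone, concave and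
below `C x^γ`; the constant `C` reproduces itself because `λ (k / zlow)^γ < ρ + λ`. By monotone
convergence the limit is a fixed point (`bellman_limitValue`). It equals `v`
(`value_eq_limitValue`). Indeed, between two observations a predictable rate is a function of time
and of the past observations, so an admissible pair is a sequence of one-period controls, and its
utility over `n` periods is at most the `n`-th iterate. Conversely, near-optimal one-period controls
can be chosen measurably in the wealth, and together they form an admissible pair.

Fixed portfolio. Write `φ = v̂(·, a)`, `G(y) = λ ∫ v(y + a z) p(dz)` and `Ũ(p) = sup_c (U(c) - p
c)`. Since `φ` is concave, it has one-sided derivatives `φ'₊ ≤ φ'₋`. Consuming at a constant rate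
for a short time gives `Ũ(φ'₊) ≤ β φ - G`; estimating an arbitrary plan through the supergradient
`φ'₋` gives `β φ - G ≤ Ũ(φ'₋)`. As `Ũ` is strictly decreasing, the two derivatives agree and the
Hamilton-Jacobi-Bellman equation `Ũ(φ') = β φ - G` holds classically
(`ConsumptionValue.exists_hasDerivAt`), with no detour through viscosity solutions.

From `φ` to `v` and back. An optimal portfolio exists by upper semicontinuity on a compact interval.
It is interior (`exists_controlValue_lt`): scaling a boundary portfolio by `1 - δ` costs `O(δ)` and
frees wealth `δ x`, which yields utility of order `U(δ x)`, and `U(h)/h → ∞`. So at each `x > 0` the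
concave `v` is touched from below by a differentiable `v̂(·, a)`; hence `v` is differentiable, and
the derivative of a concave function is continuous. Then `G` is `C¹` by dominated convergence
(`hasDerivAt_expectedNext`), and `φ' = Ũ⁻¹(β φ - G)` makes `φ` of class `C²`. The derivatives
explode at the left ends because consuming a surplus `h` over one unit of time already gains a fixed
multiple of `U(h)`. -/

/-! ### Utility functions, the inverse marginal utility and the convex conjugate -/

/-- A utility function on `[0, ∞)` satisfying the Inada conditions. -/
structure InadaUtility (U : ℝ → ℝ) : Prop where
  strictMono : StrictMonoOn U (Set.Ici 0)
  strictConcave : StrictConcaveOn ℝ (Set.Ici 0) U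
  contDiff : ContDiffOn ℝ 1 U (Set.Ioi 0)
  map_zero : U 0 = 0
  inada_zero : Tendsto (deriv U) (𝓝[>] 0) atTop
  inada_top : Tendsto (deriv U) atTop (𝓝 0)
  tendsto_zero : Tendsto U (𝓝[>] 0) (𝓝 0)

namespace InadaUtility

variable {U : ℝ → ℝ} (hU : InadaUtility U)
include hU

theorem nonneg {x : ℝ} (hx : 0 ≤ x) : 0 ≤ U x := by
  have := hU.strictMono.monotoneOn (mem_Ici.2 le_rfl) (mem_Ici.2 hx) hx
  rwa [hU.map_zero] at this

theorem hasDerivAt {x : ℝ} (hx : 0 < x) : HasDerivAt U (deriv U x) x :=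
  ((hU.contDiff.differentiableOn one_ne_zero).differentiableAt (Ioi_mem_nhds hx)).hasDerivAt

theorem continuousOn_deriv : ContinuousOn (deriv U) (Ioi 0) :=
  hU.contDiff.continuousOn_deriv_of_isOpen isOpen_Ioi le_rfl

theorem strictAntiOn_deriv : StrictAntiOn (deriv U) (Ioi 0) :=
  (hU.strictConcave.subset Ioi_subset_Ici_self (convex_Ioi 0)).strictAntiOn_deriv
    fun _ hx => (hU.hasDerivAt hx).differentiableAt

theorem le_tangent {x c : ℝ} (hx : 0 < x) (hc : 0 ≤ c) :
    U c ≤ U x + deriv U x * (c - x) := by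
  have hcc := hU.strictConcave.concaveOn
  rcases lt_trichotomy c x with h | rfl | h
  · have := hcc.le_slope_of_hasDerivAt (mem_Ici.2 hc) (mem_Ici.2 hx.le) h (hU.hasDerivAt hx)
    rw [slope_def_field, le_div_iff₀ (by linarith)] at this
    linarith
  · simp
  · have := hcc.slope_le_of_hasDerivAt (mem_Ici.2 hx.le) (mem_Ici.2 hc) h (hU.hasDerivAt hx)
    rw [slope_def_field, div_le_iff₀ (by linarith)] at this
    linarith

theorem deriv_pos {x : ℝ} (hx : 0 < x) : 0 < deriv U x := by
  have h1 := hU.le_tangent hx (by linarith : (0 : ℝ) ≤ x + 1)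
  have h2 := hU.strictMono (mem_Ici.2 hx.le) (mem_Ici.2 (by linarith)) (lt_add_one x)
  linarith

theorem exists_deriv_eq {p : ℝ} (hp : 0 < p) : ∃ x, 0 < x ∧ deriv U x = p := by
  obtain ⟨x, hx, hx0⟩ := ((hU.inada_zero.eventually_ge_atTop p).and self_mem_nhdsWithin).exists
  obtain ⟨y, hy, hyx⟩ := ((hU.inada_top.eventually (gt_mem_nhds hp)).and
    (eventually_ge_atTop x)).exists
  have hsub : Icc x y ⊆ Ioi 0 := fun z hz => lt_of_lt_of_le hx0 hz.1
  obtain ⟨z, hz, hzp⟩ := intermediate_value_Icc' hyx (hU.continuousOn_deriv.mono hsub)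
    ⟨hy.le, hx⟩
  exact ⟨z, hsub hz, hzp⟩

omit hU in
open Classical in
/-- The inverse of the marginal utility. -/
noncomputable def _root_.inverseMarginal (U : ℝ → ℝ) (p : ℝ) : ℝ :=
  if h : ∃ x, 0 < x ∧ deriv U x = p then h.choose else 0

theorem inverseMarginal_pos {p : ℝ} (hp : 0 < p) : 0 < inverseMarginal U p := by
  have h := hU.exists_deriv_eq hp
  rw [inverseMarginal, dif_pos h]
  exact h.choose_spec.1

theorem deriv_inverseMarginal {p : ℝ} (hp : 0 < p) : deriv U (inverseMarginal U p) = p := by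
  have h := hU.exists_deriv_eq hp
  rw [inverseMarginal, dif_pos h]
  exact h.choose_spec.2

theorem inverseMarginal_deriv {x : ℝ} (hx : 0 < x) : inverseMarginal U (deriv U x) = x :=
  hU.strictAntiOn_deriv.injOn (hU.inverseMarginal_pos (hU.deriv_pos hx)) hx
    (hU.deriv_inverseMarginal (hU.deriv_pos hx))

theorem strictAntiOn_inverseMarginal : StrictAntiOn (inverseMarginal U) (Ioi 0) := by
  intro p hp q hq hpq
  by_contra! h
  have := hU.strictAntiOn_deriv.antitoneOn (hU.inverseMarginal_pos hp)
    (hU.inverseMarginal_pos hq) h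
  rw [hU.deriv_inverseMarginal hp, hU.deriv_inverseMarginal hq] at this
  exact absurd hpq (not_lt.2 this)

/-- A strictly monotone function whose image is a neighbourhood of one of its values is continuous
there; the inverse marginal utility attains every positive number. -/
theorem continuousOn_inverseMarginal : ContinuousOn (inverseMarginal U) (Ioi 0) := by
  intro p hp
  have hm : StrictMonoOn (fun q => -inverseMarginal U q) (Ioi 0) :=
    fun a ha b hb hab => neg_lt_neg (hU.strictAntiOn_inverseMarginal ha hb hab)
  have : ContinuousAt (fun q => -inverseMarginal U q) p := by
    refine hm.continuousAt_of_image_mem_nhds (Ioi_mem_nhds hp) ?_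
    have : Iio 0 ⊆ (fun q => -inverseMarginal U q) '' Ioi 0 := by
      intro y hy
      refine ⟨deriv U (-y), hU.deriv_pos (neg_pos.2 hy), ?_⟩
      simp [hU.inverseMarginal_deriv (neg_pos.2 hy)]
    exact mem_of_superset (Iio_mem_nhds (neg_lt_zero.2 (hU.inverseMarginal_pos hp))) this
  have := this.neg
  simp only [Pi.neg_def, neg_neg] at this
  exact this.continuousWithinAt

omit hU in
/-- The convex conjugate `sup_{c ≥ 0} (U c - p c)` of the utility, for `p > 0`. -/
noncomputable def _root_.utilityConjugate (U : ℝ → ℝ) (p : ℝ) : ℝ :=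
  U (inverseMarginal U p) - p * inverseMarginal U p

theorem le_conjugate {p c : ℝ} (hp : 0 < p) (hc : 0 ≤ c) : U c ≤ utilityConjugate U p + p * c := by
  have := hU.le_tangent (hU.inverseMarginal_pos hp) hc
  rw [hU.deriv_inverseMarginal hp] at this
  rw [utilityConjugate]
  linarith

theorem conjugate_nonneg {p : ℝ} (hp : 0 < p) : 0 ≤ utilityConjugate U p := by
  have := hU.le_conjugate hp le_rfl
  rw [hU.map_zero] at this
  linarith

/-- `-inverseMarginal U p` is a subgradient of the conjugate at `p`: the maximiser for `p` is a
competitor in the supremum for `q`. Strict monotonicity and differentiability of the conjugate both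
follow from this inequality alone. -/
theorem conjugate_sub_le {p q : ℝ} (hp : 0 < p) (hq : 0 < q) :
    utilityConjugate U p - utilityConjugate U q ≤ -(p - q) * inverseMarginal U p := by
  have := hU.le_conjugate hq (hU.inverseMarginal_pos hp).le
  rw [utilityConjugate]
  linarith

theorem strictAntiOn_conjugate : StrictAntiOn (utilityConjugate U) (Ioi 0) := by
  intro p hp q hq hpq
  have h1 := hU.conjugate_sub_le hq hp
  have h2 := mul_pos (sub_pos.2 hpq) (hU.inverseMarginal_pos hq)
  linarith

/-- The subgradient inequalities at `p` and at `q` enclose the increment, so the remainder is at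
most the variation of the inverse marginal utility times `|q - p|`. -/
theorem hasDerivAt_conjugate {p : ℝ} (hp : 0 < p) :
    HasDerivAt (utilityConjugate U) (-inverseMarginal U p) p := by
  have hc : ContinuousAt (inverseMarginal U) p :=
    (hU.continuousOn_inverseMarginal p hp).continuousAt (Ioi_mem_nhds hp)
  rw [hasDerivAt_iff_isLittleO, Asymptotics.isLittleO_iff]
  intro ε hε
  filter_upwards [Ioi_mem_nhds hp, Metric.continuousAt_iff'.1 hc ε hε] with q hq hqε
  have h1 := hU.conjugate_sub_le hq hp
  have h2 := hU.conjugate_sub_le hp hq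
  rw [Real.dist_eq] at hqε
  have h3 : |utilityConjugate U q - utilityConjugate U p - (q - p) • (-inverseMarginal U p)|
      ≤ |inverseMarginal U q - inverseMarginal U p| * |q - p| := by
    rw [← abs_mul, smul_eq_mul]
    have e : (inverseMarginal U q - inverseMarginal U p) * (q - p) =
      (q - p) * inverseMarginal U q - (q - p) * inverseMarginal U p := by ring
    rw [abs_le, e]
    have h4 := abs_nonneg ((q - p) * inverseMarginal U q - (q - p) * inverseMarginal U p)
    have h5 := neg_abs_le ((q - p) * inverseMarginal U q - (q - p) * inverseMarginal U p)
    constructor <;> linarith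
  rw [Real.norm_eq_abs, Real.norm_eq_abs]
  exact h3.trans (mul_le_mul_of_nonneg_right hqε.le (abs_nonneg _))

/-- Strict differentiability is what allows the conjugate to be inverted locally in
`ConsumptionValue.contDiffOn_two`. -/
theorem hasStrictDerivAt_conjugate {p : ℝ} (hp : 0 < p) :
    HasStrictDerivAt (utilityConjugate U) (-inverseMarginal U p) p := by
  refine hasStrictDerivAt_of_hasDerivAt_of_continuousAt
    (f' := fun q => -inverseMarginal U q) ?_ ?_
  · filter_upwards [Ioi_mem_nhds hp] with q hq using hU.hasDerivAt_conjugate hq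
  · exact ((hU.continuousOn_inverseMarginal p hp).continuousAt (Ioi_mem_nhds hp)).neg

/-- The tangent at `x`, evaluated at `0`, gives `U x / x ≥ U' x`. -/
theorem tendsto_div_atTop : Tendsto (fun x => U x / x) (𝓝[>] 0) atTop := by
  refine tendsto_atTop_mono' _ ?_ hU.inada_zero
  filter_upwards [self_mem_nhdsWithin] with x hx
  have := hU.le_tangent hx le_rfl
  rw [hU.map_zero] at this
  rw [le_div_iff₀ hx]
  linarith

/-- For small `ε`, the utility is bounded above by an affine function with constant term `ε`. -/
theorem exists_affine_le {ε : ℝ} (hε : 0 < ε) :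
    ∃ K q, 0 ≤ K ∧ K < ε ∧ 0 < q ∧ ∀ c, 0 ≤ c → U c ≤ K + q * c := by
  -- The affine bound is the tangent at a point `x` with `U x < ε`; its constant term `U x - x U' x`
  -- is smaller still.
  obtain ⟨x, hx, hx0⟩ := ((hU.tendsto_zero.eventually (gt_mem_nhds hε)).and
    self_mem_nhdsWithin).exists
  have hd := hU.deriv_pos hx0
  refine ⟨utilityConjugate U (deriv U x), deriv U x, hU.conjugate_nonneg hd, ?_, hd,
    fun c hc => hU.le_conjugate hd hc⟩
  rw [utilityConjugate, hU.inverseMarginal_deriv hx0]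
  have := mul_pos hd hx0
  linarith

theorem measurable_comp {α : Type*} [MeasurableSpace α] {c : α → ℝ} (hc : Measurable c)
    (h0 : ∀ s, 0 ≤ c s) : Measurable fun s => U (c s) := by
  -- Nothing is known about `U` on negative numbers, hence the truncation.
  have hm : Monotone fun x => U (max x 0) := fun x y hxy =>
    hU.strictMono.monotoneOn (mem_Ici.2 (le_max_right _ _)) (mem_Ici.2 (le_max_right _ _))
      (max_le_max hxy le_rfl)
  have h : (fun s => U (c s)) = (fun x => U (max x 0)) ∘ c := by
    ext s
    simp [h0 s]
  exact h ▸ hm.measurable.comp hc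

end InadaUtility

/-! ### Differentiability of concave functions on a half-line -/

namespace ConcaveOn

variable {f : ℝ → ℝ} {l x : ℝ}

theorem exists_hasDerivWithinAt_right (hf : ConcaveOn ℝ (Ici l) f) (hx : l < x) :
    ∃ d, HasDerivWithinAt f d (Ioi x) x := by
  have h := hf.neg.hasDerivWithinAt_rightDeriv_of_mem_interior (x := x) (by simpa using hx)
  exact ⟨_, by simpa using h.neg⟩

theorem exists_hasDerivWithinAt_left (hf : ConcaveOn ℝ (Ici l) f) (hx : l < x) :
    ∃ d, HasDerivWithinAt f d (Iio x) x := by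
  have h := hf.neg.hasDerivWithinAt_leftDeriv_of_mem_interior (x := x) (by simpa using hx)
  exact ⟨_, by simpa using h.neg⟩

theorem right_le_left {dr dl : ℝ} (hf : ConcaveOn ℝ (Ici l) f) (hx : l < x)
    (hr : HasDerivWithinAt f dr (Ioi x) x) (hl : HasDerivWithinAt f dl (Iio x) x) : dr ≤ dl := by
  have h := hf.neg.leftDeriv_le_rightDeriv_of_mem_interior (x := x) (by simpa using hx)
  rw [hr.neg.derivWithin (uniqueDiffWithinAt_Ioi x), hl.neg.derivWithin (uniqueDiffWithinAt_Iio x)]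
    at h
  linarith

theorem hasDerivAt_of_left_le_right {dr dl : ℝ} (hf : ConcaveOn ℝ (Ici l) f) (hx : l < x)
    (hr : HasDerivWithinAt f dr (Ioi x) x) (hl : HasDerivWithinAt f dl (Iio x) x)
    (h : dl ≤ dr) : HasDerivAt f dr x := by
  have : dl = dr := le_antisymm h (hf.right_le_left hx hr hl)
  subst this
  have := (hasDerivWithinAt_Iio_iff_Iic.1 hl).union (hasDerivWithinAt_Ioi_iff_Ici.1 hr)
  rwa [Iic_union_Ici, hasDerivWithinAt_univ] at this

/-- A concave function touched from below by a differentiable function is differentiable. -/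
theorem hasDerivAt_of_touching {g : ℝ → ℝ} {g' : ℝ} (hf : ConcaveOn ℝ (Ici l) f) (hx : l < x)
    (hg : HasDerivAt g g' x) (hle : ∀ᶠ y in 𝓝 x, g y ≤ f y) (heq : g x = f x) :
    HasDerivAt f g' x := by
  obtain ⟨dr, hr⟩ := hf.exists_hasDerivWithinAt_right hx
  obtain ⟨dl, hl⟩ := hf.exists_hasDerivWithinAt_left hx
  have h1 : g' ≤ dr := by
    have a := hasDerivWithinAt_iff_tendsto_slope' (by simp) |>.1 (hg.hasDerivWithinAt (s := Ioi x))
    have b := hasDerivWithinAt_iff_tendsto_slope' (by simp) |>.1 hr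
    refine le_of_tendsto_of_tendsto a b ?_
    filter_upwards [nhdsWithin_le_nhds hle, self_mem_nhdsWithin] with y hy hxy
    rw [slope_def_field, slope_def_field, heq]
    exact div_le_div_of_nonneg_right (by linarith) (sub_nonneg.2 (le_of_lt hxy))
  have h2 : dl ≤ g' := by
    have a := hasDerivWithinAt_iff_tendsto_slope' (by simp) |>.1 (hg.hasDerivWithinAt (s := Iio x))
    have b := hasDerivWithinAt_iff_tendsto_slope' (by simp) |>.1 hl
    refine le_of_tendsto_of_tendsto b a ?_
    filter_upwards [nhdsWithin_le_nhds hle, self_mem_nhdsWithin] with y hy hxy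
    rw [slope_def_field, slope_def_field, heq]
    exact div_le_div_of_nonpos_of_le (sub_nonpos.2 (le_of_lt hxy)) (by linarith)
  have h3 := hf.right_le_left hx hr hl
  have := hf.hasDerivAt_of_left_le_right hx hr hl (h2.trans h1)
  rwa [le_antisymm h1 (h3.trans h2)]

/-- The derivative at `z` lies between the slopes of the chords from `z` to a point on either side.
Those slopes are continuous in `z`, and at `x` they are as close to the derivative as desired. -/
theorem continuousOn_deriv_of_differentiable (hf : ConcaveOn ℝ (Ici l) f)
    (hd : ∀ x, l < x → DifferentiableAt ℝ f x) : ContinuousOn (deriv f) (Ioi l) := by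
  intro x hx
  have hx' : l < x := hx
  refine ContinuousAt.continuousWithinAt (tendsto_order.2 ⟨fun b hb => ?_, fun b hb => ?_⟩)
  · have hs := (hasDerivWithinAt_iff_tendsto_slope' (by simp)).1
      ((hd x hx).hasDerivAt.hasDerivWithinAt (s := Ioi x))
    obtain ⟨y, hy, hxy⟩ := ((hs.eventually (lt_mem_nhds hb)).and self_mem_nhdsWithin).exists
    have hxy : x < y := hxy
    have hc : ContinuousAt (fun z => slope f z y) x := by
      simp only [slope_def_field]
      exact (continuousAt_const.sub (hd x hx).continuousAt).div
        (continuousAt_const.sub continuousAt_id) (sub_ne_zero.2 hxy.ne')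
    filter_upwards [hc.eventually (lt_mem_nhds hy), Ioi_mem_nhds hx', Iio_mem_nhds hxy]
      with z hz hlz hzy
    exact hz.trans_le (hf.slope_le_deriv (mem_Ici.2 (le_of_lt hlz))
      (mem_Ici.2 (hx'.trans hxy).le) hzy (hd z hlz))
  · have hs := (hasDerivWithinAt_iff_tendsto_slope' (by simp)).1
      ((hd x hx).hasDerivAt.hasDerivWithinAt (s := Iio x))
    obtain ⟨y, ⟨hy, hyx⟩, hly⟩ := (((hs.eventually (gt_mem_nhds hb)).and self_mem_nhdsWithin).and
      (nhdsWithin_le_nhds (Ioi_mem_nhds hx'))).exists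
    have hyx : y < x := hyx
    have hly : l < y := hly
    rw [slope_comm] at hy
    have hc : ContinuousAt (fun z => slope f y z) x := by
      simp only [slope_def_field]
      exact ((hd x hx).continuousAt.sub continuousAt_const).div
        (continuousAt_id.sub continuousAt_const) (sub_ne_zero.2 hyx.ne')
    filter_upwards [hc.eventually (gt_mem_nhds hy), Ioi_mem_nhds hyx] with z hz hyz
    have hyz : y < z := hyz
    exact (hf.deriv_le_slope (mem_Ici.2 hly.le) (mem_Ici.2 (hly.trans hyz).le) hyz
      (hd z (hly.trans hyz))).trans_lt hz

/-- For `z` near `l` the derivative dominates the slope from `z` to a fixed `y`, and this tends to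
the slope from `l` to `y`, which exceeds any given bound when `y` is close to `l`. -/
theorem tendsto_deriv_atTop (hf : ConcaveOn ℝ (Ici l) f)
    (hd : ∀ x, l < x → DifferentiableAt ℝ f x) (hc : ContinuousWithinAt f (Ici l) l)
    (hs : Tendsto (slope f l) (𝓝[>] l) atTop) : Tendsto (deriv f) (𝓝[>] l) atTop := by
  rw [tendsto_atTop]
  intro A
  obtain ⟨y, hy, hly⟩ := ((hs.eventually_gt_atTop A).and self_mem_nhdsWithin).exists
  have hly : l < y := hly
  have hc' : Tendsto (fun z => slope f z y) (𝓝[>] l) (𝓝 (slope f l y)) := by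
    simp only [slope_def_field]
    exact (tendsto_const_nhds.sub (hc.mono Ioi_subset_Ici_self)).div
      (tendsto_const_nhds.sub (tendsto_id.mono_left nhdsWithin_le_nhds)) (sub_ne_zero.2 hly.ne')
  filter_upwards [hc'.eventually (lt_mem_nhds hy), self_mem_nhdsWithin,
    nhdsWithin_le_nhds (Iio_mem_nhds hly)] with z hz hlz hzy
  have hlz : l < z := hlz
  exact hz.le.trans (hf.slope_le_deriv (mem_Ici.2 hlz.le) (mem_Ici.2 hly.le) hzy (hd z hlz))

end ConcaveOn

/-! ### The Hamilton-Jacobi-Bellman equation from dynamic programming inequalities -/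

/-- Dynamic programming inequalities for the value `φ` of optimally consuming a wealth above the
level `l`, with discount rate `β`, utility `U` and running reward `G`. -/
structure ConsumptionValue (U φ G : ℝ → ℝ) (β l : ℝ) : Prop where
  concave : ConcaveOn ℝ (Ici l) φ
  -- Starting from `y + c h`, consume at rate `c` for a time `h`: the wealth stays above `y`, so for
  -- increasing `G` the running reward is at least `U c + G y`, and `y` is left at the end.
  le_value : ∀ y, l ≤ y → ∀ c, 0 ≤ c → ∀ h, 0 ≤ h →
    (1 - Real.exp (-β * h)) / β * (U c + G y) + Real.exp (-β * h) * φ y ≤ φ (y + c * h)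
  -- If `p` is a supergradient at `y` on the left, consuming a total `C` during `h` lowers the
  -- continuation value by at least `p C`. The factor `exp (-β h)` in the bound on `U` makes the
  -- utility's linear part cancel exactly against the discounted loss.
  value_le : ∀ y, l ≤ y → ∀ p, 0 < p → (∀ y', l ≤ y' → y' ≤ y → φ y' ≤ φ y + p * (y' - y)) →
    ∀ h, 0 < h → ∀ K, (∀ c, 0 ≤ c → U c ≤ K + p * Real.exp (-β * h) * c) → β * φ y ≤ K + G y
  -- The infinite-horizon version: total consumption never exceeds `y - l`.
  value_le_affine : ∀ y, l ≤ y → ∀ K q, 0 ≤ q → (∀ c, 0 ≤ c → U c ≤ K + q * c) →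
    φ y ≤ (K + G y) / β + q * (y - l)

namespace ConsumptionValue

variable {U φ G : ℝ → ℝ} {β l : ℝ}

/-- The value function is differentiable and satisfies the Hamilton-Jacobi-Bellman equation. -/
theorem exists_hasDerivAt (h : ConsumptionValue U φ G β l) (hU : InadaUtility U) (hβ : 0 < β)
    {y : ℝ} (hy : l < y) :
    ∃ d, 0 < d ∧ HasDerivAt φ d y ∧ utilityConjugate U d = β * φ y - G y := by
  obtain ⟨dr, hr⟩ := h.concave.exists_hasDerivWithinAt_right hy
  obtain ⟨dl, hl⟩ := h.concave.exists_hasDerivWithinAt_left hy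
  have hrl := h.concave.right_le_left hy hr hl
  have hright : ∀ y', y < y' → φ y' ≤ φ y + dr * (y' - y) := by
    intro y' hy'
    have := h.concave.slope_le_of_hasDerivWithinAt_Ioi (mem_Ici.2 hy.le)
      (mem_Ici.2 (hy.trans hy').le) hy' hr
    rw [slope_def_field, div_le_iff₀ (by linarith)] at this
    linarith
  -- This is `le_value` with `h = t / β`, combined with the right tangent of `φ` at `y`. The last
  -- factor tends to `1` as `t` tends to `0`.
  have key : ∀ c, 0 < c → ∀ t, 0 < t → U c + G y - β * φ y ≤ c * dr * (t / (1 - Real.exp (-t))) := by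
    intro c hc t ht
    have e1 : Real.exp (-t) < 1 := by simpa using ht
    have h1 := h.le_value y hy.le c hc.le (t / β) (by positivity)
    have h2 := hright (y + c * (t / β)) (by have : 0 < c * (t / β) := by positivity
                                            linarith)
    have e2 : -β * (t / β) = -t := by field_simp
    rw [e2] at h1
    rw [mul_div_assoc', le_div_iff₀ (by linarith)]
    have h3 := h1.trans h2
    have e3 : dr * (y + c * (t / β) - y) = dr * c * t / β := by ring
    have e4 : (1 - Real.exp (-t)) / β * (U c + G y) + Real.exp (-t) * φ y =
      ((U c + G y - β * φ y) * (1 - Real.exp (-t))) / β + φ y := by field_simp; ring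
    rw [e3, e4] at h3
    have h4 : ((U c + G y - β * φ y) * (1 - Real.exp (-t))) / β ≤ dr * c * t / β := by linarith
    rw [div_le_div_iff_of_pos_right hβ] at h4
    linarith
  -- Let `c₀ = β (y - l)`. The affine bound with the tangent of `U` at `c₀` gives `β φ y ≤ U c₀ + G
  -- y`, whereas `dr ≤ 0` and `key` at rate `c₀ + 1` would give `U (c₀ + 1) + G y ≤ β φ y`.
  have hpos : 0 < dr := by
    by_contra! hneg
    have hc0 : 0 < β * (y - l) := mul_pos hβ (sub_pos.2 hy)
    have hq := hU.deriv_pos hc0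
    have h1 := key (β * (y - l) + 1) (by linarith) 1 one_pos
    have h2 : (β * (y - l) + 1) * dr * (1 / (1 - Real.exp (-1))) ≤ 0 := by
      refine mul_nonpos_of_nonpos_of_nonneg
        (mul_nonpos_of_nonneg_of_nonpos (by linarith) hneg) ?_
      have : Real.exp (-1) < 1 := by simp
      exact (div_pos one_pos (by linarith)).le
    have h3 := h.value_le_affine y hy.le _ _ hq.le (fun c hc => hU.le_conjugate hq hc)
    rw [utilityConjugate, hU.inverseMarginal_deriv hc0] at h3
    have h4 := hU.strictMono (mem_Ici.2 hc0.le) (mem_Ici.2 (by linarith)) (lt_add_one (β * (y - l)))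
    have h5 : β * φ y ≤ U (β * (y - l)) + G y := by
      have := mul_le_mul_of_nonneg_left h3 hβ.le
      refine this.trans (le_of_eq ?_)
      field_simp
      ring
    linarith
  -- Use `key` at the rate that attains the conjugate, with `t / (1 - exp (-t)) ≤ 1 + t`, and let
  -- `t` tend to `0`.
  have hB : utilityConjugate U dr ≤ β * φ y - G y := by
    have hc := hU.inverseMarginal_pos hpos
    have h1 : ∀ t, 0 < t → U (inverseMarginal U dr) + G y - β * φ y ≤
        inverseMarginal U dr * dr * (1 + t) := by
      intro t ht
      refine (key _ hc t ht).trans (mul_le_mul_of_nonneg_left ?_ (mul_pos hc hpos).le)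
      have e1 : Real.exp (-t) < 1 := by simpa using ht
      rw [div_le_iff₀ (by linarith)]
      have e2 := Real.add_one_le_exp t
      have e3 : Real.exp (-t) ≤ 1 / (1 + t) := by
        rw [Real.exp_neg, ← one_div]
        exact one_div_le_one_div_of_le (by linarith) (by linarith)
      have e4 : 1 / (1 + t) * (1 + t) = 1 := by field_simp
      nlinarith
    have h2 : U (inverseMarginal U dr) + G y - β * φ y ≤ inverseMarginal U dr * dr := by
      refine le_of_forall_pos_le_add fun ε hε => ?_
      have hm := mul_pos hc hpos
      have := h1 (ε / (inverseMarginal U dr * dr)) (by positivity)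
      refine this.trans (le_of_eq ?_)
      field_simp
    rw [utilityConjugate]
    linarith
  have hlpos := hpos.trans_le hrl
  -- The left derivative is a supergradient on `[l, y]`. `value_le` then applies with the conjugate
  -- at `dl * exp (-β t)` as constant, and the conjugate is continuous as `t` tends to `0`.
  have hC : β * φ y - G y ≤ utilityConjugate U dl := by
    have hsup : ∀ y', l ≤ y' → y' ≤ y → φ y' ≤ φ y + dl * (y' - y) := by
      intro y' hl' hy'
      rcases hy'.eq_or_lt with rfl | hy'
      · simp
      have := h.concave.le_slope_of_hasDerivWithinAt_Iio (mem_Ici.2 hl')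
        (mem_Ici.2 hy.le) hy' hl
      rw [slope_def_field, le_div_iff₀ (by linarith)] at this
      linarith
    have h1 : ∀ t, 0 < t → β * φ y - G y ≤ utilityConjugate U (dl * Real.exp (-β * t)) := by
      intro t ht
      have := h.value_le y hy.le dl hlpos hsup t ht _
        (fun c hc => hU.le_conjugate (mul_pos hlpos (Real.exp_pos _)) hc)
      linarith
    have h2 : ContinuousAt (fun t => utilityConjugate U (dl * Real.exp (-β * t))) 0 := by
      refine ContinuousAt.comp (g := utilityConjugate U) ?_ (by fun_prop)
      simpa using (hU.hasDerivAt_conjugate hlpos).continuousAt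
    have h3 : Tendsto (fun t => utilityConjugate U (dl * Real.exp (-β * t))) (𝓝[>] 0)
        (𝓝 (utilityConjugate U dl)) := by
      have := h2.tendsto.mono_left (nhdsWithin_le_nhds (s := Ioi 0))
      simpa using this
    exact ge_of_tendsto h3 (by filter_upwards [self_mem_nhdsWithin] with t ht using h1 t ht)
  -- `hB` and `hC` give conjugate at `dr` ≤ conjugate at `dl`, so `dr < dl` would contradict its
  -- strict decrease.
  have hle : dl ≤ dr := by
    by_contra! hlt
    have := hU.strictAntiOn_conjugate hpos hlpos hlt
    linarith
  have heq := le_antisymm hle hrl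
  subst heq
  exact ⟨dl, hpos, h.concave.hasDerivAt_of_left_le_right hy hr hl le_rfl, le_antisymm hB hC⟩

theorem differentiableAt (h : ConsumptionValue U φ G β l) (hU : InadaUtility U) (hβ : 0 < β)
    {y : ℝ} (hy : l < y) : DifferentiableAt ℝ φ y := by
  obtain ⟨d, -, hd, -⟩ := h.exists_hasDerivAt hU hβ hy
  exact hd.differentiableAt

theorem deriv_pos (h : ConsumptionValue U φ G β l) (hU : InadaUtility U) (hβ : 0 < β)
    {y : ℝ} (hy : l < y) : 0 < deriv φ y := by
  obtain ⟨d, h0, hd, -⟩ := h.exists_hasDerivAt hU hβ hy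
  rwa [hd.deriv]

theorem conjugate_deriv (h : ConsumptionValue U φ G β l) (hU : InadaUtility U) (hβ : 0 < β)
    {y : ℝ} (hy : l < y) : utilityConjugate U (deriv φ y) = β * φ y - G y := by
  obtain ⟨d, h0, hd, he⟩ := h.exists_hasDerivAt hU hβ hy
  rwa [hd.deriv]

theorem continuousOn_deriv (h : ConsumptionValue U φ G β l) (hU : InadaUtility U) (hβ : 0 < β) :
    ContinuousOn (deriv φ) (Ioi l) :=
  h.concave.continuousOn_deriv_of_differentiable fun _ hx => h.differentiableAt hU hβ hx

/-- The value function is of class `C²` when the running reward is of class `C¹`. -/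
theorem contDiffOn_two (h : ConsumptionValue U φ G β l) (hU : InadaUtility U) (hβ : 0 < β)
    {G' : ℝ → ℝ} (hG : ∀ y, l < y → HasDerivAt G (G' y) y) (hG' : ContinuousOn G' (Ioi l)) :
    ContDiffOn ℝ 2 φ (Ioi l) := by
  have hc := h.continuousOn_deriv hU hβ
  have hd : ∀ y, l < y → HasDerivAt (deriv φ)
      ((-inverseMarginal U (deriv φ y))⁻¹ * (β * deriv φ y - G' y)) y := by
    intro y hy
    have hp := h.deriv_pos hU hβ hy
    have hs := hU.hasStrictDerivAt_conjugate hp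
    have hne : -inverseMarginal U (deriv φ y) ≠ 0 := neg_ne_zero.2 (hU.inverseMarginal_pos hp).ne'
    -- Near `y`, the equation can be solved for `φ'` by the local inverse of the conjugate, applied
    -- to the differentiable function `β φ - G`. Continuity of `φ'` keeps `φ'` within the range
    -- where this inverse is valid.
    have h1 := (hs.to_localInverse hne).hasDerivAt
    rw [h.conjugate_deriv hU hβ hy] at h1
    have h2 : HasDerivAt (fun y => β * φ y - G y) (β * deriv φ y - G' y) y :=
      ((h.differentiableAt hU hβ hy).hasDerivAt.const_mul β).sub (hG y hy)
    refine (h1.comp y h2).congr_of_eventuallyEq ?_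
    have hca : ContinuousAt (deriv φ) y := (hc y hy).continuousAt (Ioi_mem_nhds hy)
    filter_upwards [hca.eventually (hs.eventually_left_inverse hne), Ioi_mem_nhds hy] with z hz hlz
    rw [Function.comp_apply, ← h.conjugate_deriv hU hβ hlz, hz]
  have e : (2 : WithTop ℕ∞) = 1 + 1 := by norm_num
  rw [e, contDiffOn_succ_iff_deriv_of_isOpen isOpen_Ioi]
  refine ⟨fun y hy => (h.differentiableAt hU hβ hy).differentiableWithinAt, by simp, ?_⟩
  have e : (1 : WithTop ℕ∞) = 0 + 1 := by norm_num
  rw [e, contDiffOn_succ_iff_deriv_of_isOpen isOpen_Ioi]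
  refine ⟨fun y hy => (hd y hy).differentiableAt.differentiableWithinAt, by simp, ?_⟩
  rw [contDiffOn_zero]
  refine ContinuousOn.congr (f := fun y => (-inverseMarginal U (deriv φ y))⁻¹ *
    (β * deriv φ y - G' y)) ?_ fun y hy => (hd y hy).deriv
  refine ContinuousOn.mul (ContinuousOn.inv₀ ?_ ?_) ((hc.const_smul β).sub hG')
  · exact (hU.continuousOn_inverseMarginal.comp hc fun y hy => h.deriv_pos hU hβ hy).neg
  · exact fun y hy => neg_ne_zero.2 (hU.inverseMarginal_pos (h.deriv_pos hU hβ hy)).ne'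

theorem le_value_self (h : ConsumptionValue U φ G β l) (hU : InadaUtility U) (hβ : 0 < β)
    {y : ℝ} (hy : l ≤ y) : G y ≤ β * φ y := by
  have h1 := h.le_value y hy 0 le_rfl 1 zero_le_one
  have e : Real.exp (-β * 1) < 1 := by simpa using hβ
  simp only [hU.map_zero, zero_add, zero_mul, add_zero] at h1
  have h2 : (1 - Real.exp (-β * 1)) * (G y / β) ≤ (1 - Real.exp (-β * 1)) * φ y := by
    have : (1 - Real.exp (-β * 1)) / β * G y = (1 - Real.exp (-β * 1)) * (G y / β) := by ring
    linarith
  have h3 := le_of_mul_le_mul_left h2 (by linarith)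
  rw [div_le_iff₀ hβ] at h3
  linarith

/-- At the left end nothing can be consumed, so the affine bound reduces to `(K + G l) / β`, with
`K` arbitrarily small. -/
theorem value_left (h : ConsumptionValue U φ G β l) (hU : InadaUtility U) (hβ : 0 < β) :
    β * φ l = G l := by
  refine le_antisymm (le_of_forall_pos_le_add fun ε hε => ?_) (h.le_value_self hU hβ le_rfl)
  obtain ⟨K, q, -, hK, hq, hle⟩ := hU.exists_affine_le hε
  have := h.value_le_affine l le_rfl K q hq.le hle
  rw [sub_self, mul_zero, add_zero, le_div_iff₀ hβ] at this
  linarith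

theorem continuousWithinAt_left (h : ConsumptionValue U φ G β l) (hU : InadaUtility U)
    (hβ : 0 < β) (hm : MonotoneOn φ (Ici l)) (hG : ContinuousWithinAt G (Ici l) l) :
    ContinuousWithinAt φ (Ici l) l := by
  have hl := h.value_left hU hβ
  refine tendsto_order.2 ⟨fun b hb => ?_, fun b hb => ?_⟩
  · filter_upwards [self_mem_nhdsWithin] with y hy
    exact hb.trans_le (hm (mem_Ici.2 le_rfl) hy hy)
  · obtain ⟨K, q, -, hK, hq, hle⟩ := hU.exists_affine_le (mul_pos hβ (sub_pos.2 hb))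
    have ht : ContinuousWithinAt (fun y => (K + G y) / β + q * (y - l)) (Ici l) l :=
      ((continuousWithinAt_const.add hG).div_const β).add (by fun_prop)
    have hlt : (K + G l) / β + q * (l - l) < b := by
      rw [sub_self, mul_zero, add_zero, div_lt_iff₀ hβ]
      linarith
    filter_upwards [ht.tendsto.eventually (gt_mem_nhds hlt), self_mem_nhdsWithin] with y hy hly
    exact (h.value_le_affine y hly K q hq.le hle).trans_lt hy

/-- The marginal value explodes at the left end. -/
theorem tendsto_deriv_atTop (h : ConsumptionValue U φ G β l) (hU : InadaUtility U)
    (hβ : 0 < β) (hm : MonotoneOn φ (Ici l)) (hG : ContinuousWithinAt G (Ici l) l) :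
    Tendsto (deriv φ) (𝓝[>] l) atTop := by
  refine h.concave.tendsto_deriv_atTop (fun _ hx => h.differentiableAt hU hβ hx)
    (h.continuousWithinAt_left hU hβ hm hG) ?_
  have he : Real.exp (-β) < 1 := by simpa using hβ
  have hk : 0 < (1 - Real.exp (-β)) / β := div_pos (by linarith) hβ
  have ht : Tendsto (fun y => y - l) (𝓝[>] l) (𝓝[>] 0) := by
    refine tendsto_nhdsWithin_iff.2 ⟨?_, ?_⟩
    · have : ContinuousAt (fun y => y - l) l := by fun_prop
      have := this.tendsto.mono_left (nhdsWithin_le_nhds (s := Ioi l))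
      simpa using this
    · filter_upwards [self_mem_nhdsWithin] with y hy
      exact sub_pos.2 (show l < y from hy)
  refine tendsto_atTop_mono' _ ?_ ((hU.tendsto_div_atTop.comp ht).const_mul_atTop hk)
  filter_upwards [self_mem_nhdsWithin] with y hy
  have hy : l < y := hy
  -- Starting from `y`, consume the whole surplus `y - l` at a constant rate over one unit of time.
  have h1 := h.le_value l le_rfl (y - l) (by linarith) 1 zero_le_one
  rw [slope_def_field, Function.comp_apply, mul_div_assoc', div_le_div_iff_of_pos_right (by linarith)]
  rw [mul_one, mul_one, ← h.value_left hU hβ, add_sub_cancel] at h1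
  have : (1 - Real.exp (-β)) / β * (U (y - l) + β * φ l) + Real.exp (-β) * φ l =
    (1 - Real.exp (-β)) / β * U (y - l) + φ l := by field_simp; ring
  linarith

end ConsumptionValue

/-! ### Returns, portfolios and the largest possible loss -/

namespace IlliquidMarket

variable {Ω : Type*} [mΩ : MeasurableSpace Ω] {M : IlliquidMarket Ω} {P : Measure Ω} {k b : ℝ}

namespace ReturnAssumptions

variable (hM : M.ReturnAssumptions P k b)
include hM

theorem zlow_pos : 0 < M.zlow := hM.zlow_mem.1

theorem zbar_cases : M.zbar = ⊤ ∨ ∃ r : ℝ, 0 < r ∧ M.zbar = r := by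
  have h := hM.zbar_pos
  induction hz : M.zbar with
  | bot => simp [hz] at h
  | top => exact Or.inl rfl
  | coe r =>
    rw [hz] at h
    exact Or.inr ⟨r, by exact_mod_cast h, rfl⟩

omit hM in
theorem portfolios_nonneg_or (a : ℝ) : a ∈ M.portfolios ↔ 0 ≤ a ∨ M.zbar ≠ ⊤ := by
  rw [portfolios, mem_ofPred_eq]
  tauto

/-- A form of the definition that covers bounded and unbounded returns at once. -/
theorem l_le_iff {a x : ℝ} :
    M.l a ≤ x ↔ a * M.zlow ≤ x ∧ ∀ r : ℝ, M.zbar = r → -a * r ≤ x := by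
  rcases hM.zbar_cases with h | ⟨r, -, h⟩
  · simp [l, h]
  · simp only [l, h, EReal.coe_ne_top, if_false, EReal.toReal_coe, max_le_iff, EReal.coe_eq_coe_iff]
    simp

theorem l_nonneg {a : ℝ} (ha : a ∈ M.portfolios) : 0 ≤ M.l a := by
  have hz := hM.zlow_pos
  obtain ⟨h1, h2⟩ := (hM.l_le_iff).1 le_rfl
  rcases le_total 0 a with h | h
  · exact (mul_nonneg h hz.le).trans h1
  · rcases hM.zbar_cases with ht | ⟨r, hr, h'⟩
    · exact (mul_nonneg (ha ht) hz.le).trans h1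
    · exact (mul_nonneg (neg_nonneg.2 h) hr.le).trans (h2 r h')

omit hM in
theorem l_zero : M.l 0 = 0 := by simp [l]

omit hM in
theorem zero_mem_portfolios : (0 : ℝ) ∈ M.portfolios := fun _ => le_rfl

theorem mul_zlow_le_l {a : ℝ} : a * M.zlow ≤ M.l a :=
  ((hM.l_le_iff).1 le_rfl).1

omit hM in
theorem continuous_l : Continuous M.l := by
  unfold l
  split_ifs <;> fun_prop

omit hM in
theorem convex_portfolios : Convex ℝ M.portfolios := by
  intro a ha a' ha' s t hs ht _ h
  exact add_nonneg (mul_nonneg hs (ha h)) (mul_nonneg ht (ha' h))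

omit hM in
theorem l_combo_le {a a' s t : ℝ} (hs : 0 ≤ s) (ht : 0 ≤ t) :
    M.l (s * a + t * a') ≤ s * M.l a + t * M.l a' := by
  unfold l
  split_ifs
  · exact le_of_eq (by ring)
  · refine max_le ?_ ?_
    · have h1 := mul_le_mul_of_nonneg_left (le_max_left (a * M.zlow) (-a * M.zbar.toReal)) hs
      have h2 := mul_le_mul_of_nonneg_left (le_max_left (a' * M.zlow) (-a' * M.zbar.toReal)) ht
      linarith
    · have h1 := mul_le_mul_of_nonneg_left (le_max_right (a * M.zlow) (-a * M.zbar.toReal)) hs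
      have h2 := mul_le_mul_of_nonneg_left (le_max_right (a' * M.zlow) (-a' * M.zbar.toReal)) ht
      linarith

theorem mem_portfolioInterval {a x : ℝ} :
    a ∈ M.portfolioInterval x ↔ a ∈ M.portfolios ∧ M.l a ≤ x := by
  have hz := hM.zlow_pos
  have hp := portfolios_nonneg_or (M := M) a
  rcases hM.zbar_cases with h | ⟨r, hr, h⟩
  · rw [portfolioInterval, hp]
    simp [h, l, le_div_iff₀ hz]
  · rw [portfolioInterval, hp]
    simp only [l, h, EReal.coe_ne_top, if_false, EReal.toReal_coe, mem_Icc, le_div_iff₀ hz,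
      div_le_iff₀ hr, max_le_iff]
    constructor
    · rintro ⟨h1, h2⟩
      exact ⟨Or.inr (by simp), h2, by linarith⟩
    · rintro ⟨-, h1, h2⟩
      exact ⟨by linarith, h1⟩

theorem isProb_zero : IsProbabilityMeasure (M.p 0) := hM.isProb 0 le_rfl

theorem ae_return : ∀ᵐ z ∂M.p 0, -M.zlow ≤ z ∧ (z : EReal) ≤ M.zbar := by
  have hs : ∀ᵐ z ∂M.p 0, z ∈ (M.p 0).support := Measure.support_mem_ae
  filter_upwards [hs] with z hz
  rcases hM.support_eq 0 le_rfl with ⟨hc, hi⟩ | ⟨-, -, hl, hg⟩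
  · have hzl := hM.zlow_pos
    have h0 : (0 : ℝ) ∈ (M.p 0).support := by
      apply interior_subset
      rw [hi]
      exact ⟨by linarith, by exact_mod_cast hM.zbar_pos⟩
    constructor
    · by_contra! hlt
      -- A support point below `-zlow` would put the whole open interval from it to `0` into the
      -- interior of the support.
      have h1 : Ioo z 0 ⊆ interior (M.p 0).support :=
        interior_maximal (Ioo_subset_Icc_self.trans (hc.out hz h0)) isOpen_Ioo
      have h2 : (z + -M.zlow) / 2 ∈ Ioo z 0 := ⟨by linarith, by linarith⟩
      have := h1 h2
      rw [hi] at this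
      linarith [this.1]
    · by_contra! hlt
      have h1 : Ioo 0 z ⊆ interior (M.p 0).support :=
        interior_maximal (Ioo_subset_Icc_self.trans (hc.out h0 hz)) isOpen_Ioo
      rcases hM.zbar_cases with h | ⟨r, hr, h⟩
      · simp [h] at hlt
      · rw [h] at hlt
        have hlt : r < z := by exact_mod_cast hlt
        have h2 : (r + z) / 2 ∈ Ioo 0 z := ⟨by linarith, by linarith⟩
        have := h1 h2
        rw [hi, mem_ofPred_eq, h] at this
        have : (r + z) / 2 < r := by exact_mod_cast this.2
        linarith
  · refine ⟨hl.2 hz, ?_⟩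
    rcases hM.zbar_cases with h | ⟨r, hr, h⟩
    · simp [h]
    · have := hg.2 hz
      rw [h] at this ⊢
      exact_mod_cast this

/-- `l a` is the largest loss of the portfolio `a`: it occurs at the lowest return for long
positions and at the highest for short ones. -/
theorem neg_l_le_mul {a z : ℝ} (ha : a ∈ M.portfolios) (hz1 : -M.zlow ≤ z)
    (hz2 : (z : EReal) ≤ M.zbar) : -M.l a ≤ a * z := by
  obtain ⟨h1, h2⟩ := (hM.l_le_iff (a := a)).1 le_rfl
  rcases le_total 0 a with h | h
  · have := mul_le_mul_of_nonneg_left hz1 h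
    linarith
  · rcases hM.zbar_cases with ht | ⟨r, hr, h'⟩
    · have : a = 0 := le_antisymm h (ha ht)
      subst this
      simpa using h1
    · have h3 := h2 r h'
      rw [h'] at hz2
      have h4 : z ≤ r := by exact_mod_cast hz2
      have := mul_le_mul_of_nonneg_left h4 (neg_nonneg.2 h)
      linarith

/-- The wealth after the next observation is almost surely nonnegative if and only if the
portfolio is admissible and the wealth before is at least `l a`. -/
theorem ae_nonneg_iff {a y : ℝ} :
    (∀ᵐ z ∂M.p 0, 0 ≤ y + a * z) ↔ a ∈ M.portfolios ∧ M.l a ≤ y := by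
  have hzl := hM.zlow_pos
  constructor
  · intro h
    -- A closed set of full measure contains the support, so the constraint holds at the extreme
    -- returns even if they have no mass.
    have hS : IsClosed {z : ℝ | 0 ≤ y + a * z} := isClosed_le continuous_const (by fun_prop)
    have hsub := Measure.support_subset_of_isClosed hS h
    have hlow : 0 ≤ y + a * (-M.zlow) ∧ (∀ r : ℝ, M.zbar = r → 0 ≤ y + a * r) ∧
        (M.zbar = ⊤ → 0 ≤ a) := by
      rcases hM.support_eq 0 le_rfl with ⟨-, hi⟩ | ⟨-, hne, hl, hg⟩
      · have hsub' := interior_subset.trans hsub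
        rw [hi] at hsub'
        rcases hM.zbar_cases with h | ⟨r, hr, h⟩
        · have hIoi : Ioi (-M.zlow) ⊆ {z : ℝ | 0 ≤ y + a * z} :=
            fun z hz => hsub' ⟨hz, by simp [h]⟩
          refine ⟨?_, by simp [h], fun _ => ?_⟩
          · have := closure_minimal hIoi hS
            rw [closure_Ioi] at this
            exact this (mem_Ici.2 le_rfl)
          · by_contra! ha
            -- With unbounded returns a short position is ruined: at this return the gain is `-(|y|
            -- + 1)`.
            have : (|y| + 1) / (-a) ∈ Ioi (-M.zlow) := by
              have : 0 < (|y| + 1) / (-a) := div_pos (by positivity) (by linarith)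
              exact mem_Ioi.2 (by linarith)
            have := hIoi this
            rw [mem_ofPred_eq] at this
            have e : a * ((|y| + 1) / (-a)) = -(|y| + 1) := by
              have : a ≠ 0 := ha.ne
              field_simp
            have := le_abs_self y
            linarith
        · have hIoo : Ioo (-M.zlow) r ⊆ {z : ℝ | 0 ≤ y + a * z} :=
            fun z hz => hsub' ⟨hz.1, by rw [h]; exact_mod_cast hz.2⟩
          have := closure_minimal hIoo hS
          rw [closure_Ioo (by linarith)] at this
          refine ⟨this (left_mem_Icc.2 (by linarith)), ?_, by simp [h]⟩
          intro r' h'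
          rw [h, EReal.coe_eq_coe_iff] at h'
          exact h' ▸ this (right_mem_Icc.2 (by linarith))
      · refine ⟨hsub hl.1, ?_, fun h => absurd h hne⟩
        intro r hr
        have := hsub hg.1
        rwa [hr] at this
    have ha : a ∈ M.portfolios := hlow.2.2
    refine ⟨ha, (hM.l_le_iff).2 ⟨by linarith [hlow.1], fun r hr => ?_⟩⟩
    linarith [hlow.2.1 r hr]
  · rintro ⟨ha, hl⟩
    filter_upwards [hM.ae_return] with z hz
    linarith [hM.neg_l_le_mul ha hz.1 hz.2]

theorem one_le_k : 1 ≤ k := by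
  have := hM.isProb_zero
  have h1 := hM.mean_le 0 le_rfl
  have h2 := hM.mean_nonneg 0 le_rfl
  rw [integral_add (integrable_const _) (hM.integrable_return 0 le_rfl)] at h1
  simp at h1
  linarith

theorem mean_le_sub_one : ∫ z, z ∂(M.p 0) ≤ k - 1 := by
  have := hM.isProb_zero
  have h1 := hM.mean_le 0 le_rfl
  rw [integral_add (integrable_const _) (hM.integrable_return 0 le_rfl)] at h1
  simp at h1
  linarith

theorem integrable_affine (x a : ℝ) : Integrable (fun z => x + a * z) (M.p 0) := by
  have := hM.isProb_zero
  exact (integrable_const x).add ((hM.integrable_return 0 le_rfl).const_mul a)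

/-- The expected wealth after the next observation. -/
theorem integral_affine_le {x a : ℝ} (ha : a ∈ M.portfolios) (hl : M.l a ≤ x) :
    ∫ z, x + a * z ∂(M.p 0) ≤ k / M.zlow * x := by
  have := hM.isProb_zero
  have hz := hM.zlow_mem
  have hx : 0 ≤ x := (hM.l_nonneg ha).trans hl
  have h1 := hM.mean_le_sub_one
  have h2 := hM.mean_nonneg 0 le_rfl
  rw [integral_add (integrable_const _) ((hM.integrable_return 0 le_rfl).const_mul a),
    integral_const_mul]
  simp only [integral_const, probReal_univ, smul_eq_mul, one_mul]
  -- Nonnegativity of the mean return allows `a` to be replaced by its largest value `x / zlow`;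
  -- then `x ≤ x / zlow`, as `zlow ≤ 1`, makes the two terms add up to `k x / zlow`.
  have h3 : a ≤ x / M.zlow := by
    rw [le_div_iff₀ hz.1]
    exact (hM.mul_zlow_le_l).trans hl
  have hxz : 0 ≤ x / M.zlow := div_nonneg hx hz.1.le
  have h4 : a * ∫ z, z ∂(M.p 0) ≤ x / M.zlow * (k - 1) :=
    (mul_le_mul_of_nonneg_right h3 h2).trans (mul_le_mul_of_nonneg_left h1 hxz)
  have h5 : x ≤ x / M.zlow := by
    rw [le_div_iff₀ hz.1]
    exact mul_le_of_le_one_right hx hz.2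
  have : k / M.zlow * x = x / M.zlow * (k - 1) + x / M.zlow := by ring
  linarith

end ReturnAssumptions

end IlliquidMarket

/-! ### Deterministic consumption plans and the dynamic programming operator -/

theorem lintegral_exp_neg_Ioi {β : ℝ} (hβ : 0 < β) :
    ∫⁻ s in Ioi (0 : ℝ), ENNReal.ofReal (Real.exp (-β * s)) = ENNReal.ofReal (1 / β) := by
  rw [← ofReal_integral_eq_lintegral_ofReal (exp_neg_integrableOn_Ioi 0 hβ)
    (ae_of_all _ fun _ => (Real.exp_pos _).le), integral_exp_mul_Ioi (by linarith)]
  simp [neg_div_neg_eq]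

theorem lintegral_exp_neg_Ioc {β h : ℝ} (hβ : 0 < β) (hh : 0 ≤ h) :
    ∫⁻ s in Ioc (0 : ℝ) h, ENNReal.ofReal (Real.exp (-β * s)) =
      ENNReal.ofReal ((1 - Real.exp (-β * h)) / β) := by
  have hi : IntegrableOn (fun s => Real.exp (-β * s)) (Ioc 0 h) :=
    (exp_neg_integrableOn_Ioi 0 hβ).mono_set Ioc_subset_Ioi_self
  rw [← ofReal_integral_eq_lintegral_ofReal hi (ae_of_all _ fun _ => (Real.exp_pos _).le),
    ← intervalIntegral.integral_of_le hh, intervalIntegral.integral_comp_mul_left (fun x => Real.exp x) (neg_ne_zero.2 hβ.ne')]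
  congr 1
  rw [integral_exp, smul_eq_mul]
  have := hβ.ne'
  field_simp
  simp

namespace IlliquidMarket

variable {Ω : Type*} [mΩ : MeasurableSpace Ω] {M : IlliquidMarket Ω}

namespace IsConsumption

variable {t x a : ℝ} {c : ℝ → ℝ}

theorem l_le (hc : M.IsConsumption t x a c) : M.l a ≤ x := by
  have := hc.integral_le t le_rfl
  rw [intervalIntegral.integral_same] at this
  linarith

theorem intervalIntegrable (hc : M.IsConsumption 0 x a c) {r s : ℝ} (hr : 0 ≤ r) (hs : 0 ≤ s) :
    IntervalIntegrable c volume r s :=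
  (hc.integrable r hr).symm.trans (hc.integrable s hs)

theorem integral_mono (hc : M.IsConsumption 0 x a c) {r s : ℝ} (hr : 0 ≤ r) (hrs : r ≤ s) :
    ∫ u in (0 : ℝ)..r, c u ≤ ∫ u in (0 : ℝ)..s, c u := by
  rw [← intervalIntegral.integral_add_adjacent_intervals (hc.integrable r hr)
    (hc.intervalIntegrable hr (hr.trans hrs))]
  have := intervalIntegral.integral_nonneg hrs (μ := volume) fun u _ => hc.nonneg u
  linarith

theorem integral_nonneg (hc : M.IsConsumption 0 x a c) {s : ℝ} (hs : 0 ≤ s) :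
    0 ≤ ∫ u in (0 : ℝ)..s, c u :=
  intervalIntegral.integral_nonneg hs fun u _ => hc.nonneg u

theorem lintegral_Ioc (hc : M.IsConsumption 0 x a c) {s : ℝ} (hs : 0 ≤ s) :
    ∫⁻ u in Ioc 0 s, ENNReal.ofReal (c u) = ENNReal.ofReal (∫ u in (0 : ℝ)..s, c u) := by
  rw [intervalIntegral.integral_of_le hs, ofReal_integral_eq_lintegral_ofReal
    ((intervalIntegrable_iff_integrableOn_Ioc_of_le hs).1 (hc.integrable s hs))
    (ae_of_all _ hc.nonneg)]

theorem lintegral_le (hc : M.IsConsumption 0 x a c) :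
    ∫⁻ u in Ioi 0, ENNReal.ofReal (c u) ≤ ENNReal.ofReal (x - M.l a) := by
  have hU : Ioi (0 : ℝ) = ⋃ n : ℕ, Ioc 0 (n : ℝ) := by
    ext s
    simp only [mem_Ioi, mem_iUnion, mem_Ioc, exists_and_left, iff_self_and]
    exact fun _ => exists_nat_ge s
  rw [hU, setLIntegral_iUnion_of_directed]
  · refine iSup_le fun n => ?_
    rw [hc.lintegral_Ioc n.cast_nonneg]
    exact ENNReal.ofReal_le_ofReal (hc.integral_le n n.cast_nonneg)
  · refine Monotone.directed_le fun m n hmn => ?_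
    exact Ioc_subset_Ioc_right (by exact_mod_cast hmn)

theorem mono (hc : M.IsConsumption t x a c) {x' a' : ℝ} (h : x - M.l a ≤ x' - M.l a') :
    M.IsConsumption t x' a' c :=
  ⟨hc.measurable, hc.nonneg, hc.integrable, fun s hs => (hc.integral_le s hs).trans h⟩

theorem shift (hc : M.IsConsumption 0 x a c) {h : ℝ} (hh : 0 ≤ h) :
    M.IsConsumption 0 (x - ∫ u in (0 : ℝ)..h, c u) a fun s => c (s + h) where
  measurable := hc.measurable.comp (measurable_id.add_const h)
  nonneg s := hc.nonneg _
  integrable s hs := by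
    have := (hc.intervalIntegrable hh (by linarith : 0 ≤ s + h)).comp_add_right h
    simpa using this
  integral_le s hs := by
    rw [intervalIntegral.integral_comp_add_right, zero_add]
    have h1 := hc.integral_le (s + h) (by linarith)
    rw [← intervalIntegral.integral_add_adjacent_intervals (hc.integrable h hh)
      (hc.intervalIntegrable hh (by linarith : 0 ≤ s + h))] at h1
    linarith

/-- Consuming at a constant rate first. -/
theorem cons (hc : M.IsConsumption 0 x a c) {h r : ℝ} (hh : 0 ≤ h) (hr : 0 ≤ r) :
    M.IsConsumption 0 (x + r * h) a fun s => if s ≤ h then r else c (s - h) := by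
  have hi : ∀ s, h ≤ s → IntervalIntegrable (fun s => if s ≤ h then r else c (s - h)) volume h s ∧
      ∫ u in h..s, (if u ≤ h then r else c (u - h)) = ∫ u in (0 : ℝ)..s - h, c u := by
    intro s hs
    have heq : EqOn (fun u => c (u - h)) (fun s => if s ≤ h then r else c (s - h)) (uIoc h s) := by
      intro u hu
      rw [uIoc_of_le hs] at hu
      simp [not_le.2 hu.1]
    constructor
    · have := (hc.integrable (s - h) (by linarith)).comp_sub_right h
      simp only [zero_add, sub_add_cancel] at this
      exact this.congr heq
    · rw [← intervalIntegral.integral_congr_ae (ae_of_all _ fun u hu => heq hu),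
        intervalIntegral.integral_comp_sub_right, sub_self]
  have hi0 : ∀ s, 0 ≤ s → s ≤ h →
      IntervalIntegrable (fun s => if s ≤ h then r else c (s - h)) volume 0 s ∧
      ∫ u in (0 : ℝ)..s, (if u ≤ h then r else c (u - h)) = r * s := by
    intro s hs hsh
    have heq : EqOn (fun _ => r) (fun s => if s ≤ h then r else c (s - h)) (uIoc 0 s) := by
      intro u hu
      rw [uIoc_of_le hs] at hu
      simp [hu.2.trans hsh]
    constructor
    · exact intervalIntegrable_const.congr heq
    · rw [← intervalIntegral.integral_congr_ae (ae_of_all _ fun u hu => heq hu)]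
      simp [mul_comm]
  refine ⟨Measurable.ite measurableSet_Iic measurable_const
    (hc.measurable.comp (measurable_id.sub_const h)), fun s => ?_, fun s hs => ?_, fun s hs => ?_⟩
  · split_ifs
    exacts [hr, hc.nonneg _]
  · rcases le_total s h with h1 | h1
    · exact (hi0 s hs h1).1
    · exact (hi0 h hh le_rfl).1.trans (hi s h1).1
  · rcases le_total s h with h1 | h1
    · rw [(hi0 s hs h1).2]
      have := hc.l_le
      have := mul_le_mul_of_nonneg_left h1 hr
      linarith
    · rw [← intervalIntegral.integral_add_adjacent_intervals (hi0 h hh le_rfl).1 (hi s h1).1,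
        (hi0 h hh le_rfl).2, (hi s h1).2]
      have := hc.integral_le (s - h) (by linarith)
      linarith

theorem zero (h : M.l a ≤ x) : M.IsConsumption t x a fun _ => 0 :=
  ⟨measurable_const, fun _ => le_rfl, fun _ _ => intervalIntegrable_const,
    fun _ _ => by simpa using h⟩

theorem combo {x' a' : ℝ} {c' : ℝ → ℝ} (hc : M.IsConsumption 0 x a c)
    (hc' : M.IsConsumption 0 x' a' c') {r s : ℝ} (hr : 0 ≤ r) (hs : 0 ≤ s) :
    M.IsConsumption 0 (r * x + s * x') (r * a + s * a') fun u => r * c u + s * c' u where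
  measurable := (hc.measurable.const_mul r).add (hc'.measurable.const_mul s)
  nonneg u := add_nonneg (mul_nonneg hr (hc.nonneg u)) (mul_nonneg hs (hc'.nonneg u))
  integrable u hu := ((hc.integrable u hu).const_mul r).add ((hc'.integrable u hu).const_mul s)
  integral_le u hu := by
    rw [intervalIntegral.integral_add ((hc.integrable u hu).const_mul r)
      ((hc'.integrable u hu).const_mul s), intervalIntegral.integral_const_mul,
      intervalIntegral.integral_const_mul]
    have h1 := mul_le_mul_of_nonneg_left (hc.integral_le u hu) hr
    have h2 := mul_le_mul_of_nonneg_left (hc'.integral_le u hu) hs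
    have h3 := ReturnAssumptions.l_combo_le (M := M) (a := a) (a' := a') hr hs
    linarith

end IsConsumption

variable (M)

/-- The expected value of `w` at the wealth following an observation, when the wealth before is
`y` and the portfolio is `a`. -/
noncomputable def expectedNext (w : ℝ → ℝ≥0∞) (y a : ℝ) : ℝ≥0∞ := ∫⁻ z, w (y + a * z) ∂(M.p 0)

/-- The expected discounted utility up to the next observation, with terminal reward `w`. -/
noncomputable def objective (w : ℝ → ℝ≥0∞) (x a : ℝ) (c : ℝ → ℝ) : ℝ≥0∞ :=
  ∫⁻ s in Ioi (0 : ℝ), ENNReal.ofReal (Real.exp (-(M.rho + M.lam) * s)) *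
    (ENNReal.ofReal (M.U (c s)) + ENNReal.ofReal M.lam *
      M.expectedNext w (x - ∫ u in (0 : ℝ)..s, c u) a)

/-- The optimal value for a given portfolio `a`. -/
noncomputable def controlValue (w : ℝ → ℝ≥0∞) (x a : ℝ) : ℝ≥0∞ :=
  ⨆ (c : ℝ → ℝ) (_ : M.IsConsumption 0 x a c), M.objective w x a c

/-- The dynamic programming operator. -/
noncomputable def bellman (w : ℝ → ℝ≥0∞) (x : ℝ) : ℝ≥0∞ :=
  ⨆ a ∈ M.portfolioInterval x, M.controlValue w x a

variable {M}

theorem objective_le_controlValue {w : ℝ → ℝ≥0∞} {x a : ℝ} {c : ℝ → ℝ}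
    (hc : M.IsConsumption 0 x a c) : M.objective w x a c ≤ M.controlValue w x a :=
  le_iSup₂_of_le c hc le_rfl

theorem controlValue_le_bellman {w : ℝ → ℝ≥0∞} {x a : ℝ} (ha : a ∈ M.portfolioInterval x) :
    M.controlValue w x a ≤ M.bellman w x :=
  le_iSup₂_of_le a ha le_rfl

theorem expectedNext_mono {w w' : ℝ → ℝ≥0∞} (hw : Monotone w) (h : ∀ y, w y ≤ w' y) {y y' : ℝ}
    (hy : y ≤ y') (a : ℝ) : M.expectedNext w y a ≤ M.expectedNext w' y' a :=
  lintegral_mono fun z => (hw (by linarith)).trans (h _)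

theorem objective_mono {w w' : ℝ → ℝ≥0∞} (hw : Monotone w) (h : ∀ y, w y ≤ w' y) {x x' : ℝ}
    (hx : x ≤ x') (a : ℝ) (c : ℝ → ℝ) : M.objective w x a c ≤ M.objective w' x' a c := by
  refine lintegral_mono fun s => ?_
  gcongr
  exact expectedNext_mono hw h (by linarith) a

theorem controlValue_mono {w w' : ℝ → ℝ≥0∞} (hw : Monotone w) (h : ∀ y, w y ≤ w' y) {x x' : ℝ}
    (hx : x ≤ x') (a : ℝ) : M.controlValue w x a ≤ M.controlValue w' x' a :=
  iSup₂_le fun c hc => (objective_mono hw h hx a c).trans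
    (objective_le_controlValue (hc.mono (by linarith)))

theorem objective_congr {w : ℝ → ℝ≥0∞} {x a : ℝ} {c c' : ℝ → ℝ} (h : ∀ s, 0 < s → c s = c' s) :
    M.objective w x a c = M.objective w x a c' := by
  refine setLIntegral_congr_fun measurableSet_Ioi fun s hs => ?_
  rw [h s hs, intervalIntegral.integral_congr_ae (ae_of_all _ fun u hu => h u ?_)]
  rw [uIoc_of_le (le_of_lt hs)] at hu
  exact hu.1

/-- The law of motion of the objective: consume up to time `h`, then start afresh. -/
theorem objective_eq_add {w : ℝ → ℝ≥0∞} {x a : ℝ} {c : ℝ → ℝ} (hc : M.IsConsumption 0 x a c)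
    {h : ℝ} (hh : 0 ≤ h) :
    M.objective w x a c =
      (∫⁻ s in Ioc 0 h, ENNReal.ofReal (Real.exp (-(M.rho + M.lam) * s)) *
        (ENNReal.ofReal (M.U (c s)) + ENNReal.ofReal M.lam *
          M.expectedNext w (x - ∫ u in (0 : ℝ)..s, c u) a)) +
      ENNReal.ofReal (Real.exp (-(M.rho + M.lam) * h)) *
        M.objective w (x - ∫ u in (0 : ℝ)..h, c u) a fun s => c (s + h) := by
  rw [objective, ← Ioc_union_Ioi_eq_Ioi hh, lintegral_union measurableSet_Ioi
    (Ioc_disjoint_Ioi le_rfl)]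
  congr 1
  rw [objective, ← lintegral_const_mul' _ _ ENNReal.ofReal_ne_top]
  have hp : (fun s : ℝ => s + h) ⁻¹' Ioi h = Ioi 0 := by
    ext s
    simp
  rw [← (measurePreserving_add_right volume h).setLIntegral_comp_preimage_emb
    (measurableEmbedding_addRight h) _ (Ioi h), hp]
  refine setLIntegral_congr_fun measurableSet_Ioi fun s hs => ?_
  have hs : 0 < s := hs
  rw [← mul_assoc, ← ENNReal.ofReal_mul (Real.exp_pos _).le, ← Real.exp_add,
    intervalIntegral.integral_comp_add_right, zero_add, sub_sub,
    intervalIntegral.integral_add_adjacent_intervals (hc.integrable h hh)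
      (hc.intervalIntegrable hh (by linarith : 0 ≤ s + h))]
  congr 4
  ring

/-- Wealth decreases along a plan, so for monotone `w` this function of time is antitone. -/
theorem aemeasurable_expectedNext {w : ℝ → ℝ≥0∞} (hw : Monotone w) {x a : ℝ} {c : ℝ → ℝ}
    (hc : M.IsConsumption 0 x a c) :
    AEMeasurable (fun s => M.expectedNext w (x - ∫ u in (0 : ℝ)..s, c u) a)
      (volume.restrict (Ioi 0)) := by
  refine aemeasurable_restrict_of_antitoneOn measurableSet_Ioi fun r hr s hs hrs => ?_
  exact expectedNext_mono hw (fun _ => le_rfl)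
    (by linarith [hc.integral_mono (le_of_lt hr) hrs]) a

/-- Discounting is kept on the constant part and dropped on the part linear in `c`, so consumption
enters only through its total. -/
theorem lintegral_affine_le {S : Set ℝ} (hS : MeasurableSet S) (hS0 : S ⊆ Ioi 0) {β K q g : ℝ}
    (hβ : 0 < β) (hK : 0 ≤ K) (hq : 0 ≤ q) (hg : 0 ≤ g) {c : ℝ → ℝ}
    (hc0 : ∀ s, 0 ≤ c s) {U : ℝ → ℝ} (hU : ∀ r, 0 ≤ r → U r ≤ K + q * r) {X : ℝ → ℝ≥0∞}
    (hX : ∀ s ∈ S, X s ≤ ENNReal.ofReal g) :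
    ∫⁻ s in S, ENNReal.ofReal (Real.exp (-β * s)) * (ENNReal.ofReal (U (c s)) + X s) ≤
      ENNReal.ofReal (K + g) * (∫⁻ s in S, ENNReal.ofReal (Real.exp (-β * s))) +
        ENNReal.ofReal q * ∫⁻ s in S, ENNReal.ofReal (c s) := by
  rw [← lintegral_const_mul' _ _ ENNReal.ofReal_ne_top,
    ← lintegral_const_mul' _ _ ENNReal.ofReal_ne_top, ← lintegral_add_left (by fun_prop)]
  refine setLIntegral_mono' hS fun s hs => ?_
  have hs0 : 0 < s := hS0 hs
  have he : Real.exp (-β * s) ≤ 1 := by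
    rw [Real.exp_le_one_iff]
    nlinarith
  have h1 : ENNReal.ofReal (U (c s)) + X s ≤ ENNReal.ofReal (K + g) + ENNReal.ofReal (q * c s) := by
    refine (add_le_add (ENNReal.ofReal_le_ofReal (hU _ (hc0 s))) (hX s hs)).trans (le_of_eq ?_)
    rw [ENNReal.ofReal_add hK (mul_nonneg hq (hc0 s)), ENNReal.ofReal_add hK hg]
    ring
  calc _ ≤ ENNReal.ofReal (Real.exp (-β * s)) *
        (ENNReal.ofReal (K + g) + ENNReal.ofReal (q * c s)) := mul_le_mul_right h1 _
    _ ≤ _ := by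
      rw [mul_add, mul_comm (ENNReal.ofReal (K + g)), ← ENNReal.ofReal_mul hq]
      gcongr
      exact mul_le_of_le_one_left' (ENNReal.ofReal_le_one.2 he)

/-- Wealth never rises between observations, so the initial expected reward bounds all later ones,
and total consumption is at most `x - l a`. -/
theorem objective_le_of_affine {w : ℝ → ℝ≥0∞} (hw : Monotone w) (hβ : 0 < M.rho + M.lam)
    {K q g : ℝ} (hK : 0 ≤ K) (hq : 0 ≤ q) (hg : 0 ≤ g)
    (hU : ∀ r, 0 ≤ r → M.U r ≤ K + q * r) {x a : ℝ}
    (hX : ENNReal.ofReal M.lam * M.expectedNext w x a ≤ ENNReal.ofReal g)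
    {c : ℝ → ℝ} (hc : M.IsConsumption 0 x a c) :
    M.objective w x a c ≤ ENNReal.ofReal ((K + g) / (M.rho + M.lam) + q * (x - M.l a)) := by
  have hl : 0 ≤ x - M.l a := sub_nonneg.2 hc.l_le
  refine (lintegral_affine_le measurableSet_Ioi Subset.rfl hβ hK hq hg hc.nonneg hU
    (g := g) fun s hs => ?_).trans ?_
  · refine (mul_le_mul_right ?_ _).trans hX
    exact expectedNext_mono hw (fun _ => le_rfl)
      (by linarith [hc.integral_nonneg (le_of_lt (show 0 < s from hs))]) a
  · rw [lintegral_exp_neg_Ioi hβ, ENNReal.ofReal_add (div_nonneg (add_nonneg hK hg) hβ.le)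
      (mul_nonneg hq hl), ENNReal.ofReal_mul hq, div_eq_mul_one_div (K + g), ENNReal.ofReal_mul (add_nonneg hK hg)]
    gcongr
    exact hc.lintegral_le

theorem controlValue_le_of_affine {w : ℝ → ℝ≥0∞} (hw : Monotone w) (hβ : 0 < M.rho + M.lam)
    {K q g : ℝ} (hK : 0 ≤ K) (hq : 0 ≤ q) (hg : 0 ≤ g)
    (hU : ∀ r, 0 ≤ r → M.U r ≤ K + q * r) {x a : ℝ}
    (hX : ENNReal.ofReal M.lam * M.expectedNext w x a ≤ ENNReal.ofReal g) :
    M.controlValue w x a ≤ ENNReal.ofReal ((K + g) / (M.rho + M.lam) + q * (x - M.l a)) :=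
  iSup₂_le fun _ hc => objective_le_of_affine hw hβ hK hq hg hU hX hc

end IlliquidMarket

/-! ### Concavity, growth and convergence of the iterates -/

/-- Concavity on `[0, ∞)` of a function with values in `[0, ∞]`. -/
def ENNConcave (w : ℝ → ℝ≥0∞) : Prop :=
  ∀ x y, 0 ≤ x → 0 ≤ y → ∀ r s, 0 ≤ r → 0 ≤ s → r + s = 1 →
    ENNReal.ofReal r * w x + ENNReal.ofReal s * w y ≤ w (r * x + s * y)

theorem ENNConcave.iSup {w : ℕ → ℝ → ℝ≥0∞} (hm : Monotone w) (h : ∀ n, ENNConcave (w n)) :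
    ENNConcave fun x => ⨆ n, w n x := by
  intro x y hx hy r s hr hs hrs
  rw [ENNReal.mul_iSup, ENNReal.mul_iSup]
  refine ENNReal.iSup_add_iSup_le fun i j => ?_
  refine le_iSup_of_le (max i j) (le_trans ?_ (h (max i j) x y hx hy r s hr hs hrs))
  gcongr
  · exact hm (le_max_left i j) x
  · exact hm (le_max_right i j) y

theorem ENNConcave.concaveOn_toReal {w : ℝ → ℝ≥0∞} (h : ENNConcave w)
    (hfin : ∀ x, 0 ≤ x → w x ≠ ⊤) : ConcaveOn ℝ (Ici 0) fun x => (w x).toReal := by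
  refine ⟨convex_Ici 0, fun x hx y hy r s hr hs hrs => ?_⟩
  have hx : 0 ≤ x := hx
  have hy : 0 ≤ y := hy
  simp only [smul_eq_mul]
  have h1 := ENNReal.toReal_mono (hfin _ (by positivity)) (h x y hx hy r s hr hs hrs)
  rwa [ENNReal.toReal_add (ENNReal.mul_ne_top ENNReal.ofReal_ne_top (hfin x hx))
    (ENNReal.mul_ne_top ENNReal.ofReal_ne_top (hfin y hy)), ENNReal.toReal_mul, ENNReal.toReal_mul,
    ENNReal.toReal_ofReal hr, ENNReal.toReal_ofReal hs] at h1

theorem ENNConcave.mul_le {w : ℝ → ℝ≥0∞} (h : ENNConcave w) {x r : ℝ} (hx : 0 ≤ x) (hr : 0 ≤ r)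
    (hr1 : r ≤ 1) : ENNReal.ofReal r * w x ≤ w (r * x) := by
  have := h x 0 hx le_rfl r (1 - r) hr (by linarith) (by ring)
  rw [mul_zero, add_zero] at this
  exact le_self_add.trans this

/-- Concavity and nonnegativity at `0` suffice. This replaces moduli of continuity throughout: it
controls the expected reward under changes of wealth or portfolio, and the error of the discretised
selection. -/
theorem ENNConcave.subadditive {w : ℝ → ℝ≥0∞} (h : ENNConcave w) {x y : ℝ} (hx : 0 ≤ x)
    (hy : 0 ≤ y) : w (x + y) ≤ w x + w y := by
  rcases hx.eq_or_lt with rfl | hx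
  · simp
  have h0 : 0 < x + y := by linarith
  have h1 := h.mul_le h0.le (r := x / (x + y)) (by positivity) (by rw [div_le_one h0]; linarith)
  have h2 := h.mul_le h0.le (r := y / (x + y)) (by positivity) (by rw [div_le_one h0]; linarith)
  rw [div_mul_cancel₀ _ h0.ne'] at h1 h2
  calc w (x + y) = ENNReal.ofReal (x / (x + y)) * w (x + y) +
        ENNReal.ofReal (y / (x + y)) * w (x + y) := by
        rw [← add_mul, ← ENNReal.ofReal_add (by positivity) (by positivity), ← add_div,
          div_self h0.ne', ENNReal.ofReal_one, one_mul]
    _ ≤ _ := add_le_add h1 h2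

namespace IlliquidMarket

variable {Ω : Type*} [mΩ : MeasurableSpace Ω] {M : IlliquidMarket Ω} {P : Measure Ω} {k b γ K₁ : ℝ}

/-- Only continuity at `0` needs an argument: an increasing concave function may jump there, and the
growth bound excludes it. -/
theorem UtilityAssumptions.inadaUtility (hU : M.UtilityAssumptions k b γ K₁) :
    InadaUtility M.U where
  strictMono := hU.strictMono
  strictConcave := hU.strictConcave
  contDiff := hU.contDiff
  map_zero := hU.map_zero
  inada_zero := hU.inada_zero
  inada_top := hU.inada_top
  tendsto_zero := by
    have h1 : Tendsto (fun x : ℝ => K₁ * x ^ γ) (𝓝[>] 0) (𝓝 0) := by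
      have : ContinuousAt (fun x : ℝ => K₁ * x ^ γ) 0 :=
        (Real.continuousAt_rpow_const 0 γ (Or.inr hU.γ_mem.1.le)).const_mul K₁
      have := this.tendsto.mono_left (nhdsWithin_le_nhds (s := Ioi 0))
      simpa [Real.zero_rpow hU.γ_mem.1.ne'] using this
    refine tendsto_of_tendsto_of_tendsto_of_le_of_le' tendsto_const_nhds h1 ?_ ?_
    · filter_upwards [self_mem_nhdsWithin] with x hx
      have := hU.strictMono.monotoneOn (mem_Ici.2 le_rfl) (mem_Ici.2 (le_of_lt hx)) (le_of_lt hx)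
      rwa [hU.map_zero] at this
    · filter_upwards [self_mem_nhdsWithin] with x hx using hU.growth x (le_of_lt hx)

/-- The only use of the discount condition: one step of the operator multiplies the growth constant
by a factor below one. The term `b γ` is nonnegative and is dropped. -/
theorem lam_mul_lt (hM : M.ReturnAssumptions P k b) (hU : M.UtilityAssumptions k b γ K₁) :
    M.lam * (k / M.zlow) ^ γ < M.rho + M.lam := by
  have h1 := hU.discount
  have h2 := mul_nonneg hM.b_nonneg hU.γ_mem.1.le
  rw [Real.div_rpow hM.k_nonneg hM.zlow_pos.le]
  linarith

theorem rate_pos (hM : M.ReturnAssumptions P k b) (hU : M.UtilityAssumptions k b γ K₁) :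
    0 < M.rho + M.lam := add_pos hU.rho_pos hM.lam_pos

/-- The right side is the tangent of `t ↦ t^γ` at `m`, in the form of the weighted inequality
between geometric and arithmetic means. -/
theorem rpow_le_affine {γ : ℝ} (hγ : γ ∈ Ioo (0 : ℝ) 1) {t m : ℝ} (ht : 0 ≤ t) (hm : 0 < m) :
    t ^ γ ≤ m ^ (γ - 1) * (γ * t + (1 - γ) * m) := by
  have h := Real.geom_mean_le_arith_mean2_weighted hγ.1.le (by linarith [hγ.2] : 0 ≤ 1 - γ) ht hm.le
    (by ring)
  have h1 := mul_le_mul_of_nonneg_left h (Real.rpow_nonneg hm.le (γ - 1))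
  refine le_trans (le_of_eq ?_) h1
  have : m ^ (γ - 1) * m ^ (1 - γ) = 1 := by
    rw [← Real.rpow_add hm]
    simp
  calc t ^ γ = t ^ γ * (m ^ (γ - 1) * m ^ (1 - γ)) := by rw [this, mul_one]
    _ = _ := by ring

/-- Jensen's inequality by means of the tangent at `m = (k / zlow) x`, which is an upper bound of
the expected wealth. -/
theorem expectedNext_le_rpow (hM : M.ReturnAssumptions P k b)
    (hγ : γ ∈ Ioo (0 : ℝ) 1) {w : ℝ → ℝ≥0∞} {C : ℝ} (hC : 0 ≤ C)
    (hw : ∀ y, 0 ≤ y → w y ≤ ENNReal.ofReal (C * y ^ γ)) {x a : ℝ} (ha : a ∈ M.portfolios)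
    (hl : M.l a ≤ x) (hx : 0 < x) :
    M.expectedNext w x a ≤ ENNReal.ofReal (C * ((k / M.zlow) ^ γ * x ^ γ)) := by
  have := hM.isProb_zero
  have hk := hM.one_le_k
  have hz := hM.zlow_pos
  set m := k / M.zlow * x with hm
  have hm0 : 0 < m := by positivity
  have hcoef : 0 ≤ C * m ^ (γ - 1) := mul_nonneg hC (Real.rpow_nonneg hm0.le _)
  have h1g : 0 ≤ 1 - γ := by linarith [hγ.2]
  have hint : Integrable (fun z => C * m ^ (γ - 1) * (γ * (x + a * z) + (1 - γ) * m)) (M.p 0) :=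
    (((hM.integrable_affine x a).const_mul γ).add (integrable_const _)).const_mul _
  have hae := hM.ae_nonneg_iff.2 ⟨ha, hl⟩
  calc M.expectedNext w x a
      ≤ ∫⁻ z, ENNReal.ofReal (C * m ^ (γ - 1) * (γ * (x + a * z) + (1 - γ) * m)) ∂(M.p 0) := by
        refine lintegral_mono_ae ?_
        filter_upwards [hae] with z hz
        refine (hw _ hz).trans (ENNReal.ofReal_le_ofReal ?_)
        rw [mul_assoc]
        exact mul_le_mul_of_nonneg_left (rpow_le_affine hγ hz hm0) hC
    _ = ENNReal.ofReal (∫ z, C * m ^ (γ - 1) * (γ * (x + a * z) + (1 - γ) * m) ∂(M.p 0)) := by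
        refine (ofReal_integral_eq_lintegral_ofReal hint ?_).symm
        filter_upwards [hae] with z hz
        exact mul_nonneg hcoef (add_nonneg (mul_nonneg hγ.1.le hz) (mul_nonneg h1g hm0.le))
    _ ≤ _ := by
        refine ENNReal.ofReal_le_ofReal ?_
        rw [integral_const_mul, integral_add ((hM.integrable_affine x a).const_mul γ)
          (integrable_const _), integral_const_mul]
        simp only [integral_const, probReal_univ, smul_eq_mul, one_mul]
        have h1 := mul_le_mul_of_nonneg_left (hM.integral_affine_le ha hl) hγ.1.le
        have h2 : γ * ∫ z, x + a * z ∂(M.p 0) + (1 - γ) * m ≤ m := by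
          linarith
        refine (mul_le_mul_of_nonneg_left h2 hcoef).trans (le_of_eq ?_)
        rw [← Real.mul_rpow (by positivity) hx.le, ← hm, mul_assoc]
        congr 1
        conv_lhs => rw [← Real.rpow_one m, ← Real.rpow_mul hm0.le, ← Real.rpow_add hm0]
        simp

variable (M γ K₁ k) in
/-- The constant in the growth bound of the value function. -/
noncomputable def growthConst : ℝ :=
  K₁ * (1 / (M.rho + M.lam) + 1) / (1 - M.lam * (k / M.zlow) ^ γ / (M.rho + M.lam))

theorem growthConst_nonneg (hM : M.ReturnAssumptions P k b)
    (hU : M.UtilityAssumptions k b γ K₁) : 0 ≤ M.growthConst k γ K₁ := by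
  have hβ := rate_pos hM hU
  have h1 := lam_mul_lt hM hU
  refine div_nonneg (mul_nonneg hU.K₁_pos.le (by positivity)) ?_
  rw [sub_nonneg, div_le_one hβ]
  exact h1.le

/-- Value functions of the class that the dynamic programming operator preserves. -/
structure ValueClass (M : IlliquidMarket Ω) (k γ K₁ : ℝ) (w : ℝ → ℝ≥0∞) : Prop where
  mono : Monotone w
  concave : ENNConcave w
  growth : ∀ y, 0 ≤ y → w y ≤ ENNReal.ofReal (M.growthConst k γ K₁ * y ^ γ)

/-- The slope is scaled to the wealth `x`, so a total consumption of at most `x` contributes at most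
`K₁ x^γ` and all terms stay homogeneous of degree `γ`. -/
theorem UtilityAssumptions.affine_growth (hU : M.UtilityAssumptions k b γ K₁) {x : ℝ} (hx : 0 < x)
    (r : ℝ) (hr : 0 ≤ r) : M.U r ≤ K₁ * x ^ γ + K₁ * x ^ γ / x * r := by
  have hK := hU.K₁_pos
  have hx' := Real.rpow_pos_of_pos hx γ
  have h1 : r ^ γ ≤ x ^ γ + x ^ γ / x * r := by
    rcases le_total r x with h | h
    · have := Real.rpow_le_rpow hr h hU.γ_mem.1.le
      have : 0 ≤ x ^ γ / x * r := by positivity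
      linarith
    · have h2 : (r / x) ^ γ ≤ r / x := by
        have := Real.rpow_le_rpow_of_exponent_le ((one_le_div hx).2 h) hU.γ_mem.2.le
        rwa [Real.rpow_one] at this
      rw [Real.div_rpow hr hx.le, div_le_iff₀ hx'] at h2
      have : r / x * x ^ γ = x ^ γ / x * r := by ring
      linarith
  have := mul_le_mul_of_nonneg_left h1 hK.le
  refine (hU.growth r hr).trans (this.trans (le_of_eq ?_))
  ring

theorem ValueClass.controlValue_le (hM : M.ReturnAssumptions P k b)
    (hU : M.UtilityAssumptions k b γ K₁) {w : ℝ → ℝ≥0∞} (hw : M.ValueClass k γ K₁ w) {x a : ℝ}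
    (ha : a ∈ M.portfolios) (hl : M.l a ≤ x) (hx : 0 < x) :
    M.controlValue w x a ≤ ENNReal.ofReal (M.growthConst k γ K₁ * x ^ γ) := by
  have hβ := rate_pos hM hU
  have hC := growthConst_nonneg hM hU
  have hK := hU.K₁_pos
  have hlam := hM.lam_pos
  have hk := hM.one_le_k
  have hz := hM.zlow_pos
  have hx' := Real.rpow_pos_of_pos hx γ
  have h1 := expectedNext_le_rpow hM hU.γ_mem hC hw.growth ha hl hx
  have h2 : ENNReal.ofReal M.lam * M.expectedNext w x a ≤
      ENNReal.ofReal (M.lam * (M.growthConst k γ K₁ * ((k / M.zlow) ^ γ * x ^ γ))) := by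
    rw [ENNReal.ofReal_mul hlam.le]
    exact mul_le_mul_right h1 _
  refine (controlValue_le_of_affine hw.mono hβ (by positivity) (by positivity) (by positivity)
    (hU.affine_growth hx) h2).trans (ENNReal.ofReal_le_ofReal ?_)
  have hl0 := hM.l_nonneg ha
  have h3 : K₁ * x ^ γ / x * (x - M.l a) ≤ K₁ * x ^ γ := by
    calc K₁ * x ^ γ / x * (x - M.l a) ≤ K₁ * x ^ γ / x * x := by gcongr; linarith
      _ = _ := by field_simp
  have hne : 1 - M.lam * (k / M.zlow) ^ γ / (M.rho + M.lam) ≠ 0 := by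
    have : M.lam * (k / M.zlow) ^ γ / (M.rho + M.lam) < 1 := by
      rw [div_lt_one hβ]
      exact lam_mul_lt hM hU
    linarith
  -- The growth constant is the solution `C` of `C = K₁ (1/β + 1) + C λ (k / zlow)^γ / β`, the
  -- recursion that one step of the operator imposes.
  have h4 : M.growthConst k γ K₁ = K₁ * (1 / (M.rho + M.lam) + 1) +
      M.growthConst k γ K₁ * (M.lam * (k / M.zlow) ^ γ / (M.rho + M.lam)) := by
    have : M.growthConst k γ K₁ * (1 - M.lam * (k / M.zlow) ^ γ / (M.rho + M.lam)) =
        K₁ * (1 / (M.rho + M.lam) + 1) := div_mul_cancel₀ _ hne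
    linarith
  have h5 : M.growthConst k γ K₁ * x ^ γ = (K₁ * x ^ γ + M.lam * (M.growthConst k γ K₁ *
      ((k / M.zlow) ^ γ * x ^ γ))) / (M.rho + M.lam) + K₁ * x ^ γ := by
    conv_lhs => rw [h4]
    ring
  linarith

theorem bellman_mono {w w' : ℝ → ℝ≥0∞} (hM : M.ReturnAssumptions P k b) (hw : Monotone w)
    (h : ∀ y, w y ≤ w' y) {x x' : ℝ} (hx : x ≤ x') : M.bellman w x ≤ M.bellman w' x' := by
  refine iSup₂_le fun a ha => (controlValue_mono hw h hx a).trans (controlValue_le_bellman ?_)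
  rw [hM.mem_portfolioInterval] at ha ⊢
  exact ⟨ha.1, ha.2.trans hx⟩

theorem expectedNext_concave (hM : M.ReturnAssumptions P k b) {w : ℝ → ℝ≥0∞} (hm : Monotone w)
    (hw : ENNConcave w) {x x' a a' : ℝ} (ha : a ∈ M.portfolios) (hl : M.l a ≤ x)
    (ha' : a' ∈ M.portfolios) (hl' : M.l a' ≤ x') {r s : ℝ} (hr : 0 ≤ r) (hs : 0 ≤ s)
    (hrs : r + s = 1) :
    ENNReal.ofReal r * M.expectedNext w x a + ENNReal.ofReal s * M.expectedNext w x' a' ≤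
      M.expectedNext w (r * x + s * x') (r * a + s * a') := by
  rw [expectedNext, expectedNext, ← lintegral_const_mul' _ _ ENNReal.ofReal_ne_top,
    ← lintegral_const_mul' _ _ ENNReal.ofReal_ne_top, ← lintegral_add_left]
  · refine lintegral_mono_ae ?_
    filter_upwards [hM.ae_nonneg_iff.2 ⟨ha, hl⟩, hM.ae_nonneg_iff.2 ⟨ha', hl'⟩] with z h1 h2
    refine (hw _ _ h1 h2 r s hr hs hrs).trans (le_of_eq ?_)
    congr 1
    ring
  · exact (hm.measurable.comp (by fun_prop)).const_mul _

/-- Concavity is joint in wealth, portfolio and plan, and convex combinations of feasible choices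
are feasible; therefore it survives the suprema over plans and portfolios. -/
theorem objective_concave (hM : M.ReturnAssumptions P k b) (hU : InadaUtility M.U)
    {w : ℝ → ℝ≥0∞} (hm : Monotone w) (hw : ENNConcave w) {x x' a a' : ℝ} (ha : a ∈ M.portfolios)
    (ha' : a' ∈ M.portfolios) {c c' : ℝ → ℝ} (hc : M.IsConsumption 0 x a c)
    (hc' : M.IsConsumption 0 x' a' c') {r s : ℝ} (hr : 0 ≤ r) (hs : 0 ≤ s) (hrs : r + s = 1) :
    ENNReal.ofReal r * M.objective w x a c + ENNReal.ofReal s * M.objective w x' a' c' ≤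
      M.objective w (r * x + s * x') (r * a + s * a') fun u => r * c u + s * c' u := by
  rw [objective, objective, ← lintegral_const_mul' _ _ ENNReal.ofReal_ne_top,
    ← lintegral_const_mul' _ _ ENNReal.ofReal_ne_top, ← lintegral_add_left']
  · refine setLIntegral_mono' measurableSet_Ioi fun u hu => ?_
    have hu : 0 < u := hu
    rw [intervalIntegral.integral_add ((hc.integrable u hu.le).const_mul r)
      ((hc'.integrable u hu.le).const_mul s), intervalIntegral.integral_const_mul,
      intervalIntegral.integral_const_mul]
    have h1 : ENNReal.ofReal r * ENNReal.ofReal (M.U (c u)) +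
        ENNReal.ofReal s * ENNReal.ofReal (M.U (c' u)) ≤
          ENNReal.ofReal (M.U (r * c u + s * c' u)) := by
      rw [← ENNReal.ofReal_mul hr, ← ENNReal.ofReal_mul hs,
        ← ENNReal.ofReal_add (mul_nonneg hr (hU.nonneg (hc.nonneg u)))
          (mul_nonneg hs (hU.nonneg (hc'.nonneg u)))]
      exact ENNReal.ofReal_le_ofReal (hU.strictConcave.concaveOn.2 (mem_Ici.2 (hc.nonneg u))
        (mem_Ici.2 (hc'.nonneg u)) hr hs hrs)
    have h2 := expectedNext_concave hM hm hw (x := x - ∫ u in (0 : ℝ)..u, c u)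
      (x' := x' - ∫ u in (0 : ℝ)..u, c' u) ha (by linarith [hc.integral_le u hu.le]) ha'
      (by linarith [hc'.integral_le u hu.le]) hr hs hrs
    have e : r * (x - ∫ u in (0 : ℝ)..u, c u) + s * (x' - ∫ u in (0 : ℝ)..u, c' u) =
      r * x + s * x' - (r * (∫ u in (0 : ℝ)..u, c u) + s * ∫ u in (0 : ℝ)..u, c' u) := by ring
    rw [e] at h2
    calc _ = ENNReal.ofReal (Real.exp (-(M.rho + M.lam) * u)) *
        ((ENNReal.ofReal r * ENNReal.ofReal (M.U (c u)) +
          ENNReal.ofReal s * ENNReal.ofReal (M.U (c' u))) + ENNReal.ofReal M.lam *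
          (ENNReal.ofReal r * M.expectedNext w (x - ∫ u in (0 : ℝ)..u, c u) a +
            ENNReal.ofReal s * M.expectedNext w (x' - ∫ u in (0 : ℝ)..u, c' u) a')) := by ring
      _ ≤ _ := by gcongr
  · refine AEMeasurable.const_mul ((by fun_prop : Measurable _).aemeasurable.mul
      (AEMeasurable.add ?_ ((aemeasurable_expectedNext hm hc).const_mul _))) _
    exact (hU.measurable_comp hc.measurable hc.nonneg).ennreal_ofReal.aemeasurable

theorem controlValue_concave (hM : M.ReturnAssumptions P k b) (hU : InadaUtility M.U)
    {w : ℝ → ℝ≥0∞} (hm : Monotone w) (hw : ENNConcave w) {x x' a a' : ℝ} (ha : a ∈ M.portfolios)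
    (hl : M.l a ≤ x) (ha' : a' ∈ M.portfolios) (hl' : M.l a' ≤ x') {r s : ℝ} (hr : 0 ≤ r)
    (hs : 0 ≤ s) (hrs : r + s = 1) :
    ENNReal.ofReal r * M.controlValue w x a + ENNReal.ofReal s * M.controlValue w x' a' ≤
      M.controlValue w (r * x + s * x') (r * a + s * a') := by
  simp only [controlValue, ENNReal.mul_iSup]
  exact ENNReal.biSup_add_biSup_le' ⟨_, IsConsumption.zero hl⟩ ⟨_, IsConsumption.zero hl'⟩
    fun c hc c' hc' => (objective_concave hM hU hm hw ha ha' hc hc' hr hs hrs).trans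
      (objective_le_controlValue (hc.combo hc' hr hs))

theorem bellman_concave (hM : M.ReturnAssumptions P k b) (hU : InadaUtility M.U)
    {w : ℝ → ℝ≥0∞} (hm : Monotone w) (hw : ENNConcave w) : ENNConcave (M.bellman w) := by
  intro x y hx hy r s hr hs hrs
  simp only [bellman, ENNReal.mul_iSup]
  have h0 : ∀ x, 0 ≤ x → (0 : ℝ) ∈ M.portfolioInterval x := fun x hx =>
    hM.mem_portfolioInterval.2
      ⟨ReturnAssumptions.zero_mem_portfolios, by rwa [ReturnAssumptions.l_zero]⟩
  refine ENNReal.biSup_add_biSup_le' ⟨0, h0 x hx⟩ ⟨0, h0 y hy⟩ fun a ha a' ha' => ?_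
  rw [hM.mem_portfolioInterval] at ha ha'
  refine (controlValue_concave hM hU hm hw ha.1 ha.2 ha'.1 ha'.2 hr hs hrs).trans
    (controlValue_le_bellman ?_)
  rw [hM.mem_portfolioInterval]
  refine ⟨ReturnAssumptions.convex_portfolios ha.1 ha'.1 hr hs hrs, ?_⟩
  have h1 := ReturnAssumptions.l_combo_le (M := M) (a := a) (a' := a') hr hs
  have h2 := mul_le_mul_of_nonneg_left ha.2 hr
  have h3 := mul_le_mul_of_nonneg_left ha'.2 hs
  linarith

theorem ValueClass.bellman (hM : M.ReturnAssumptions P k b) (hU : M.UtilityAssumptions k b γ K₁)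
    {w : ℝ → ℝ≥0∞} (hw : M.ValueClass k γ K₁ w) : M.ValueClass k γ K₁ (M.bellman w) where
  mono x y hxy := bellman_mono hM hw.mono (fun _ => le_rfl) hxy
  concave := bellman_concave hM hU.inadaUtility hw.mono hw.concave
  growth := by
    have hpos : ∀ y, 0 < y →
        M.bellman w y ≤ ENNReal.ofReal (M.growthConst k γ K₁ * y ^ γ) := by
      intro y hy
      refine iSup₂_le fun a ha => ?_
      rw [hM.mem_portfolioInterval] at ha
      exact hw.controlValue_le hM hU ha.1 ha.2 hy
    intro y hy
    rcases hy.eq_or_lt with rfl | hy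
    -- The tangent argument needs positive wealth; zero wealth is reached by monotonicity and a
    -- limit.
    · have h1 : ContinuousAt (fun y : ℝ => ENNReal.ofReal (M.growthConst k γ K₁ * y ^ γ)) 0 :=
        ENNReal.continuous_ofReal.continuousAt.comp
          ((Real.continuousAt_rpow_const 0 γ (Or.inr hU.γ_mem.1.le)).const_mul _)
      refine ge_of_tendsto (h1.tendsto.mono_left (nhdsWithin_le_nhds (s := Ioi 0))) ?_
      filter_upwards [self_mem_nhdsWithin] with y hy
      exact (bellman_mono hM hw.mono (fun _ => le_rfl) (le_of_lt hy)).trans (hpos y hy)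
    · exact hpos y hy

variable (M) in
/-- The iterates of the dynamic programming operator. -/
noncomputable def iterValue : ℕ → ℝ → ℝ≥0∞
  | 0 => fun _ => 0
  | n + 1 => M.bellman (iterValue n)

theorem iterValue_class (hM : M.ReturnAssumptions P k b) (hU : M.UtilityAssumptions k b γ K₁)
    (n : ℕ) : M.ValueClass k γ K₁ (M.iterValue n) := by
  induction n with
  | zero => exact ⟨fun _ _ _ => le_rfl, fun _ _ _ _ _ _ _ _ _ => by simp [iterValue],
      fun _ _ => zero_le⟩
  | succ n ih => exact ih.bellman hM hU

theorem iterValue_mono (hM : M.ReturnAssumptions P k b) (hU : M.UtilityAssumptions k b γ K₁) :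
    Monotone M.iterValue := by
  refine monotone_nat_of_le_succ fun n => ?_
  induction n with
  | zero => exact fun _ => zero_le
  | succ n ih => exact fun x => bellman_mono hM (iterValue_class hM hU n).mono ih le_rfl

variable (M) in
/-- The limit of the iterates of the dynamic programming operator. -/
noncomputable def limitValue (x : ℝ) : ℝ≥0∞ := ⨆ n, M.iterValue n x

theorem limitValue_class (hM : M.ReturnAssumptions P k b) (hU : M.UtilityAssumptions k b γ K₁) :
    M.ValueClass k γ K₁ M.limitValue where
  mono _ _ hxy := iSup_mono fun n => (iterValue_class hM hU n).mono hxy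
  concave := ENNConcave.iSup (iterValue_mono hM hU) fun n => (iterValue_class hM hU n).concave
  growth y hy := iSup_le fun n => (iterValue_class hM hU n).growth y hy

/-- Monotone convergence, first in the return and then in time. Because the objective commutes with
the supremum over `n`, no continuity of the operator has to be proved. -/
theorem objective_limitValue (hM : M.ReturnAssumptions P k b)
    (hU : M.UtilityAssumptions k b γ K₁) {x a : ℝ} {c : ℝ → ℝ} (hc : M.IsConsumption 0 x a c) :
    M.objective M.limitValue x a c = ⨆ n, M.objective (M.iterValue n) x a c := by
  have hcl := iterValue_class hM hU
  have hmono := iterValue_mono hM hU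
  have h1 : ∀ y, M.expectedNext M.limitValue y a = ⨆ n, M.expectedNext (M.iterValue n) y a := by
    intro y
    exact lintegral_iSup (fun n => (hcl n).mono.measurable.comp (by fun_prop))
      fun m n hmn z => hmono hmn _
  have hE : ∀ y, Monotone fun n => M.expectedNext (M.iterValue n) y a := fun y m n hmn =>
    expectedNext_mono (hcl m).mono (hmono hmn) le_rfl a
  simp only [objective]
  rw [← lintegral_iSup']
  · refine lintegral_congr fun s => ?_
    rw [h1, ENNReal.mul_iSup, ENNReal.add_iSup, ENNReal.mul_iSup]
  · intro n
    refine (by fun_prop : Measurable _).aemeasurable.mul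
      (AEMeasurable.add ?_ ((aemeasurable_expectedNext (hcl n).mono hc).const_mul _))
    exact (hU.inadaUtility.measurable_comp hc.measurable hc.nonneg).ennreal_ofReal.aemeasurable
  · refine ae_of_all _ fun s m n hmn => ?_
    dsimp only
    gcongr
    exact hE _ hmn

/-- The limit of the iterates is a fixed point of the dynamic programming operator. -/
theorem bellman_limitValue (hM : M.ReturnAssumptions P k b)
    (hU : M.UtilityAssumptions k b γ K₁) (x : ℝ) : M.bellman M.limitValue x = M.limitValue x := by
  have hcl := iterValue_class hM hU
  refine le_antisymm ?_ (iSup_le fun n => ?_)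
  · refine iSup₂_le fun a ha => iSup₂_le fun c hc => ?_
    rw [objective_limitValue hM hU hc]
    refine iSup_le fun n => le_iSup_of_le (n + 1) ?_
    exact (objective_le_controlValue hc).trans (controlValue_le_bellman ha)
  · refine (iterValue_mono hM hU n.le_succ x).trans ?_
    exact bellman_mono hM (hcl n).mono (fun y => le_iSup (fun n => M.iterValue n y) n) le_rfl

end IlliquidMarket

/-! ### Dynamic programming inequalities for a fixed portfolio -/

namespace IlliquidMarket

variable {Ω : Type*} [mΩ : MeasurableSpace Ω] {M : IlliquidMarket Ω} {P : Measure Ω} {k b γ K₁ : ℝ}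

/-- Consume at rate `r` up to time `h`, then follow an arbitrary plan from `y`. Wealth is at least
`y` until `h`, which bounds the expected reward from below. -/
theorem le_controlValue_add {w : ℝ → ℝ≥0∞} (hw : Monotone w)
    (hβ : 0 < M.rho + M.lam) {y a r h : ℝ} (hl : M.l a ≤ y) (hr : 0 ≤ r) (hh : 0 ≤ h) :
    ENNReal.ofReal ((1 - Real.exp (-(M.rho + M.lam) * h)) / (M.rho + M.lam)) *
        (ENNReal.ofReal (M.U r) + ENNReal.ofReal M.lam * M.expectedNext w y a) +
      ENNReal.ofReal (Real.exp (-(M.rho + M.lam) * h)) * M.controlValue w y a ≤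
      M.controlValue w (y + r * h) a := by
  rw [controlValue, ENNReal.mul_iSup]
  simp only [ENNReal.mul_iSup]
  rw [ENNReal.add_biSup' ⟨_, IsConsumption.zero hl⟩]
  refine iSup₂_le fun c hc => ?_
  have hc' := hc.cons hh hr
  refine le_trans ?_ (objective_le_controlValue hc')
  have hint : ∀ s, 0 ≤ s → s ≤ h →
      ∫ u in (0 : ℝ)..s, (if u ≤ h then r else c (u - h)) = r * s := by
    intro s hs hsh
    rw [intervalIntegral.integral_congr_ae (g := fun _ => r) (ae_of_all _ fun u hu => ?_)]
    · simp [mul_comm]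
    · rw [uIoc_of_le hs] at hu
      simp [hu.2.trans hsh]
  rw [objective_eq_add hc' hh, hint h hh le_rfl, add_sub_cancel_right]
  refine add_le_add ?_ (mul_le_mul_right (le_of_eq (objective_congr fun s hs => ?_)) _)
  · rw [← lintegral_exp_neg_Ioc hβ hh, mul_comm, ← lintegral_const_mul _ (by fun_prop)]
    refine setLIntegral_mono' measurableSet_Ioc fun s hs => ?_
    rw [mul_comm, hint s hs.1.le hs.2, if_pos hs.2]
    gcongr
    refine expectedNext_mono hw (fun _ => le_rfl) ?_ a
    have := mul_le_mul_of_nonneg_left hs.2 hr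
    linarith
  · simp [hs]

/-- The opposite estimate for an arbitrary plan: linearise the utility up to time `h` and replace
the continuation by its optimal value. -/
theorem objective_le_add {w : ℝ → ℝ≥0∞} (hw : Monotone w) (hβ : 0 < M.rho + M.lam)
    {K q g : ℝ} (hK : 0 ≤ K) (hq : 0 ≤ q) (hg : 0 ≤ g)
    (hU : ∀ r, 0 ≤ r → M.U r ≤ K + q * r) {x a h : ℝ} (hh : 0 ≤ h)
    (hX : ENNReal.ofReal M.lam * M.expectedNext w x a ≤ ENNReal.ofReal g)
    {c : ℝ → ℝ} (hc : M.IsConsumption 0 x a c) :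
    M.objective w x a c ≤
      ENNReal.ofReal ((K + g) * ((1 - Real.exp (-(M.rho + M.lam) * h)) / (M.rho + M.lam)) +
        q * ∫ u in (0 : ℝ)..h, c u) +
      ENNReal.ofReal (Real.exp (-(M.rho + M.lam) * h)) *
        M.controlValue w (x - ∫ u in (0 : ℝ)..h, c u) a := by
  have he : 0 ≤ (1 - Real.exp (-(M.rho + M.lam) * h)) / (M.rho + M.lam) := by
    refine div_nonneg (sub_nonneg.2 (Real.exp_le_one_iff.2 ?_)) hβ.le
    have := mul_nonneg hβ.le hh
    linarith
  rw [objective_eq_add hc hh]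
  refine add_le_add ?_ (mul_le_mul_right (objective_le_controlValue (hc.shift hh)) _)
  refine (lintegral_affine_le measurableSet_Ioc Ioc_subset_Ioi_self hβ hK hq hg hc.nonneg hU
    (g := g) fun s hs => ?_).trans (le_of_eq ?_)
  · refine (mul_le_mul_right ?_ _).trans hX
    exact expectedNext_mono hw (fun _ => le_rfl) (by linarith [hc.integral_nonneg hs.1.le]) a
  · rw [lintegral_exp_neg_Ioc hβ hh, ENNReal.ofReal_add (mul_nonneg (add_nonneg hK hg) he)
      (mul_nonneg hq (hc.integral_nonneg hh)), ENNReal.ofReal_mul (add_nonneg hK hg),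
      ENNReal.ofReal_mul hq, hc.lintegral_Ioc hh]

namespace ValueClass

variable {w : ℝ → ℝ≥0∞} (hw : M.ValueClass k γ K₁ w) (hM : M.ReturnAssumptions P k b)
  (hU : M.UtilityAssumptions k b γ K₁)
include hw hM hU

theorem controlValue_ne_top {x a : ℝ} (ha : a ∈ M.portfolios) (hl : M.l a ≤ x) :
    M.controlValue w x a ≠ ⊤ := by
  have h0 := (hM.l_nonneg ha).trans hl
  exact ne_top_of_le_ne_top ENNReal.ofReal_ne_top
    ((controlValue_mono hw.mono (fun _ => le_rfl) (by linarith : x ≤ x + 1) a).trans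
      (hw.controlValue_le hM hU ha (by linarith) (by linarith)))

theorem expectedNext_ne_top {x a : ℝ} (ha : a ∈ M.portfolios) (hl : M.l a ≤ x) :
    M.expectedNext w x a ≠ ⊤ := by
  have h0 := (hM.l_nonneg ha).trans hl
  exact ne_top_of_le_ne_top ENNReal.ofReal_ne_top
    ((expectedNext_mono hw.mono (fun _ => le_rfl) (by linarith : x ≤ x + 1) a).trans
      (expectedNext_le_rpow hM hU.γ_mem (growthConst_nonneg hM hU) hw.growth ha
        (by linarith) (by linarith)))

omit hM hU in
theorem ne_top (x : ℝ) : w x ≠ ⊤ :=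
  ne_top_of_le_ne_top ENNReal.ofReal_ne_top
    ((hw.mono (le_max_left x 0)).trans (hw.growth _ (le_max_right x 0)))

theorem monotoneOn_controlValue {a : ℝ} (ha : a ∈ M.portfolios) :
    MonotoneOn (fun x => (M.controlValue w x a).toReal) (Ici (M.l a)) := fun _ _ _ hy hxy =>
  ENNReal.toReal_mono (hw.controlValue_ne_top hM hU ha hy)
    (controlValue_mono hw.mono (fun _ => le_rfl) hxy a)

/-- The optimal value for a given portfolio satisfies the dynamic programming inequalities. -/
theorem consumptionValue {a : ℝ} (ha : a ∈ M.portfolios) :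
    ConsumptionValue M.U (fun x => (M.controlValue w x a).toReal)
      (fun y => M.lam * (M.expectedNext w y a).toReal) (M.rho + M.lam) (M.l a) where
  concave := by
    refine ⟨convex_Ici _, fun x hx y hy r s hr hs hrs => ?_⟩
    have hx : M.l a ≤ x := hx
    have hy : M.l a ≤ y := hy
    simp only [smul_eq_mul]
    have e : r * a + s * a = a := by rw [← add_mul, hrs, one_mul]
    have h1 := controlValue_concave hM hU.inadaUtility hw.mono hw.concave ha hx ha hy hr hs hrs
    rw [e] at h1
    have hl : M.l a ≤ r * x + s * y := by
      have h2 := mul_le_mul_of_nonneg_left hx hr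
      have h3 := mul_le_mul_of_nonneg_left hy hs
      have : M.l a = r * M.l a + s * M.l a := by rw [← add_mul, hrs, one_mul]
      linarith
    have h1 := ENNReal.toReal_mono (hw.controlValue_ne_top hM hU ha hl) h1
    rwa [ENNReal.toReal_add
      (ENNReal.mul_ne_top ENNReal.ofReal_ne_top (hw.controlValue_ne_top hM hU ha hx))
      (ENNReal.mul_ne_top ENNReal.ofReal_ne_top (hw.controlValue_ne_top hM hU ha hy)),
      ENNReal.toReal_mul, ENNReal.toReal_mul,
      ENNReal.toReal_ofReal hr, ENNReal.toReal_ofReal hs] at h1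
  le_value y hy r hr h hh := by
    have hβ := rate_pos hM hU
    have h1 := le_controlValue_add (M := M) hw.mono hβ hy hr hh
    have hl : M.l a ≤ y + r * h := by
      have := mul_nonneg hr hh
      linarith
    have he : 0 ≤ (1 - Real.exp (-(M.rho + M.lam) * h)) / (M.rho + M.lam) := by
      refine div_nonneg (sub_nonneg.2 (Real.exp_le_one_iff.2 ?_)) hβ.le
      have := mul_nonneg hβ.le hh
      linarith
    have hE := ENNReal.mul_ne_top (ENNReal.ofReal_ne_top (r := M.lam))
      (hw.expectedNext_ne_top hM hU ha hy)
    have h1 := ENNReal.toReal_mono (hw.controlValue_ne_top hM hU ha hl) h1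
    rwa [ENNReal.toReal_add (ENNReal.mul_ne_top ENNReal.ofReal_ne_top
        (ENNReal.add_ne_top.2 ⟨ENNReal.ofReal_ne_top, hE⟩))
      (ENNReal.mul_ne_top ENNReal.ofReal_ne_top (hw.controlValue_ne_top hM hU ha hy)),
      ENNReal.toReal_mul, ENNReal.toReal_mul, ENNReal.toReal_add ENNReal.ofReal_ne_top hE,
      ENNReal.toReal_mul, ENNReal.toReal_ofReal he, ENNReal.toReal_ofReal (Real.exp_pos _).le,
      ENNReal.toReal_ofReal (hU.inadaUtility.nonneg hr), ENNReal.toReal_ofReal hM.lam_pos.le] at h1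
  value_le y hy p hp hsup h hh K hK := by
    have hβ := rate_pos hM hU
    set e := Real.exp (-(M.rho + M.lam) * h) with he
    have he0 : 0 < e := Real.exp_pos _
    have he1 : e < 1 := by
      rw [he, Real.exp_lt_one_iff]
      have := mul_pos hβ hh
      linarith
    have hK0 : 0 ≤ K := by
      have := hK 0 le_rfl
      rwa [hU.map_zero, mul_zero, add_zero] at this
    have hq : 0 ≤ p * e := (mul_pos hp he0).le
    set g := M.lam * (M.expectedNext w y a).toReal with hg
    have hg0 : 0 ≤ g := mul_nonneg hM.lam_pos.le ENNReal.toReal_nonneg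
    have hX : ENNReal.ofReal M.lam * M.expectedNext w y a ≤ ENNReal.ofReal g := by
      rw [hg, ENNReal.ofReal_mul hM.lam_pos.le,
        ENNReal.ofReal_toReal (hw.expectedNext_ne_top hM hU ha hy)]
    have hφ0 : 0 ≤ (M.controlValue w y a).toReal := ENNReal.toReal_nonneg
    -- The supergradient bound on the continuation cancels the term `p e ∫ c`, so the estimate no
    -- longer depends on the plan.
    have hbd : M.controlValue w y a ≤ ENNReal.ofReal ((K + g) * ((1 - e) / (M.rho + M.lam)) +
        e * (M.controlValue w y a).toReal) := by
      refine iSup₂_le fun c hc => ?_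
      refine (objective_le_add hw.mono hβ hK0 hq hg0 hK hh.le hX hc).trans ?_
      have hle := hc.integral_le h hh.le
      have h0 := hc.integral_nonneg hh.le
      have h1 := hsup (y - ∫ u in (0 : ℝ)..h, c u) (by linarith) (by linarith)
      rw [← ENNReal.ofReal_toReal (hw.controlValue_ne_top hM hU ha
        (by linarith : M.l a ≤ y - ∫ u in (0 : ℝ)..h, c u)), ← ENNReal.ofReal_mul he0.le,
        ← ENNReal.ofReal_add (add_nonneg (mul_nonneg (add_nonneg hK0 hg0)
          (div_nonneg (by linarith) hβ.le)) (mul_nonneg hq h0))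
          (mul_nonneg he0.le ENNReal.toReal_nonneg)]
      refine ENNReal.ofReal_le_ofReal ?_
      have h2 := mul_le_mul_of_nonneg_left h1 he0.le
      have h3 : e * ((M.controlValue w y a).toReal +
          p * (y - (∫ u in (0 : ℝ)..h, c u) - y)) =
          e * (M.controlValue w y a).toReal - p * e * ∫ u in (0 : ℝ)..h, c u := by ring
      linarith
    have h1 := ENNReal.toReal_mono ENNReal.ofReal_ne_top hbd
    rw [ENNReal.toReal_ofReal (add_nonneg (mul_nonneg (add_nonneg hK0 hg0)
          (div_nonneg (by linarith) hβ.le)) (mul_nonneg he0.le hφ0))] at h1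
    -- `β φ ≤ (1 - e) (K + g) + e β φ`; the factor `1 - e > 0` is then divided out.
    have h2 : (1 - e) * ((M.rho + M.lam) * (M.controlValue w y a).toReal) ≤ (1 - e) * (K + g) := by
      have h3 := mul_le_mul_of_nonneg_left h1 hβ.le
      have h4 : (M.rho + M.lam) * ((K + g) * ((1 - e) / (M.rho + M.lam)) +
          e * (M.controlValue w y a).toReal) = (1 - e) * (K + g) +
          e * ((M.rho + M.lam) * (M.controlValue w y a).toReal) := by
        field_simp
      linarith
    exact le_of_mul_le_mul_left h2 (by linarith)
  value_le_affine y hy K q hq hK := by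
    have hβ := rate_pos hM hU
    have hK0 : 0 ≤ K := by
      have := hK 0 le_rfl
      rwa [hU.map_zero, mul_zero, add_zero] at this
    have hg0 : 0 ≤ M.lam * (M.expectedNext w y a).toReal :=
      mul_nonneg hM.lam_pos.le ENNReal.toReal_nonneg
    have hX : ENNReal.ofReal M.lam * M.expectedNext w y a ≤
        ENNReal.ofReal (M.lam * (M.expectedNext w y a).toReal) := by
      rw [ENNReal.ofReal_mul hM.lam_pos.le,
        ENNReal.ofReal_toReal (hw.expectedNext_ne_top hM hU ha hy)]
    have h1 := ENNReal.toReal_mono ENNReal.ofReal_ne_top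
      (controlValue_le_of_affine hw.mono hβ hK0 hq hg0 hK hX)
    rwa [ENNReal.toReal_ofReal (add_nonneg (div_nonneg (add_nonneg hK0 hg0) hβ.le)
      (mul_nonneg hq (by linarith)))] at h1

omit hM in
theorem tendsto_zero : Tendsto w (𝓝[≥] 0) (𝓝 0) := by
  have h1 : ContinuousAt (fun y : ℝ => ENNReal.ofReal (M.growthConst k γ K₁ * y ^ γ)) 0 :=
    ENNReal.continuous_ofReal.continuousAt.comp
      ((Real.continuousAt_rpow_const 0 γ (Or.inr hU.γ_mem.1.le)).const_mul _)
  have h2 := h1.tendsto.mono_left (nhdsWithin_le_nhds (s := Ici 0))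
  rw [Real.zero_rpow hU.γ_mem.1.ne', mul_zero, ENNReal.ofReal_zero] at h2
  refine tendsto_of_tendsto_of_tendsto_of_le_of_le' tendsto_const_nhds h2
    (Eventually.of_forall fun _ => zero_le) ?_
  filter_upwards [self_mem_nhdsWithin] with y hy using hw.growth y hy

omit hU in
theorem expectedNext_add_le {a y h : ℝ} (ha : a ∈ M.portfolios) (hl : M.l a ≤ y) (hh : 0 ≤ h) :
    M.expectedNext w (y + h) a ≤ M.expectedNext w y a + w h := by
  have := hM.isProb_zero
  calc M.expectedNext w (y + h) a ≤ ∫⁻ z, (w (y + a * z) + w h) ∂(M.p 0) := by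
        refine lintegral_mono_ae ?_
        filter_upwards [hM.ae_nonneg_iff.2 ⟨ha, hl⟩] with z hz
        rw [add_right_comm]
        exact hw.concave.subadditive hz hh
    _ = _ := by
        rw [lintegral_add_right _ measurable_const]
        simp [expectedNext]

theorem continuousWithinAt_expectedNext {a : ℝ} (ha : a ∈ M.portfolios) :
    ContinuousWithinAt (fun y => M.lam * (M.expectedNext w y a).toReal) (Ici (M.l a)) (M.l a) := by
  refine ContinuousWithinAt.const_smul ?_ M.lam
  have h1 : Tendsto (fun y => w (y - M.l a)) (𝓝[≥] (M.l a)) (𝓝 0) := by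
    refine (hw.tendsto_zero hU).comp (tendsto_nhdsWithin_iff.2 ⟨?_, ?_⟩)
    · have : ContinuousAt (fun y => y - M.l a) (M.l a) := by fun_prop
      have := this.tendsto.mono_left (nhdsWithin_le_nhds (s := Ici (M.l a)))
      simpa using this
    · filter_upwards [self_mem_nhdsWithin] with y hy
      exact sub_nonneg.2 (show M.l a ≤ y from hy)
  have h2 : Tendsto (fun y => M.expectedNext w y a) (𝓝[≥] (M.l a))
      (𝓝 (M.expectedNext w (M.l a) a)) := by
    refine tendsto_of_tendsto_of_tendsto_of_le_of_le' tendsto_const_nhds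
      (h := fun y => M.expectedNext w (M.l a) a + w (y - M.l a)) ?_ ?_ ?_
    · have := (tendsto_const_nhds (x := M.expectedNext w (M.l a) a)).add h1
      rwa [add_zero] at this
    · filter_upwards [self_mem_nhdsWithin] with y hy
      exact expectedNext_mono hw.mono (fun _ => le_rfl) hy a
    · filter_upwards [self_mem_nhdsWithin] with y hy
      have := hw.expectedNext_add_le hM ha le_rfl (sub_nonneg.2 (show M.l a ≤ y from hy))
      rwa [add_sub_cancel] at this
  exact (ENNReal.tendsto_toReal (hw.expectedNext_ne_top hM hU ha le_rfl)).comp h2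

end ValueClass

end IlliquidMarket

/-! ### Optimal portfolios and regularity of fixed points -/

namespace IlliquidMarket

variable {Ω : Type*} [mΩ : MeasurableSpace Ω] {M : IlliquidMarket Ω} {P : Measure Ω} {k b γ K₁ : ℝ}

theorem ReturnAssumptions.integrable_one_add_abs (hM : M.ReturnAssumptions P k b) :
    Integrable (fun z : ℝ => 1 + |z|) (M.p 0) := by
  have := hM.isProb_zero
  exact (integrable_const _).add (hM.integrable_return 0 le_rfl).abs

theorem l_mul {r : ℝ} (hr : 0 ≤ r) (a : ℝ) : M.l (r * a) = r * M.l a := by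
  unfold l
  split_ifs
  · ring
  · rw [mul_max_of_nonneg _ _ hr]
    congr 1 <;> ring

namespace ValueClass

variable {w : ℝ → ℝ≥0∞} (hw : M.ValueClass k γ K₁ w) (hM : M.ReturnAssumptions P k b)
  (hU : M.UtilityAssumptions k b γ K₁)
include hw hM hU

/-- A plan feasible for `a'` is feasible for `a` once the wealth is raised by the difference of the
reserves. The terminal wealths then differ by at most `|a - a'| |z|`, which subadditivity turns into
an additive error. -/
theorem controlValue_le_add {x a a' : ℝ} (ha : a ∈ M.portfolios) :
    M.controlValue w x a' ≤ M.controlValue w (x + |M.l a - M.l a'|) a +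
      ENNReal.ofReal (M.lam / (M.rho + M.lam)) * ∫⁻ z, w (|a - a'| * |z|) ∂(M.p 0) := by
  have hβ := rate_pos hM hU
  refine iSup₂_le fun c hc => ?_
  have hc' : M.IsConsumption 0 (x + |M.l a - M.l a'|) a c :=
    hc.mono (by linarith [le_abs_self (M.l a - M.l a')])
  refine le_trans ?_ (add_le_add_left (objective_le_controlValue hc') _)
  set E := ∫⁻ z, w (|a - a'| * |z|) ∂(M.p 0)
  have h1 : ∀ s, 0 ≤ s → M.expectedNext w (x - ∫ u in (0 : ℝ)..s, c u) a' ≤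
      M.expectedNext w (x + |M.l a - M.l a'| - ∫ u in (0 : ℝ)..s, c u) a + E := by
    intro s hs
    have hmeas : Measurable fun z : ℝ => w (|a - a'| * |z|) :=
      hw.mono.measurable.comp (by fun_prop)
    rw [expectedNext, expectedNext, ← lintegral_add_right _ hmeas]
    refine lintegral_mono_ae ?_
    have hl := hc'.integral_le s hs
    filter_upwards [hM.ae_nonneg_iff.2
      ⟨ha, (by linarith : M.l a ≤ x + |M.l a - M.l a'| - ∫ u in (0 : ℝ)..s, c u)⟩] with z hz
    refine (hw.mono ?_).trans (hw.concave.subadditive hz (by positivity))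
    rw [← abs_mul, abs_sub_comm (M.l a), sub_mul]
    have := neg_abs_le (a * z - a' * z)
    have := abs_nonneg (M.l a' - M.l a)
    linarith
  have h2 : ENNReal.ofReal (M.lam / (M.rho + M.lam)) * E =
      ∫⁻ s in Ioi (0 : ℝ), ENNReal.ofReal (Real.exp (-(M.rho + M.lam) * s)) *
        (ENNReal.ofReal M.lam * E) := by
    rw [lintegral_mul_const _ (by fun_prop), lintegral_exp_neg_Ioi hβ, ← mul_assoc,
      ← ENNReal.ofReal_mul (by positivity)]
    congr 2
    ring
  have hmeas : AEMeasurable (fun s => ENNReal.ofReal (Real.exp (-(M.rho + M.lam) * s)) *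
      (ENNReal.ofReal (M.U (c s)) + ENNReal.ofReal M.lam * M.expectedNext w
        (x + |M.l a - M.l a'| - ∫ u in (0 : ℝ)..s, c u) a)) (volume.restrict (Ioi 0)) := by
    refine (by fun_prop : Measurable _).aemeasurable.mul
      (AEMeasurable.add ?_ ((aemeasurable_expectedNext hw.mono hc').const_mul _))
    exact (hU.inadaUtility.measurable_comp hc.measurable hc.nonneg).ennreal_ofReal.aemeasurable
  rw [h2, objective, objective, ← lintegral_add_left' hmeas]
  refine setLIntegral_mono' measurableSet_Ioi fun s hs => ?_
  rw [← mul_add, add_assoc, ← mul_add]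
  gcongr
  exact h1 s (le_of_lt hs)

-- By the growth bound and `|z|^γ ≤ 1 + |z|`, the error caused by a change of portfolio is of order
-- `r^γ`.
omit hU in
theorem lintegral_scaled_le (hU : M.UtilityAssumptions k b γ K₁) {r : ℝ} (hr : 0 ≤ r) :
    ∫⁻ z, w (r * |z|) ∂(M.p 0) ≤
      ENNReal.ofReal (M.growthConst k γ K₁ * r ^ γ * ∫ z, (1 + |z|) ∂(M.p 0)) := by
  have hC := growthConst_nonneg hM hU
  have hr' := Real.rpow_nonneg hr γ
  rw [← integral_const_mul, ofReal_integral_eq_lintegral_ofReal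
    (hM.integrable_one_add_abs.const_mul _) (ae_of_all _ fun z => by positivity)]
  refine lintegral_mono fun z => (hw.growth _ (by positivity)).trans (ENNReal.ofReal_le_ofReal ?_)
  rw [Real.mul_rpow hr (abs_nonneg z), mul_assoc]
  gcongr
  rcases le_total |z| 1 with h | h
  · have := Real.rpow_le_one (abs_nonneg z) h hU.γ_mem.1.le
    linarith [abs_nonneg z]
  · have := Real.rpow_le_rpow_of_exponent_le h hU.γ_mem.2.le
    rw [Real.rpow_one] at this
    linarith

theorem continuousOn_controlValue {a : ℝ} (ha : a ∈ M.portfolios) :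
    ContinuousOn (fun x => (M.controlValue w x a).toReal) (Ici (M.l a)) := by
  have h := hw.consumptionValue hM hU ha
  exact h.concave.continuousOn_Ici (h.continuousWithinAt_left hU.inadaUtility (rate_pos hM hU)
    (hw.monotoneOn_controlValue hM hU ha) (hw.continuousWithinAt_expectedNext hM hU ha))

/-- In the bound of `controlValue_le_add` the portfolio `a` is fixed and only its wealth varies, so
continuity in the wealth, up to the left end `l a`, is enough. -/
theorem upperSemicontinuousOn_controlValue (x : ℝ) :
    UpperSemicontinuousOn (fun a => (M.controlValue w x a).toReal) (M.portfolioInterval x) := by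
  intro a ha B hB
  have hβ := rate_pos hM hU
  obtain ⟨hap, hl⟩ := hM.mem_portfolioInterval.1 ha
  set I := ∫ z, (1 + |z|) ∂(M.p 0)
  have hI : 0 ≤ I := integral_nonneg fun z => by positivity
  have hC := growthConst_nonneg hM hU
  set D := M.lam / (M.rho + M.lam)
  have hD : 0 ≤ D := div_nonneg hM.lam_pos.le hβ.le
  have h1 : ContinuousAt (fun a' => (M.controlValue w (x + |M.l a - M.l a'|) a).toReal +
      D * (M.growthConst k γ K₁ * |a - a'| ^ γ * I)) a := by
    refine ContinuousAt.add ?_ ?_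
    · have hcw := hw.continuousOn_controlValue hM hU hap x hl
      have ht : Tendsto (fun a' => x + |M.l a - M.l a'|) (𝓝 a) (𝓝[Ici (M.l a)] x) := by
        refine tendsto_nhdsWithin_iff.2 ⟨?_, Eventually.of_forall fun a' => ?_⟩
        · have hlc := ReturnAssumptions.continuous_l (M := M)
          have : Continuous fun a' => x + |M.l a - M.l a'| := by fun_prop
          simpa using this.tendsto a
        · exact mem_Ici.2 (by linarith [abs_nonneg (M.l a - M.l a')])
      have := hcw.tendsto.comp ht
      simpa [ContinuousAt, Function.comp_def] using this
    · refine (ContinuousAt.mul ?_ continuousAt_const).const_mul D |> fun h => h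
      refine ContinuousAt.const_mul ?_ _
      exact ContinuousAt.rpow_const (by fun_prop) (Or.inr hU.γ_mem.1.le)
  have h2 : (M.controlValue w (x + |M.l a - M.l a|) a).toReal +
      D * (M.growthConst k γ K₁ * |a - a| ^ γ * I) < B := by
    simpa [Real.zero_rpow hU.γ_mem.1.ne'] using hB
  filter_upwards [nhdsWithin_le_nhds (h1.eventually (gt_mem_nhds h2)), self_mem_nhdsWithin]
    with a' h3 ha'
  obtain ⟨hap', hl'⟩ := hM.mem_portfolioInterval.1 ha'
  refine lt_of_le_of_lt ?_ h3
  have h4 := (hw.controlValue_le_add hM hU (x := x) hap).trans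
    (add_le_add_right (mul_le_mul_right
      (hw.lintegral_scaled_le hM hU (abs_nonneg (a - a'))) _) _)
  have hne := hw.controlValue_ne_top hM hU hap
    (by linarith [abs_nonneg (M.l a - M.l a')] : M.l a ≤ x + |M.l a - M.l a'|)
  have h5 := ENNReal.toReal_mono (ENNReal.add_ne_top.2 ⟨hne, ENNReal.mul_ne_top
    ENNReal.ofReal_ne_top ENNReal.ofReal_ne_top⟩) h4
  rwa [ENNReal.toReal_add hne (ENNReal.mul_ne_top
    ENNReal.ofReal_ne_top ENNReal.ofReal_ne_top), ENNReal.toReal_mul, ENNReal.toReal_ofReal hD,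
    ENNReal.toReal_ofReal (by positivity)] at h5

/-- There is an optimal portfolio. -/
theorem exists_isMaxOn {x : ℝ} (hx : 0 ≤ x) : ∃ a ∈ M.portfolioInterval x,
    ∀ a' ∈ M.portfolioInterval x, M.controlValue w x a' ≤ M.controlValue w x a := by
  have hne : (M.portfolioInterval x).Nonempty := ⟨0, hM.mem_portfolioInterval.2
    ⟨ReturnAssumptions.zero_mem_portfolios, by rwa [ReturnAssumptions.l_zero]⟩⟩
  have hc : IsCompact (M.portfolioInterval x) := isCompact_Icc
  obtain ⟨a, ha, hmax⟩ := (hw.upperSemicontinuousOn_controlValue hM hU x).exists_isMaxOn hne hc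
  refine ⟨a, ha, fun a' ha' => ?_⟩
  obtain ⟨h1, h2⟩ := hM.mem_portfolioInterval.1 ha
  obtain ⟨h1', h2'⟩ := hM.mem_portfolioInterval.1 ha'
  exact (ENNReal.toReal_le_toReal (hw.controlValue_ne_top hM hU h1' h2')
    (hw.controlValue_ne_top hM hU h1 h2)).1 (hmax ha')

/-- A portfolio that leaves nothing for consumption is not optimal. -/
theorem exists_controlValue_lt {a : ℝ} (ha : a ∈ M.portfolios) (hx : 0 < M.l a) :
    ∃ a' ∈ M.portfolioInterval (M.l a),
      M.controlValue w (M.l a) a < M.controlValue w (M.l a) a' := by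
  have hβ := rate_pos hM hU
  have hI := hU.inadaUtility
  have he : Real.exp (-(M.rho + M.lam)) < 1 := by
    rw [Real.exp_lt_one_iff]
    linarith
  set x := M.l a with hxl
  set κ := (1 - Real.exp (-(M.rho + M.lam))) / (M.rho + M.lam) with hκ
  have hκ0 : 0 < κ := div_pos (by linarith) hβ
  set Ga := M.lam * (M.expectedNext w x a).toReal with hGa
  have ht : Tendsto (fun δ => δ * x) (𝓝[>] 0) (𝓝[>] 0) := by
    refine tendsto_nhdsWithin_iff.2 ⟨?_, ?_⟩
    · have : Continuous fun δ => δ * x := by fun_prop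
      have := (this.tendsto 0).mono_left (nhdsWithin_le_nhds (s := Ioi 0))
      simpa using this
    · filter_upwards [self_mem_nhdsWithin] with δ hδ using mul_pos hδ hx
  -- `Ga / β` is the value of `a`, as nothing can be consumed. Since `U (δ x) / (δ x)` is unbounded,
  -- `δ` can be chosen so that the utility `κ U (δ x)` of the freed wealth exceeds the loss `δ Ga /
  -- β`.
  obtain ⟨δ, ⟨hδ, hδ0⟩, hδ1⟩ := ((((hI.tendsto_div_atTop.comp ht).eventually_gt_atTop
    (Ga / (M.rho + M.lam) / (κ * x))).and self_mem_nhdsWithin).and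
    (nhdsWithin_le_nhds (Iio_mem_nhds one_pos))).exists
  have hδ0 : 0 < δ := hδ0
  have hδ1 : δ < 1 := hδ1
  have hlδ : M.l ((1 - δ) * a) = (1 - δ) * x := l_mul (by linarith) a
  have hap : (1 - δ) * a ∈ M.portfolios := fun h => mul_nonneg (by linarith) (ha h)
  have hle : (1 - δ) * x ≤ x := by
    have := mul_pos hδ0 hx
    linarith
  refine ⟨(1 - δ) * a, hM.mem_portfolioInterval.2 ⟨hap, hlδ.trans_le hle⟩, ?_⟩
  refine (ENNReal.toReal_lt_toReal (hw.controlValue_ne_top hM hU ha le_rfl)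
    (hw.controlValue_ne_top hM hU hap (hlδ.trans_le hle))).1 ?_
  have hv := (hw.consumptionValue hM hU ha).value_left hI hβ
  have hc := hw.consumptionValue hM hU hap
  have hv' := hc.value_left hI hβ
  have h1 := hc.le_value _ le_rfl (δ * x) (by positivity) 1 zero_le_one
  rw [hlδ, mul_one, mul_one, ← hκ] at h1
  rw [hlδ] at hv'
  have e1 : (1 - δ) * x + δ * x = x := by ring
  rw [e1] at h1
  -- Scaling wealth and portfolio together scales the terminal wealth, and concavity with `w 0 ≥ 0`
  -- limits the loss to the fraction `δ`.
  have h2 : (1 - δ) * Ga ≤ M.lam * (M.expectedNext w ((1 - δ) * x) ((1 - δ) * a)).toReal := by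
    have h3 : ENNReal.ofReal (1 - δ) * M.expectedNext w x a ≤
        M.expectedNext w ((1 - δ) * x) ((1 - δ) * a) := by
      rw [expectedNext, ← lintegral_const_mul' _ _ ENNReal.ofReal_ne_top]
      refine lintegral_mono_ae ?_
      filter_upwards [hM.ae_nonneg_iff.2 ⟨ha, le_refl (M.l a)⟩] with z hz
      have := hw.concave.mul_le hz (by linarith : 0 ≤ 1 - δ) (by linarith)
      rwa [mul_add, ← mul_assoc] at this
    have h4 := ENNReal.toReal_mono (hw.expectedNext_ne_top hM hU hap hlδ.le) h3
    rw [ENNReal.toReal_mul, ENNReal.toReal_ofReal (by linarith)] at h4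
    have := mul_le_mul_of_nonneg_left h4 hM.lam_pos.le
    rw [hGa]
    linarith
  rw [Function.comp_apply, div_lt_div_iff₀ (by positivity) (by positivity)] at hδ
  have h3 : Ga / (M.rho + M.lam) * δ < κ * M.U (δ * x) := by
    have h4 : x * (Ga / (M.rho + M.lam) * δ) < x * (κ * M.U (δ * x)) := by linarith
    exact lt_of_mul_lt_mul_left h4 hx.le
  have h5 : (M.controlValue w x a).toReal = Ga / (M.rho + M.lam) := by
    rw [eq_div_iff hβ.ne']
    linarith
  rw [h5]
  refine lt_of_lt_of_le ?_ h1
  rw [← hv']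
  have h6 : κ * (M.U (δ * x) + (M.rho + M.lam) *
      (M.controlValue w ((1 - δ) * x) ((1 - δ) * a)).toReal) +
      Real.exp (-(M.rho + M.lam)) * (M.controlValue w ((1 - δ) * x) ((1 - δ) * a)).toReal =
      κ * M.U (δ * x) + (M.controlValue w ((1 - δ) * x) ((1 - δ) * a)).toReal := by
    rw [hκ]
    field_simp
    ring
  rw [h6]
  have h7 : (1 - δ) * (Ga / (M.rho + M.lam)) ≤
      (M.controlValue w ((1 - δ) * x) ((1 - δ) * a)).toReal := by
    rw [← mul_div_assoc, div_le_iff₀ hβ]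
    linarith
  linarith

theorem l_lt_of_isMax {x a : ℝ} (hx : 0 < x) (ha : a ∈ M.portfolioInterval x)
    (hmax : ∀ a' ∈ M.portfolioInterval x, M.controlValue w x a' ≤ M.controlValue w x a) :
    M.l a < x := by
  obtain ⟨hap, hl⟩ := hM.mem_portfolioInterval.1 ha
  refine lt_of_le_of_ne hl fun h => ?_
  subst h
  obtain ⟨a', ha', hlt⟩ := hw.exists_controlValue_lt hM hU hap hx
  exact absurd (hmax a' ha') (not_le.2 hlt)

/-- With `a` optimal at `x`, the value of `a` is differentiable at `x`, stays feasible nearby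
because `l a < x`, and touches the concave `w` from below. -/
theorem differentiableAt (hfix : ∀ x, M.bellman w x = w x) {x : ℝ} (hx : 0 < x) :
    DifferentiableAt ℝ (fun y => (w y).toReal) x := by
  obtain ⟨a, ha, hmax⟩ := hw.exists_isMaxOn hM hU hx.le
  have hl := hw.l_lt_of_isMax hM hU hx ha hmax
  obtain ⟨hap, -⟩ := hM.mem_portfolioInterval.1 ha
  have hc := hw.consumptionValue hM hU hap
  have hd := (hc.differentiableAt hU.inadaUtility (rate_pos hM hU) hl).hasDerivAt
  refine ((hw.concave.concaveOn_toReal fun x _ => hw.ne_top x).hasDerivAt_of_touching hx hd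
    ?_ ?_).differentiableAt
  · filter_upwards [Ioi_mem_nhds hl] with y hy
    refine ENNReal.toReal_mono (hw.ne_top y) ?_
    rw [← hfix]
    exact controlValue_le_bellman (hM.mem_portfolioInterval.2 ⟨hap, le_of_lt hy⟩)
  · congr 1
    rw [← hfix]
    exact le_antisymm (controlValue_le_bellman ha) (iSup₂_le hmax)

theorem continuousOn_deriv (hfix : ∀ x, M.bellman w x = w x) :
    ContinuousOn (deriv fun y => (w y).toReal) (Ioi 0) :=
  (hw.concave.concaveOn_toReal fun x _ => hw.ne_top x).continuousOn_deriv_of_differentiable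
    fun _ hx => hw.differentiableAt hM hU hfix hx

theorem contDiffOn_one (hfix : ∀ x, M.bellman w x = w x) :
    ContDiffOn ℝ 1 (fun y => (w y).toReal) (Ioi 0) := by
  have e : (1 : WithTop ℕ∞) = 0 + 1 := by norm_num
  rw [e, contDiffOn_succ_iff_deriv_of_isOpen isOpen_Ioi]
  refine ⟨fun y hy => (hw.differentiableAt hM hU hfix hy).differentiableWithinAt, by simp, ?_⟩
  rw [contDiffOn_zero]
  exact hw.continuousOn_deriv hM hU hfix

omit hM in
theorem map_zero : w 0 = 0 := by
  have := hw.growth 0 le_rfl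
  rwa [Real.zero_rpow hU.γ_mem.1.ne', mul_zero, ENNReal.ofReal_zero, le_zero_iff] at this

theorem tendsto_deriv_atTop (hfix : ∀ x, M.bellman w x = w x) :
    Tendsto (deriv fun y => (w y).toReal) (𝓝[>] 0) atTop := by
  have hβ := rate_pos hM hU
  have hI := hU.inadaUtility
  have hp := ReturnAssumptions.zero_mem_portfolios (M := M)
  have hl0 := ReturnAssumptions.l_zero (M := M)
  refine (hw.concave.concaveOn_toReal fun x _ => hw.ne_top x).tendsto_deriv_atTop
    (fun _ hx => hw.differentiableAt hM hU hfix hx) ?_ ?_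
  · have := (ENNReal.tendsto_toReal ENNReal.zero_ne_top).comp (hw.tendsto_zero hU)
    simpa [ContinuousWithinAt, Function.comp_def, hw.map_zero hU] using this
  · have he : Real.exp (-(M.rho + M.lam)) < 1 := by
      rw [Real.exp_lt_one_iff]
      linarith
    have hκ0 : 0 < (1 - Real.exp (-(M.rho + M.lam))) / (M.rho + M.lam) :=
      div_pos (by linarith) hβ
    refine tendsto_atTop_mono' _ ?_ (hI.tendsto_div_atTop.const_mul_atTop hκ0)
    filter_upwards [self_mem_nhdsWithin] with x hx
    have hx : 0 < x := hx
    rw [slope_def_field, hw.map_zero hU, ENNReal.toReal_zero, sub_zero, sub_zero, mul_div_assoc',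
      div_le_div_iff_of_pos_right hx]
    -- Investing nothing and consuming `x` over one unit of time is enough.
    have hc := hw.consumptionValue hM hU hp
    have h1 := hc.le_value 0 hl0.le x hx.le 1 zero_le_one
    rw [zero_add, mul_one, mul_one] at h1
    have h2 : (M.controlValue w x 0).toReal ≤ (w x).toReal := by
      refine ENNReal.toReal_mono (hw.ne_top x) ?_
      rw [← hfix]
      exact controlValue_le_bellman (hM.mem_portfolioInterval.2 ⟨hp, hl0.trans_le hx.le⟩)
    refine le_trans ?_ (h1.trans h2)
    have h3 : 0 ≤ M.lam * (M.expectedNext w 0 0).toReal :=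
      mul_nonneg hM.lam_pos.le ENNReal.toReal_nonneg
    have h4 : 0 ≤ Real.exp (-(M.rho + M.lam)) * (M.controlValue w 0 0).toReal :=
      mul_nonneg (Real.exp_pos _).le ENNReal.toReal_nonneg
    have h5 := mul_nonneg hκ0.le h3
    rw [mul_add]
    linarith

/-- For `y` above `l a`, the wealth `y' + a z` stays above some `ε > 0` for almost all `z` and all
`y'` near `y`. There `v'` is bounded by `v' ε`, which justifies differentiation under the integral
although `v'` explodes at `0`. -/
theorem hasDerivAt_expectedNext (hfix : ∀ x, M.bellman w x = w x) {a : ℝ} (ha : a ∈ M.portfolios)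
    {y : ℝ} (hy : M.l a < y) : HasDerivAt (fun y => M.lam * (M.expectedNext w y a).toReal)
      (M.lam * ∫ z, deriv (fun y => (w y).toReal) (y + a * z) ∂(M.p 0)) y ∧
    ContinuousAt (fun y => M.lam * ∫ z, deriv (fun y => (w y).toReal) (y + a * z) ∂(M.p 0)) y := by
  have := hM.isProb_zero
  set v : ℝ → ℝ := fun y => (w y).toReal with hv
  have hconc : ConcaveOn ℝ (Ici 0) v := hw.concave.concaveOn_toReal fun x _ => hw.ne_top x
  have hdiff : ∀ x, 0 < x → DifferentiableAt ℝ v x := fun x hx => hw.differentiableAt hM hU hfix hx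
  have hanti : AntitoneOn (deriv v) (Ioi 0) :=
    (hconc.subset Ioi_subset_Ici_self (convex_Ioi 0)).antitoneOn_deriv hdiff
  have hvmono : Monotone v := fun x y hxy => ENNReal.toReal_mono (hw.ne_top y) (hw.mono hxy)
  have hnn : ∀ x, 0 ≤ deriv v x := fun x => hvmono.deriv_nonneg
  have heq : ∀ y, (M.expectedNext w y a).toReal = ∫ z, v (y + a * z) ∂(M.p 0) := by
    intro y
    exact (integral_toReal (f := fun z => w (y + a * z))
      (hw.mono.measurable.comp (by fun_prop)).aemeasurable
      (ae_of_all _ fun z => (hw.ne_top _).lt_top)).symm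
  set ε := (y - M.l a) / 2 with hε
  have hε0 : 0 < ε := by linarith
  have hball : ∀ᵐ z ∂(M.p 0), ∀ y' ∈ Metric.ball y ε, ε < y' + a * z := by
    filter_upwards [hM.ae_nonneg_iff.2 ⟨ha, le_refl (M.l a)⟩] with z hz y' hy'
    rw [Metric.mem_ball, Real.dist_eq] at hy'
    have := (abs_lt.1 hy').1
    linarith
  have hbound : ∀ᵐ z ∂(M.p 0), ∀ y' ∈ Metric.ball y ε, ‖deriv v (y' + a * z)‖ ≤ deriv v ε := by
    filter_upwards [hball] with z hz y' hy'
    rw [Real.norm_of_nonneg (hnn _)]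
    exact hanti hε0 (hε0.trans (hz y' hy')) (hz y' hy').le
  have hmeas : ∀ y', AEStronglyMeasurable (fun z => v (y' + a * z)) (M.p 0) := fun y' =>
    (hvmono.measurable.comp (by fun_prop)).aestronglyMeasurable
  have hmeas' : ∀ y', AEStronglyMeasurable (fun z => deriv v (y' + a * z)) (M.p 0) := fun y' =>
    ((measurable_deriv v).comp (by fun_prop)).aestronglyMeasurable
  constructor
  · have hint : Integrable (fun z => v (y + a * z)) (M.p 0) := by
      refine integrable_toReal_of_lintegral_ne_top
        (hw.mono.measurable.comp (by fun_prop)).aemeasurable ?_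
      exact hw.expectedNext_ne_top hM hU ha hy.le
    have h1 := (hasDerivAt_integral_of_dominated_loc_of_deriv_le (F := fun y z => v (y + a * z))
      (F' := fun y z => deriv v (y + a * z)) (bound := fun _ => deriv v ε) (x₀ := y)
      (Metric.ball_mem_nhds y hε0) (Eventually.of_forall hmeas) hint (hmeas' y) hbound
      (integrable_const _) ?_).2
    · simp only [heq]
      exact h1.const_mul M.lam
    · filter_upwards [hball] with z hz y' hy'
      exact (hdiff _ (hε0.trans (hz y' hy'))).hasDerivAt.comp_add_const y' (a * z)
  · refine ContinuousAt.const_mul ?_ M.lam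
    refine continuousAt_of_dominated (bound := fun _ => deriv v ε) (Eventually.of_forall hmeas')
      ?_ (integrable_const _) ?_
    · filter_upwards [Metric.ball_mem_nhds y hε0] with y' hy'
      filter_upwards [hbound] with z hz using hz y' hy'
    · filter_upwards [hball] with z hz
      have hp : 0 < y + a * z := hε0.trans (hz y (Metric.mem_ball_self hε0))
      have hc := (hw.continuousOn_deriv hM hU hfix _ hp).continuousAt (Ioi_mem_nhds hp)
      exact ContinuousAt.comp (g := deriv v) hc (by fun_prop)

/-- The value for a given portfolio is of class `C²`. -/
theorem contDiffOn_controlValue (hfix : ∀ x, M.bellman w x = w x) {a : ℝ}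
    (ha : a ∈ M.portfolios) :
    ContDiffOn ℝ 2 (fun x => (M.controlValue w x a).toReal) (Ioi (M.l a)) :=
  (hw.consumptionValue hM hU ha).contDiffOn_two hU.inadaUtility (rate_pos hM hU)
    (fun _ hy => (hw.hasDerivAt_expectedNext hM hU hfix ha hy).1)
    fun _ hy => (hw.hasDerivAt_expectedNext hM hU hfix ha hy).2.continuousWithinAt

theorem tendsto_deriv_controlValue {a : ℝ} (ha : a ∈ M.portfolios) :
    Tendsto (deriv fun x => (M.controlValue w x a).toReal) (𝓝[>] (M.l a)) atTop :=
  (hw.consumptionValue hM hU ha).tendsto_deriv_atTop hU.inadaUtility (rate_pos hM hU)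
    (hw.monotoneOn_controlValue hM hU ha) (hw.continuousWithinAt_expectedNext hM hU ha)

end ValueClass

end IlliquidMarket

/-! ### Time invariance and the conclusions for a fixed point -/

namespace IlliquidMarket

variable {Ω : Type*} [mΩ : MeasurableSpace Ω] {M : IlliquidMarket Ω} {P : Measure Ω} {k b γ K₁ : ℝ}

theorem isConsumption_comp_add {t x a : ℝ} {c : ℝ → ℝ} (hc : M.IsConsumption t x a c) (r : ℝ) :
    M.IsConsumption (t - r) x a fun s => c (s + r) where
  measurable := hc.measurable.comp (measurable_id.add_const r)
  nonneg s := hc.nonneg _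
  integrable s hs := by
    have := (hc.integrable (s + r) (by linarith)).comp_add_right r
    simpa using this
  integral_le s hs := by
    rw [intervalIntegral.integral_comp_add_right, sub_add_cancel]
    exact hc.integral_le (s + r) (by linarith)

theorem lintegral_aux_eq_objective (hstat : ∀ t, 0 ≤ t → M.p t = M.p 0) {t x a : ℝ} (ht : 0 ≤ t)
    (c : ℝ → ℝ) :
    (∫⁻ s in Set.Ici t, ENNReal.ofReal (Real.exp (-(M.rho + M.lam) * (s - t))) *
      (ENNReal.ofReal (M.U (c s)) + ENNReal.ofReal M.lam *
        ∫⁻ z, M.value P ((x - ∫ u in t..s, c u) + a * z) ∂(M.p s))) =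
      M.objective (M.value P) x a fun s => c (s + t) := by
  rw [setLIntegral_congr Ioi_ae_eq_Ici.symm, objective]
  have hp : (fun s : ℝ => s + t) ⁻¹' Ioi t = Ioi 0 := by
    ext s
    simp
  rw [← (measurePreserving_add_right volume t).setLIntegral_comp_preimage_emb
    (measurableEmbedding_addRight t) _ (Ioi t), hp]
  refine setLIntegral_congr_fun measurableSet_Ioi fun s hs => ?_
  have hs : 0 < s := hs
  simp only [add_sub_cancel_right, expectedNext]
  rw [hstat (s + t) (by linarith), intervalIntegral.integral_comp_add_right, zero_add]

/-- In the stationary case the auxiliary value function does not depend on time. -/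
theorem auxValue_eq_controlValue (hstat : ∀ t, 0 ≤ t → M.p t = M.p 0) {t x a : ℝ} (ht : 0 ≤ t) :
    M.auxValue P t x a = M.controlValue (M.value P) x a := by
  refine le_antisymm (iSup₂_le fun c hc => ?_) (iSup₂_le fun c hc => ?_)
  · rw [lintegral_aux_eq_objective hstat ht]
    refine objective_le_controlValue ?_
    have := isConsumption_comp_add hc t
    rwa [sub_self] at this
  · have := isConsumption_comp_add hc (-t)
    rw [zero_sub, neg_neg] at this
    refine le_iSup₂_of_le _ this ?_
    rw [lintegral_aux_eq_objective hstat ht]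
    simp

/-- The conclusions of the main theorem, once the value function is known to be a fixed point of
the dynamic programming operator. -/
theorem regularity_of_value_eq (hM : M.ReturnAssumptions P k b)
    (hU : M.UtilityAssumptions k b γ K₁) (hstat : ∀ t, 0 ≤ t → M.p t = M.p 0)
    (hv : M.value P = M.limitValue) :
    (∀ x, 0 ≤ x → M.value P x < ⊤) ∧
    (∀ t x a, 0 ≤ t → a ∈ M.portfolios → M.l a ≤ x → M.auxValue P t x a < ⊤) ∧
    (∀ x, 0 ≤ x → M.value P x = ⨆ a ∈ M.portfolioInterval x, M.auxValue P 0 x a) ∧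
    ContDiffOn ℝ 1 (fun x => (M.value P x).toReal) (Set.Ioi 0) ∧
    Tendsto (deriv fun x => (M.value P x).toReal) (𝓝[>] 0) atTop ∧
    (∀ x, 0 < x → ∀ a ∈ M.portfolioInterval x,
      IsMaxOn (fun a' => M.auxValue P 0 x a') (M.portfolioInterval x) a →
        M.l a < x ∧ M.portfolioInterval x ∈ 𝓝[M.portfolios] a) ∧
    (∀ t, 0 ≤ t → ∀ a ∈ M.portfolios,
      ContDiffOn ℝ 2 (fun x => (M.auxValue P t x a).toReal) (Set.Ioi (M.l a)) ∧
      Tendsto (deriv fun x => (M.auxValue P t x a).toReal) (𝓝[>] (M.l a)) atTop) := by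
  have hw : M.ValueClass k γ K₁ (M.value P) := hv ▸ limitValue_class hM hU
  have hfix : ∀ x, M.bellman (M.value P) x = M.value P x := by
    rw [hv]
    exact bellman_limitValue hM hU
  refine ⟨fun x _ => (hw.ne_top x).lt_top, fun t x a ht ha hl => ?_, fun x _ => ?_,
    hw.contDiffOn_one hM hU hfix, hw.tendsto_deriv_atTop hM hU hfix, fun x hx a ha hmax => ?_,
    fun t ht a ha => ?_⟩
  · rw [auxValue_eq_controlValue hstat ht]
    exact (hw.controlValue_ne_top hM hU ha hl).lt_top
  · simp only [auxValue_eq_controlValue hstat le_rfl]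
    exact (hfix x).symm
  · simp only [auxValue_eq_controlValue hstat le_rfl] at hmax
    have hl := hw.l_lt_of_isMax hM hU hx ha hmax
    refine ⟨hl, ?_⟩
    filter_upwards [self_mem_nhdsWithin, nhdsWithin_le_nhds
      ((ReturnAssumptions.continuous_l (M := M)).continuousAt.eventually (gt_mem_nhds hl))]
      with a' ha' hl'
    exact hM.mem_portfolioInterval.2 ⟨ha', le_of_lt hl'⟩
  · simp only [auxValue_eq_controlValue hstat ht]
    exact ⟨hw.contDiffOn_controlValue hM hU hfix ha, hw.tendsto_deriv_controlValue hM hU ha⟩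

end IlliquidMarket

/-! ### Independence and exponential waiting times -/

/-- Independence of three random elements, in terms of lower Lebesgue integrals. -/
theorem lintegral_of_indep_triple {Ω Ω' : Type*} [MeasurableSpace Ω] [MeasurableSpace Ω']
    {P : Measure Ω} [IsProbabilityMeasure P] {Y : Ω → Ω'} {W Z : Ω → ℝ} (hY : Measurable Y)
    (hW : Measurable W) (hZ : Measurable Z) {ν₁ ν₂ : Measure ℝ} [IsProbabilityMeasure ν₁]
    [IsProbabilityMeasure ν₂]
    (h : ∀ A B C, MeasurableSet A → MeasurableSet B → MeasurableSet C →
      P (Y ⁻¹' A ∩ W ⁻¹' B ∩ Z ⁻¹' C) = P (Y ⁻¹' A) * ν₁ B * ν₂ C)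
    {F : Ω' × ℝ × ℝ → ℝ≥0∞} (hF : Measurable F) :
    ∫⁻ ω, F (Y ω, W ω, Z ω) ∂P = ∫⁻ ω, ∫⁻ t, ∫⁻ z, F (Y ω, t, z) ∂ν₂ ∂ν₁ ∂P := by
  have hYP : IsProbabilityMeasure (P.map Y) := Measure.isProbabilityMeasure_map hY.aemeasurable
  have hlaw : (P.map Y).prod (ν₁.prod ν₂) = P.map fun ω => (Y ω, W ω, Z ω) := by
    refine Measure.prod_eq fun A D hA hD => ?_
    rw [Measure.map_apply (hY.prodMk (hW.prodMk hZ)) (hA.prod hD), Measure.map_apply hY hA]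
    -- With the event `Y ∈ A` fixed, the restricted law of the other two is identified first on
    -- rectangles, which gives all measurable `D`.
    have h1 : ((P (Y ⁻¹' A)) • ν₁).prod ν₂ =
        (P.restrict (Y ⁻¹' A)).map fun ω => (W ω, Z ω) := by
      have : IsFiniteMeasure ((P (Y ⁻¹' A)) • ν₁) := Measure.smul_finite _ (measure_ne_top P _)
      refine Measure.prod_eq fun B C hB hC => ?_
      rw [Measure.map_apply (hW.prodMk hZ) (hB.prod hC),
        Measure.restrict_apply ((hW.prodMk hZ) (hB.prod hC)), Measure.smul_apply, smul_eq_mul,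
        ← h A B C hA hB hC]
      congr 1
      ext ω
      simp only [mem_inter_iff, mem_preimage, mem_prod]
      tauto
    rw [Measure.prod_smul_left] at h1
    have h2 := congrArg (fun m => m D) h1
    simp only [Measure.smul_apply, smul_eq_mul] at h2
    rw [h2, Measure.map_apply (hW.prodMk hZ) hD, Measure.restrict_apply ((hW.prodMk hZ) hD)]
    congr 1
    ext ω
    simp only [mem_inter_iff, mem_preimage, mem_prod]
    tauto
  have hF' : ∀ y, Measurable fun q : ℝ × ℝ => F (y, q) := fun y => hF.comp (by fun_prop)
  rw [← lintegral_map (f := F) (g := fun ω => (Y ω, W ω, Z ω)) hF (hY.prodMk (hW.prodMk hZ)),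
    ← hlaw, lintegral_prod _ hF.aemeasurable, lintegral_map hF.lintegral_prod_right' hY]
  refine lintegral_congr fun ω => ?_
  rw [lintegral_prod _ (hF' _).aemeasurable]

section Exponential

variable {r : ℝ}

theorem lintegral_expMeasure {f : ℝ → ℝ≥0∞} (hf : Measurable f) :
    ∫⁻ t, f t ∂(expMeasure r) =
      ∫⁻ t in Ioi (0 : ℝ), ENNReal.ofReal (r * Real.exp (-r * t)) * f t := by
  have h1 : expMeasure r = volume.withDensity (exponentialPDF r) := rfl
  have hm : Measurable (exponentialPDF r) := (measurable_exponentialPDFReal r).ennreal_ofReal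
  rw [h1, lintegral_withDensity_eq_lintegral_mul _ hm hf, ← lintegral_add_compl _
    (measurableSet_Ioi (a := (0 : ℝ))), compl_Ioi, setLIntegral_congr Iio_ae_eq_Iic.symm,
    setLIntegral_congr_fun (g := fun _ => 0) (s := Iio 0) measurableSet_Iio, lintegral_zero, add_zero]
  · refine setLIntegral_congr_fun measurableSet_Ioi fun t ht => ?_
    rw [Pi.mul_apply, exponentialPDF_of_nonneg (le_of_lt ht), neg_mul]
  · intro t ht
    rw [Pi.mul_apply, exponentialPDF_of_neg ht, zero_mul]

theorem expMeasure_Ici (hr : 0 < r) {s : ℝ} (hs : 0 < s) :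
    expMeasure r (Ici s) = ENNReal.ofReal (Real.exp (-r * s)) := by
  have hr' : -r < 0 := by linarith
  have hsub : Ici s ∩ Ioi 0 = Ici s := inter_eq_left.2 fun t ht => lt_of_lt_of_le hs ht
  rw [← lintegral_indicator_one measurableSet_Ici, lintegral_expMeasure
    (measurable_one.indicator measurableSet_Ici)]
  have h1 : ∀ t, ENNReal.ofReal (r * Real.exp (-r * t)) * (Ici s).indicator 1 t =
      (Ici s).indicator (fun t => ENNReal.ofReal (r * Real.exp (-r * t))) t := by
    intro t
    by_cases ht : t ∈ Ici s <;> simp [ht]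
  simp only [h1]
  rw [lintegral_indicator measurableSet_Ici, Measure.restrict_restrict measurableSet_Ici,
    hsub, setLIntegral_congr Ioi_ae_eq_Ici.symm,
    ← ofReal_integral_eq_lintegral_ofReal ((integrableOn_exp_mul_Ioi hr' s).const_mul r)
    (ae_of_all _ fun _ => by positivity), integral_const_mul, integral_exp_mul_Ioi hr']
  congr 1
  field_simp

theorem expMeasure_Iic_zero : expMeasure r (Iic 0) = 0 := by
  have h1 : expMeasure r = volume.withDensity (exponentialPDF r) := rfl
  rw [h1, withDensity_apply _ measurableSet_Iic, setLIntegral_congr Iio_ae_eq_Iic.symm]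
  exact lintegral_exponentialPDF_of_nonpos le_rfl

theorem ae_pos_expMeasure : ∀ᵐ t ∂(expMeasure r), 0 < t :=
  (measure_eq_zero_iff_ae_notMem.1 expMeasure_Iic_zero).mono fun _ ht => not_le.1 ht

/-- Every tail has positive mass, so an almost sure property holds at arbitrarily late times. For
constraints that are monotone in time this yields all times. -/
theorem frequently_expMeasure (hr : 0 < r) {p : ℝ → Prop} (h : ∀ᵐ t ∂(expMeasure r), p t)
    {s : ℝ} (hs : 0 < s) : ∃ t, s ≤ t ∧ p t := by
  by_contra! hne
  have h1 : expMeasure r (Ici s) = 0 := measure_mono_null (fun t ht => hne t ht) h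
  rw [expMeasure_Ici hr hs, ENNReal.ofReal_eq_zero] at h1
  exact absurd (Real.exp_pos _) (not_lt.2 h1)

end Exponential

namespace IlliquidMarket

variable {Ω : Type*} [mΩ : MeasurableSpace Ω] {M : IlliquidMarket Ω} {P : Measure Ω} {k b γ K₁ : ℝ}

theorem waiting_pos (n : ℕ) (ω : Ω) : 0 < M.waiting n ω :=
  sub_pos.2 (M.τ_strictMono ω n.lt_succ_self)

theorem measurable_waiting (n : ℕ) : Measurable (M.waiting n) :=
  (M.measurable_τ (n + 1)).sub (M.measurable_τ n)

theorem discreteObs_le (n : ℕ) : M.discreteObs n ≤ mΩ :=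
  iSup₂_le fun i _ => ((M.measurable_τ i).prodMk (M.measurable_Z i)).comap_le

theorem measurable_discreteObs_pair {i n : ℕ} (h1 : 1 ≤ i) (h2 : i ≤ n) :
    Measurable[M.discreteObs n] fun ω => (M.τ i ω, M.Z i ω) := by
  refine Measurable.mono (comap_measurable _) ?_ le_rfl
  exact le_iSup₂_of_le (f := fun i _ => MeasurableSpace.comap
    (fun ω => (M.τ i ω, M.Z i ω)) inferInstance) i (mem_Icc.2 ⟨h1, h2⟩) le_rfl

theorem discreteObs_mono {m n : ℕ} (h : m ≤ n) : M.discreteObs m ≤ M.discreteObs n :=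
  iSup₂_le fun _ hi => (measurable_discreteObs_pair (mem_Icc.1 hi).1
    ((mem_Icc.1 hi).2.trans h)).comap_le

theorem measurable_discreteObs_τ {i n : ℕ} (h : i ≤ n) : Measurable[M.discreteObs n] (M.τ i) := by
  rcases Nat.eq_zero_or_pos i with rfl | hi
  · have : M.τ 0 = fun _ => 0 := funext M.τ_zero
    rw [this]
    exact measurable_const
  · exact measurable_fst.comp (measurable_discreteObs_pair hi h)

theorem measurable_discreteObs_Z {i n : ℕ} (h1 : 1 ≤ i) (h : i ≤ n) :
    Measurable[M.discreteObs n] (M.Z i) :=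
  measurable_snd.comp (measurable_discreteObs_pair h1 h)

theorem measurable_discreteObs_waiting {i n : ℕ} (h : i < n) :
    Measurable[M.discreteObs n] (M.waiting i) :=
  (measurable_discreteObs_τ h).sub (measurable_discreteObs_τ h.le)

variable [IsProbabilityMeasure P]

/-- In the stationary case, the past, the next waiting time and the next return are independent. -/
theorem measure_inter_eq (hM : M.ReturnAssumptions P k b) (hstat : ∀ t, 0 ≤ t → M.p t = M.p 0)
    (n : ℕ) {A : Set Ω} {B C : Set ℝ} (hA : MeasurableSet[M.discreteObs n] A)
    (hB : MeasurableSet B) (hC : MeasurableSet C) :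
    P (A ∩ M.waiting n ⁻¹' B ∩ M.Z (n + 1) ⁻¹' C) = P A * expMeasure M.lam B * M.p 0 C := by
  have := hM.isProb_zero
  have hmle : M.discreteObs n ⊔ MeasurableSpace.comap (M.waiting n) inferInstance ≤ mΩ := sup_le (discreteObs_le n) (measurable_waiting n).comap_le
  have hS : MeasurableSet[M.discreteObs n ⊔
      MeasurableSpace.comap (M.waiting n) inferInstance] (A ∩ M.waiting n ⁻¹' B) :=
    MeasurableSet.inter (le_sup_left (a := M.discreteObs n) A hA)
      (le_sup_right (a := M.discreteObs n) (M.waiting n ⁻¹' B) ⟨B, hB, rfl⟩)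
  have hZ : MeasurableSet (M.Z (n + 1) ⁻¹' C) := M.measurable_Z (n + 1) hC
  have hc := hM.condDistrib_return n C hC
  have h1 : P⟦M.Z (n + 1) ⁻¹' C | M.discreteObs n ⊔
      MeasurableSpace.comap (M.waiting n) inferInstance⟧ =ᵐ[P] fun _ => (M.p 0).real C := by
    filter_upwards [hc] with ω hω
    rw [hω, hstat _ (waiting_pos n ω).le]
  have h2 : P.real (A ∩ M.waiting n ⁻¹' B ∩ M.Z (n + 1) ⁻¹' C) =
      P.real (A ∩ M.waiting n ⁻¹' B) * (M.p 0).real C := by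
    have h3 := setIntegral_condExp hmle (μ := P)
      (f := (M.Z (n + 1) ⁻¹' C).indicator fun _ => (1 : ℝ))
      ((integrable_const _).indicator hZ) hS
    rw [setIntegral_congr_ae (hmle _ hS) (h1.mono fun ω hω _ => hω), setIntegral_const,
      setIntegral_indicator hZ, setIntegral_const, smul_eq_mul, smul_eq_mul, mul_one] at h3
    exact h3.symm
  have h4 : P (A ∩ M.waiting n ⁻¹' B) = P A * expMeasure M.lam B := by
    rw [(Indep_iff _ _ P).1 (hM.indep_waiting n) A (M.waiting n ⁻¹' B) hA ⟨B, hB, rfl⟩,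
      ← hM.law_waiting n, Measure.map_apply (measurable_waiting n) hB]
  rw [← h4, ← ENNReal.toReal_eq_toReal_iff' (measure_ne_top _ _)
    (ENNReal.mul_ne_top (measure_ne_top _ _) (measure_ne_top _ _)), ENNReal.toReal_mul]
  exact h2

/-- The past is represented by the identity map into `Ω` with the coarser σ-algebra `discreteObs n`,
so `F` may depend on it in any observable way. -/
theorem lintegral_next (hM : M.ReturnAssumptions P k b) (hstat : ∀ t, 0 ≤ t → M.p t = M.p 0)
    (n : ℕ) {F : Ω × ℝ × ℝ → ℝ≥0∞}
    (hF : Measurable[(M.discreteObs n).prod inferInstance] F) :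
    ∫⁻ ω, F (ω, M.waiting n ω, M.Z (n + 1) ω) ∂P =
      ∫⁻ ω, ∫⁻ t, ∫⁻ z, F (ω, t, z) ∂(M.p 0) ∂(expMeasure M.lam) ∂P := by
  have := hM.isProb_zero
  have := isProbabilityMeasure_expMeasure hM.lam_pos
  refine @lintegral_of_indep_triple Ω Ω mΩ (M.discreteObs n) P _ id (M.waiting n) (M.Z (n + 1))
    (measurable_id'' (discreteObs_le n)) (measurable_waiting n) (M.measurable_Z (n + 1))
    _ _ _ _ ?_ F hF
  intro A B C hA hB hC
  exact measure_inter_eq hM hstat n hA hB hC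

omit [IsProbabilityMeasure P] in
theorem measurable_exp_neg_τ (n : ℕ) :
    Measurable fun ω => ENNReal.ofReal (Real.exp (-M.τ n ω)) :=
  (M.measurable_τ n).neg.exp.ennreal_ofReal

/-- The Laplace transform of a sum of independent exponential times. It tends to `0`, which excludes
accumulation of observations. -/
theorem lintegral_exp_neg_τ (hM : M.ReturnAssumptions P k b)
    (hstat : ∀ t, 0 ≤ t → M.p t = M.p 0) (n : ℕ) :
    ∫⁻ ω, ENNReal.ofReal (Real.exp (-M.τ n ω)) ∂P = ENNReal.ofReal (M.lam / (1 + M.lam)) ^ n := by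
  have := hM.isProb_zero
  have hlam := hM.lam_pos
  induction n with
  | zero => simp [M.τ_zero]
  | succ n ih =>
    have h1 : ∀ ω, ENNReal.ofReal (Real.exp (-M.τ (n + 1) ω)) =
        ENNReal.ofReal (Real.exp (-M.τ n ω)) * ENNReal.ofReal (Real.exp (-M.waiting n ω)) := by
      intro ω
      rw [← ENNReal.ofReal_mul (Real.exp_pos _).le, ← Real.exp_add, waiting]
      ring_nf
    have h2 := lintegral_next hM hstat n (F := fun q => ENNReal.ofReal (Real.exp (-M.τ n q.1)) *
      ENNReal.ofReal (Real.exp (-q.2.1))) (by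
        have h3 : Measurable[M.discreteObs n] fun ω => ENNReal.ofReal (Real.exp (-M.τ n ω)) :=
          ((measurable_discreteObs_τ le_rfl).neg.exp).ennreal_ofReal
        exact (h3.comp measurable_fst).mul (measurable_snd.fst.neg.exp).ennreal_ofReal)
    simp only [h1, h2, lintegral_const, measure_univ, mul_one]
    have h4 : ∫⁻ t, ENNReal.ofReal (Real.exp (-t)) ∂(expMeasure M.lam) =
        ENNReal.ofReal (M.lam / (1 + M.lam)) := by
      rw [lintegral_expMeasure (by fun_prop)]
      have h5 : ∀ t, ENNReal.ofReal (M.lam * Real.exp (-M.lam * t)) *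
          ENNReal.ofReal (Real.exp (-t)) =
          ENNReal.ofReal M.lam * ENNReal.ofReal (Real.exp (-(1 + M.lam) * t)) := by
        intro t
        rw [← ENNReal.ofReal_mul (by positivity), ← ENNReal.ofReal_mul hlam.le, mul_assoc,
          ← Real.exp_add]
        ring_nf
      simp only [h5]
      rw [lintegral_const_mul _ (by fun_prop), lintegral_exp_neg_Ioi (by linarith),
        ← ENNReal.ofReal_mul hlam.le, mul_one_div]
    simp_rw [lintegral_const_mul' _ _ ENNReal.ofReal_ne_top, h4]
    rw [lintegral_mul_const _ (measurable_exp_neg_τ n), ih, pow_succ]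

/-- The observation times tend to infinity. -/
theorem ae_exists_lt_τ (hM : M.ReturnAssumptions P k b)
    (hstat : ∀ t, 0 ≤ t → M.p t = M.p 0) : ∀ᵐ ω ∂P, ∀ t : ℝ, ∃ n, t < M.τ n ω := by
  have hlam := hM.lam_pos
  have hlt : ENNReal.ofReal (M.lam / (1 + M.lam)) < 1 := by
    rw [ENNReal.ofReal_lt_one, div_lt_one (by linarith)]
    linarith
  have h0 : ∫⁻ ω, ⨅ n, ENNReal.ofReal (Real.exp (-M.τ n ω)) ∂P = 0 := by
    refine le_antisymm (ge_of_tendsto' (ENNReal.tendsto_pow_atTop_nhds_zero_of_lt_one hlt)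
      fun n => ?_) zero_le
    rw [← lintegral_exp_neg_τ hM hstat n]
    exact lintegral_mono fun ω => iInf_le _ n
  rw [lintegral_eq_zero_iff (Measurable.iInf fun n =>
    measurable_exp_neg_τ n)] at h0
  filter_upwards [h0] with ω hω t
  have h1 : ⨅ n, ENNReal.ofReal (Real.exp (-M.τ n ω)) < ENNReal.ofReal (Real.exp (-t)) := by
    rw [show (⨅ n, ENNReal.ofReal (Real.exp (-M.τ n ω))) = 0 from hω]
    exact ENNReal.ofReal_pos.2 (Real.exp_pos _)
  obtain ⟨n, hn⟩ := iInf_lt_iff.1 h1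
  refine ⟨n, ?_⟩
  rw [ENNReal.ofReal_lt_ofReal_iff (Real.exp_pos _), Real.exp_lt_exp] at hn
  linarith

end IlliquidMarket

/-! ### Policies described period by period -/

/-- The cumulative consumption up to time `t`. -/
noncomputable def cumul (f : ℝ → ℝ) (t : ℝ) : ℝ≥0∞ := ∫⁻ u in Ioc 0 t, ENNReal.ofReal (f u)

theorem measurable_lintegral_Ioc {α : Type*} [MeasurableSpace α] {G : α × ℝ → ℝ≥0∞}
    (hG : Measurable G) : Measurable fun q : α × ℝ => ∫⁻ s in Ioc 0 q.2, G (q.1, s) := by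
  have h1 : Measurable fun q : (α × ℝ) × ℝ =>
      {q : (α × ℝ) × ℝ | 0 < q.2 ∧ q.2 ≤ q.1.2}.indicator (fun q => G (q.1.1, q.2)) q := by
    refine Measurable.indicator (hG.comp (by fun_prop)) ?_
    exact (measurableSet_lt measurable_const measurable_snd).inter
      (measurableSet_le measurable_snd (by fun_prop))
  refine (congrArg Measurable (funext fun q => ?_)).mp
    (h1.lintegral_prod_right' (ν := volume))
  rw [← lintegral_indicator measurableSet_Ioc]
  rfl

theorem monotone_setLIntegral_Ioc (g : ℝ → ℝ≥0∞) : Monotone fun t => ∫⁻ s in Ioc (0 : ℝ) t, g s :=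
  fun _ _ h => lintegral_mono_set (Ioc_subset_Ioc_right h)

theorem integral_eq_cumul {f : ℝ → ℝ} (hf : Measurable f) (h0 : ∀ s, 0 ≤ f s) {t : ℝ}
    (ht : 0 ≤ t) : ∫ u in (0 : ℝ)..t, f u = (cumul f t).toReal := by
  rw [intervalIntegral.integral_of_le ht, integral_eq_lintegral_of_nonneg_ae (ae_of_all _ h0)
    hf.aestronglyMeasurable, cumul]

theorem intervalIntegrable_of_cumul_ne_top {f : ℝ → ℝ} (hf : Measurable f) (h0 : ∀ s, 0 ≤ f s)
    {t : ℝ} (ht : 0 ≤ t) (h : cumul f t ≠ ⊤) : IntervalIntegrable f volume 0 t := by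
  rw [intervalIntegrable_iff_integrableOn_Ioc_of_le ht]
  refine ⟨hf.aestronglyMeasurable, ?_⟩
  rw [hasFiniteIntegral_iff_ofReal (ae_of_all _ h0)]
  exact h.lt_top

theorem cumul_ne_top {f : ℝ → ℝ} {t : ℝ} (ht : 0 ≤ t)
    (h : IntervalIntegrable f volume 0 t) : cumul f t ≠ ⊤ := by
  rw [intervalIntegrable_iff_integrableOn_Ioc_of_le ht] at h
  exact (Integrable.lintegral_lt_top h).ne

namespace IlliquidMarket

variable {Ω : Type*} [mΩ : MeasurableSpace Ω] {M : IlliquidMarket Ω} {P : Measure Ω} {k b γ K₁ : ℝ}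

variable (M) in
/-- The discounted utility of a consumption rate. -/
noncomputable def discountedUtility (f : ℝ → ℝ) (s : ℝ) : ℝ≥0∞ :=
  ENNReal.ofReal (Real.exp (-M.rho * s)) * ENNReal.ofReal (M.U (f s))

variable (M) in
/-- The reward over a period of length `t` that ends with the return `z`, with the terminal reward
`w` of the wealth at the end. -/
noncomputable def stepReward (w : ℝ → ℝ≥0∞) (x a : ℝ) (f : ℝ → ℝ) (t z : ℝ) : ℝ≥0∞ :=
  (∫⁻ s in Ioc 0 t, M.discountedUtility f s) +
    ENNReal.ofReal (Real.exp (-M.rho * t)) * w (x - (cumul f t).toReal + a * z)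

theorem measurable_discountedUtility (hU : InadaUtility M.U) {α : Type*} [MeasurableSpace α]
    {f : α → ℝ → ℝ} (hf : Measurable (Function.uncurry f)) (h0 : ∀ y s, 0 ≤ f y s) :
    Measurable fun q : α × ℝ => M.discountedUtility (f q.1) q.2 := by
  have := hU.measurable_comp hf fun q => h0 q.1 q.2
  exact (by fun_prop : Measurable _).mul this.ennreal_ofReal

theorem measurable_stepReward (hU : InadaUtility M.U) {w : ℝ → ℝ≥0∞} (hw : Monotone w)
    {α : Type*} [MeasurableSpace α] {X a : α → ℝ} (hX : Measurable X) (ha : Measurable a)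
    {f : α → ℝ → ℝ} (hf : Measurable (Function.uncurry f)) (h0 : ∀ y s, 0 ≤ f y s) :
    Measurable fun q : α × ℝ × ℝ => M.stepReward w (X q.1) (a q.1) (f q.1) q.2.1 q.2.2 := by
  have h1 := measurable_lintegral_Ioc (measurable_discountedUtility hU hf h0)
  have h2 := measurable_lintegral_Ioc hf.ennreal_ofReal
  have hp : Measurable fun q : α × ℝ × ℝ => (q.1, q.2.1) := by fun_prop
  refine (h1.comp hp).add ((by fun_prop : Measurable _).mul (hw.measurable.comp ?_))
  exact ((hX.comp measurable_fst).sub (h2.comp hp).ennreal_toReal).add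
    ((ha.comp measurable_fst).mul measurable_snd.snd)

/-- Tonelli: the waiting time exceeds `s` with probability `exp (-r s)`, which adds `r` to the
discount rate. -/
theorem lintegral_expMeasure_lintegral_Ioc {r : ℝ} (hr : 0 < r) {g : ℝ → ℝ≥0∞}
    (hg : Measurable g) :
    ∫⁻ t, (∫⁻ s in Ioc 0 t, g s) ∂(expMeasure r) =
      ∫⁻ s in Ioi (0 : ℝ), ENNReal.ofReal (Real.exp (-r * s)) * g s := by
  have := isProbabilityMeasure_expMeasure hr
  have h1 : ∀ t, ∫⁻ s in Ioc 0 t, g s = ∫⁻ s in Ioi (0 : ℝ), (Ici s).indicator 1 t * g s := by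
    intro t
    rw [← lintegral_indicator measurableSet_Ioc, ← lintegral_indicator measurableSet_Ioi]
    refine lintegral_congr fun s => ?_
    by_cases h0 : 0 < s <;> by_cases hst : s ≤ t <;> simp [indicator, h0, hst]
  simp only [h1]
  rw [lintegral_lintegral_swap]
  · refine setLIntegral_congr_fun measurableSet_Ioi fun s hs => ?_
    rw [lintegral_mul_const _ (measurable_one.indicator measurableSet_Ici),
      lintegral_indicator_one measurableSet_Ici, expMeasure_Ici hr hs]
  · refine Measurable.aemeasurable (Measurable.mul ?_ (hg.comp measurable_snd))
    have hset : MeasurableSet {q : ℝ × ℝ | q.2 ≤ q.1} :=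
      measurableSet_le measurable_snd measurable_fst
    exact (measurable_const (a := (1 : ℝ≥0∞))).indicator hset

/-- The expected reward over one period is the objective of the dynamic programming operator. -/
theorem lintegral_stepReward (hM : M.ReturnAssumptions P k b) (hU : InadaUtility M.U)
    {w : ℝ → ℝ≥0∞} (hw : Monotone w) {x a : ℝ} {f : ℝ → ℝ} (hf : Measurable f)
    (h0 : ∀ s, 0 ≤ f s) :
    ∫⁻ t, ∫⁻ z, M.stepReward w x a f t z ∂(M.p 0) ∂(expMeasure M.lam) = M.objective w x a f := by
  have := hM.isProb_zero
  have hlam := hM.lam_pos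
  have hg : Measurable (M.discountedUtility f) :=
    (by fun_prop : Measurable _).mul (hU.measurable_comp hf h0).ennreal_ofReal
  have h1 : ∀ t, ∫⁻ z, M.stepReward w x a f t z ∂(M.p 0) =
      (∫⁻ s in Ioc 0 t, M.discountedUtility f s) + ENNReal.ofReal (Real.exp (-M.rho * t)) *
        M.expectedNext w (x - (cumul f t).toReal) a := by
    intro t
    simp only [stepReward]
    rw [lintegral_add_left measurable_const, lintegral_const, measure_univ, mul_one,
      lintegral_const_mul' _ _ ENNReal.ofReal_ne_top, expectedNext]
  have hE : Measurable fun t => ENNReal.ofReal (Real.exp (-M.rho * t)) *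
      M.expectedNext w (x - (cumul f t).toReal) a := by
    refine (by fun_prop : Measurable _).mul (Measurable.comp (g := fun y => M.expectedNext w y a)
      (Monotone.measurable fun y y' h => expectedNext_mono hw (fun _ => le_rfl) h a) ?_)
    exact measurable_const.sub (monotone_setLIntegral_Ioc _).measurable.ennreal_toReal
  simp only [h1]
  rw [lintegral_add_left (monotone_setLIntegral_Ioc _).measurable,
    lintegral_expMeasure_lintegral_Ioc hlam hg, lintegral_expMeasure hE,
    ← lintegral_add_left (by fun_prop), objective]
  refine setLIntegral_congr_fun measurableSet_Ioi fun s hs => ?_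
  have hs : 0 < s := hs
  rw [discountedUtility, integral_eq_cumul hf h0 hs.le, mul_add, ← mul_assoc, ← mul_assoc,
    ← ENNReal.ofReal_mul (Real.exp_pos _).le, ← Real.exp_add, ← mul_assoc,
    ← ENNReal.ofReal_mul (by positivity), ← ENNReal.ofReal_mul (by positivity), mul_assoc M.lam,
    ← Real.exp_add]
  have e : -M.lam * s + -M.rho * s = -(M.rho + M.lam) * s := by ring
  rw [e, mul_comm M.lam, ENNReal.ofReal_mul (Real.exp_pos _).le,
    ENNReal.ofReal_mul (Real.exp_pos _).le]

theorem measurable_nextWealth {j : ℕ} {X a : Ω → ℝ} {f : Ω → ℝ → ℝ}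
    (hX : Measurable[M.discreteObs j] X) (ha : Measurable[M.discreteObs j] a)
    (hf : Measurable[(M.discreteObs j).prod inferInstance] (Function.uncurry f)) :
    Measurable[M.discreteObs (j + 1)] fun ω =>
      X ω - (cumul (f ω) (M.waiting j ω)).toReal + a ω * M.Z (j + 1) ω := by
  have hle := discreteObs_mono (M := M) j.le_succ
  have h3 : Measurable[(M.discreteObs j).prod inferInstance] fun q : Ω × ℝ => cumul (f q.1) q.2 :=
    @measurable_lintegral_Ioc Ω (M.discreteObs j) _ hf.ennreal_ofReal
  have h4 : Measurable[M.discreteObs j.succ, (M.discreteObs j).prod inferInstance]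
      fun ω => (ω, M.waiting j ω) := by
    refine @Measurable.prodMk Ω (M.discreteObs j.succ) Ω ℝ (M.discreteObs j) _ _ _ ?_ ?_
    · exact measurable_id'' hle
    · exact measurable_discreteObs_waiting j.lt_succ_self
  exact ((hX.mono hle le_rfl).sub (h3.comp h4).ennreal_toReal).add
    ((ha.mono hle le_rfl).mul (measurable_discreteObs_Z (Nat.le_add_left 1 j) le_rfl))

variable (M) in
/-- A policy described period by period: `invest j` is the amount invested over the period
`(τ j, τ (j+1)]`, and `rate j` is the consumption rate as a function of the time elapsed since
`τ j`, both depending on the observations up to `τ j`. -/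
structure FeedbackPolicy where
  invest : ℕ → Ω → ℝ
  rate : ℕ → Ω → ℝ → ℝ
  measurable_invest : ∀ j, Measurable[M.discreteObs j] (invest j)
  measurable_rate : ∀ j, Measurable[(M.discreteObs j).prod inferInstance]
    (Function.uncurry (rate j))
  rate_nonneg : ∀ j ω s, 0 ≤ rate j ω s

namespace FeedbackPolicy

variable (π : M.FeedbackPolicy)

/-- The wealth at the observation times. -/
noncomputable def wealth (x : ℝ) : ℕ → Ω → ℝ
  | 0 => fun _ => x
  | j + 1 => fun ω => wealth x j ω - (cumul (π.rate j ω) (M.waiting j ω)).toReal +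
      π.invest j ω * M.Z (j + 1) ω

theorem measurable_rate_apply (j : ℕ) (ω : Ω) : Measurable (π.rate j ω) :=
  (π.measurable_rate j).comp (@measurable_prodMk_left Ω ℝ (M.discreteObs j) _ ω)

theorem measurable_wealth (x : ℝ) (j : ℕ) : Measurable[M.discreteObs j] (π.wealth x j) := by
  induction j with
  | zero => exact measurable_const
  | succ j ih => exact measurable_nextWealth ih (π.measurable_invest j) (π.measurable_rate j)

/-- The expected discounted utility of the consumption over the period `(τ j, τ (j+1)]`. -/
noncomputable def periodUtility (P : Measure Ω) (j : ℕ) : ℝ≥0∞ :=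
  ∫⁻ ω, ENNReal.ofReal (Real.exp (-M.rho * M.τ j ω)) *
    (∫⁻ s in Ioc 0 (M.waiting j ω), M.discountedUtility (π.rate j ω) s) ∂P

/-- The expected discounted reward `w` of the wealth at `τ j`. -/
noncomputable def terminalReward (P : Measure Ω) (w : ℝ → ℝ≥0∞) (x : ℝ) (j : ℕ) : ℝ≥0∞ :=
  ∫⁻ ω, ENNReal.ofReal (Real.exp (-M.rho * M.τ j ω)) * w (π.wealth x j ω) ∂P

theorem measurable_discount (j : ℕ) : Measurable[M.discreteObs j]
    fun ω => ENNReal.ofReal (Real.exp (-M.rho * M.τ j ω)) :=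
  ((measurable_discreteObs_τ le_rfl).const_mul _).exp.ennreal_ofReal

theorem measurable_stepReward_rate (hU : InadaUtility M.U) {w : ℝ → ℝ≥0∞} (hw : Monotone w)
    (x : ℝ) (j : ℕ) : Measurable[(M.discreteObs j).prod inferInstance] fun q : Ω × ℝ × ℝ =>
      M.stepReward w (π.wealth x j q.1) (π.invest j q.1) (π.rate j q.1) q.2.1 q.2.2 :=
  @measurable_stepReward Ω mΩ M hU w hw Ω (M.discreteObs j) _ _ (π.measurable_wealth x j)
    (π.measurable_invest j) _ (π.measurable_rate j) (π.rate_nonneg j)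

variable [IsProbabilityMeasure P]

/-- Given the observations up to `τ j`, portfolio and rate are fixed and the next pair of waiting
time and return is fresh; averaging over it produces the objective. Both bounds for the value
function are iterations of this identity. -/
theorem periodUtility_add_terminalReward (hM : M.ReturnAssumptions P k b)
    (hstat : ∀ t, 0 ≤ t → M.p t = M.p 0) (hU : InadaUtility M.U) {w : ℝ → ℝ≥0∞}
    (hw : Monotone w) (x : ℝ) (j : ℕ) :
    π.periodUtility P j + π.terminalReward P w x (j + 1) =
      ∫⁻ ω, ENNReal.ofReal (Real.exp (-M.rho * M.τ j ω)) *
        M.objective w (π.wealth x j ω) (π.invest j ω) (π.rate j ω) ∂P := by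
  have hstep := π.measurable_stepReward_rate hU hw x j
  have hF : Measurable[(M.discreteObs j).prod inferInstance] fun q : Ω × ℝ × ℝ =>
      ENNReal.ofReal (Real.exp (-M.rho * M.τ j q.1)) *
        M.stepReward w (π.wealth x j q.1) (π.invest j q.1) (π.rate j q.1) q.2.1 q.2.2 :=
    ((measurable_discount j).comp measurable_fst).mul hstep
  have h1 := lintegral_next hM hstat j hF
  simp only at h1
  have h2 : ∀ ω, ∫⁻ t, ∫⁻ z, ENNReal.ofReal (Real.exp (-M.rho * M.τ j ω)) *
      M.stepReward w (π.wealth x j ω) (π.invest j ω) (π.rate j ω) t z ∂(M.p 0)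
        ∂(expMeasure M.lam) = ENNReal.ofReal (Real.exp (-M.rho * M.τ j ω)) *
        M.objective w (π.wealth x j ω) (π.invest j ω) (π.rate j ω) := by
    intro ω
    simp_rw [lintegral_const_mul' _ _ (ENNReal.ofReal_ne_top (r := Real.exp (-M.rho * M.τ j ω)))]
    rw [lintegral_stepReward hM hU hw (π.measurable_rate_apply j ω) (π.rate_nonneg j ω)]
  simp only [h2] at h1
  rw [← h1, periodUtility, terminalReward, ← lintegral_add_right]
  · refine lintegral_congr fun ω => ?_
    rw [stepReward, mul_add, ← mul_assoc, ← ENNReal.ofReal_mul (Real.exp_pos _).le, ← Real.exp_add]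
    have e : -M.rho * M.τ j ω + -M.rho * M.waiting j ω = -M.rho * M.τ (j + 1) ω := by
      rw [waiting]
      ring
    rw [e]
    rfl
  · refine ((measurable_discount (j + 1)).mono (discreteObs_le _) le_rfl).mul ?_
    exact hw.measurable.comp ((π.measurable_wealth x (j + 1)).mono (discreteObs_le _) le_rfl)

end FeedbackPolicy

end IlliquidMarket

theorem ae_of_lintegral_triple_eq_zero {α : Type*} [MeasurableSpace α] {m : Measure α}
    {ν₁ ν₂ : Measure ℝ} [SFinite ν₁] [SFinite ν₂] {F : α × ℝ × ℝ → ℝ≥0∞} (hF : Measurable F)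
    (h : ∫⁻ y, ∫⁻ t, ∫⁻ z, F (y, t, z) ∂ν₂ ∂ν₁ ∂m = 0) :
    ∀ᵐ y ∂m, ∀ᵐ t ∂ν₁, ∀ᵐ z ∂ν₂, F (y, t, z) = 0 := by
  have h1 : Measurable fun q : α × ℝ => ∫⁻ z, F (q.1, q.2, z) ∂ν₂ := by
    have : Measurable fun q : (α × ℝ) × ℝ => F (q.1.1, q.1.2, q.2) := hF.comp (by fun_prop)
    exact this.lintegral_prod_right'
  rw [lintegral_eq_zero_iff h1.lintegral_prod_right'] at h
  filter_upwards [h] with y hy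
  have hy : ∫⁻ t, ∫⁻ z, F (y, t, z) ∂ν₂ ∂ν₁ = 0 := hy
  have h1y : Measurable fun t => ∫⁻ z, F (y, t, z) ∂ν₂ := h1.comp measurable_prodMk_left
  rw [lintegral_eq_zero_iff h1y] at hy
  filter_upwards [hy] with t ht
  have ht : ∫⁻ z, F (y, t, z) ∂ν₂ = 0 := ht
  have h2 : Measurable fun z => F (y, t, z) := hF.comp (by fun_prop)
  rw [lintegral_eq_zero_iff h2] at ht
  exact ht

/-! ### From admissible pairs to policies: the upper bound -/

namespace IlliquidMarket

variable {Ω : Type*} [mΩ : MeasurableSpace Ω] {M : IlliquidMarket Ω} {P : Measure Ω} {k b γ K₁ : ℝ}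

theorem τ_nonneg (n : ℕ) (ω : Ω) : 0 ≤ M.τ n ω := by
  rw [← M.τ_zero ω]
  exact (M.τ_strictMono ω).monotone n.zero_le

/-- Before the next observation, the observed events are determined by the past observations. -/
theorem exists_discreteObs_of_continuousObs {s : ℝ≥0} {A : Set Ω}
    (hA : MeasurableSet[M.continuousObs s] A) (n : ℕ) :
    ∃ A', MeasurableSet[M.discreteObs n] A' ∧ ∀ ω, (s : ℝ) < M.τ (n + 1) ω → (ω ∈ A ↔ ω ∈ A') := by
  refine MeasurableSpace.generateFrom_induction _
    (fun A _ => ∃ A', MeasurableSet[M.discreteObs n] A' ∧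
      ∀ ω, (s : ℝ) < M.τ (n + 1) ω → (ω ∈ A ↔ ω ∈ A')) ?_ ?_ ?_ ?_ A hA
  · rintro _ ⟨i, hi, r, hr, B, hB, rfl⟩ -
    rcases le_or_gt i n with hin | hin
    · refine ⟨_, ?_, fun ω _ => Iff.rfl⟩
      exact @MeasurableSet.inter Ω (M.discreteObs n) _ _ (measurable_discreteObs_τ hin measurableSet_Iic)
        (measurable_discreteObs_Z hi hin hB)
    · refine ⟨∅, @MeasurableSet.empty Ω (M.discreteObs n), fun ω hω => ?_⟩
      have : M.τ (n + 1) ω ≤ M.τ i ω := (M.τ_strictMono ω).monotone hin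
      -- Observations after the `n`-th are not visible before `τ (n + 1)`, so such an event is empty
      -- there.
      simp only [mem_ofPred_eq, mem_empty_iff_false, iff_false, not_and]
      intro h
      linarith
  · exact ⟨∅, @MeasurableSet.empty Ω (M.discreteObs n), fun _ _ => Iff.rfl⟩
  · rintro A _ ⟨A', hA', h⟩
    exact ⟨A'ᶜ, hA'.compl, fun ω hω => not_congr (h ω hω)⟩
  · intro A _ h
    choose A' hA' h using h
    refine ⟨⋃ i, A' i, MeasurableSet.iUnion hA', fun ω hω => ?_⟩
    simp only [mem_iUnion]
    exact exists_congr fun i => h i ω hω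

/-- Over each period, a predictable process is a function of time and of the past observations. -/
theorem exists_rate_of_predictable {c : ℝ≥0 → Ω → ℝ}
    (hc : IsStronglyPredictable M.continuousObs c) (n : ℕ) :
    ∃ g : Ω × ℝ → ℝ, Measurable[(M.discreteObs n).prod inferInstance] g ∧
      ∀ ω t, M.τ n ω < t → t ≤ M.τ (n + 1) ω → c t.toNNReal ω = g (ω, t) := by
  -- On the stochastic interval `(τ n, τ (n + 1)]` the predictable σ-algebra reduces to the past
  -- observations and time, as is checked on generators; a factorisation through `ι` then gives `g`.
  let D := {q : ℝ≥0 × Ω // M.τ n q.2 < q.1 ∧ (q.1 : ℝ) ≤ M.τ (n + 1) q.2}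
  let ι : D → Ω × ℝ := fun d => (d.1.2, (d.1.1 : ℝ))
  let mo : MeasurableSpace (Ω × ℝ) := (M.discreteObs n).prod inferInstance
  have hι : Measurable[mo.comap ι, mo] ι := comap_measurable ι
  have hval : Measurable[mo.comap ι, M.continuousObs.predictable]
      (Subtype.val : D → ℝ≥0 × Ω) := by
    refine @measurable_generateFrom D (ℝ≥0 × Ω) (mo.comap ι) _ _ ?_
    rintro _ (⟨A, hA, rfl⟩ | ⟨s, A, hA, rfl⟩)
    -- Generators at time `0` do not meet the interval, which is open on the left.
    · have : (Subtype.val : D → ℝ≥0 × Ω) ⁻¹' ({⊥} ×ˢ A) = ∅ := by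
        ext d
        simp only [mem_preimage, mem_prod, mem_singleton_iff, mem_empty_iff_false, iff_false,
          not_and]
        intro h
        have h1 := d.2.1
        rw [h] at h1
        exact absurd (M.τ_nonneg n d.1.2) (not_le.2 (by simpa using h1))
      rw [this]
      exact @MeasurableSet.empty D (mo.comap ι)
    · obtain ⟨A', hA', h⟩ := exists_discreteObs_of_continuousObs hA n
      refine ⟨A' ×ˢ Ioi (s : ℝ), ?_, ?_⟩
      · exact @MeasurableSet.prod Ω ℝ (M.discreteObs n) _ A' _ hA' measurableSet_Ioi
      · ext d
        simp only [mem_preimage, mem_prod, mem_Ioi, ι, NNReal.coe_lt_coe]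
        constructor
        · rintro ⟨h1, h2⟩
          exact ⟨h2, (h _ (lt_of_lt_of_le (by exact_mod_cast h2) d.2.2)).2 h1⟩
        · rintro ⟨h2, h1⟩
          exact ⟨(h _ (lt_of_lt_of_le (by exact_mod_cast h2) d.2.2)).1 h1, h2⟩
  have hcomp : Measurable[mo.comap ι] (Function.uncurry c ∘ (Subtype.val : D → ℝ≥0 × Ω)) :=
    hc.measurable.comp hval
  obtain ⟨g, hg, hgc⟩ := hcomp.exists_eq_measurable_comp
  refine ⟨g, hg, fun ω t h1 h2 => ?_⟩
  have ht : 0 ≤ t := (M.τ_nonneg n ω).trans h1.le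
  have h3 := congrFun hgc ⟨(t.toNNReal, ω), by rwa [Real.coe_toNNReal t ht],
    by rwa [Real.coe_toNNReal t ht]⟩
  simpa [ι, Real.coe_toNNReal t ht] using h3

namespace FeedbackPolicy

variable (π : M.FeedbackPolicy)

/-- The consumption process `c` is the one prescribed by the policy. -/
def Implements (c : ℝ≥0 → Ω → ℝ) : Prop :=
  ∀ j ω s, 0 < s → s ≤ M.waiting j ω → c (s + M.τ j ω).toNNReal ω = π.rate j ω s

theorem exists_implements {α : ℕ → Ω → ℝ} {c : ℝ≥0 → Ω → ℝ}
    (hα : ∀ j, Measurable[M.discreteObs j] (α (j + 1)))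
    (hc : IsStronglyPredictable M.continuousObs c) (h0 : ∀ t ω, 0 ≤ c t ω) :
    ∃ π : M.FeedbackPolicy, π.Implements c ∧ ∀ j, π.invest j = α (j + 1) := by
  choose g hg hgc using exists_rate_of_predictable hc
  -- The factorisation is determined only within the period; the positive part makes the rate
  -- nonnegative everywhere without changing it there.
  refine ⟨⟨fun j => α (j + 1), fun j ω s => max (g j (ω, s + M.τ j ω)) 0, hα, fun j => ?_,
    fun _ _ _ => le_max_right _ _⟩, fun j ω s hs hsw => ?_, fun _ => rfl⟩
  · refine Measurable.max ?_ measurable_const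
    refine (hg j).comp (@Measurable.prodMk (Ω × ℝ) ((M.discreteObs j).prod inferInstance) Ω ℝ
      (M.discreteObs j) _ _ _ measurable_fst ?_)
    exact measurable_snd.add ((measurable_discreteObs_τ le_rfl).comp measurable_fst)
  · have h1 := hgc j ω (s + M.τ j ω) (by linarith) (by rw [waiting] at hsw; linarith)
    simp only
    rw [← h1, max_eq_left (h0 _ _)]

variable {π}

theorem Implements.integral_eq {c : ℝ≥0 → Ω → ℝ} (h : π.Implements c) (j : ℕ) (ω : Ω) :
    ∫ t in M.τ j ω..M.τ (j + 1) ω, c t.toNNReal ω =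
      (cumul (π.rate j ω) (M.waiting j ω)).toReal := by
  have hw := (waiting_pos (M := M) j ω).le
  have h1 := intervalIntegral.integral_comp_add_right (a := 0) (b := M.waiting j ω)
    (fun t : ℝ => c t.toNNReal ω) (M.τ j ω)
  rw [zero_add, waiting, sub_add_cancel, ← waiting] at h1
  rw [← h1, ← integral_eq_cumul (π.measurable_rate_apply j ω) (π.rate_nonneg j ω) hw]
  refine intervalIntegral.integral_congr_ae (ae_of_all _ fun s hs => ?_)
  rw [uIoc_of_le hw] at hs
  exact h j ω s hs.1 hs.2

theorem Implements.intervalIntegrable_iff {c : ℝ≥0 → Ω → ℝ} (h : π.Implements c) (j : ℕ) (ω : Ω) :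
    IntervalIntegrable (fun t : ℝ => c t.toNNReal ω) volume (M.τ j ω) (M.τ (j + 1) ω) ↔
      cumul (π.rate j ω) (M.waiting j ω) ≠ ⊤ := by
  have hw := (waiting_pos (M := M) j ω).le
  have heq : EqOn (fun s => c (s + M.τ j ω).toNNReal ω) (π.rate j ω) (uIoc 0 (M.waiting j ω)) := by
    intro s hs
    rw [uIoc_of_le hw] at hs
    exact h j ω s hs.1 hs.2
  constructor
  · intro hi
    have h1 := hi.comp_add_right (M.τ j ω)
    rw [sub_self, ← waiting] at h1
    exact cumul_ne_top hw (h1.congr heq)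
  · intro hne
    have h1 := (intervalIntegrable_of_cumul_ne_top (π.measurable_rate_apply j ω)
      (π.rate_nonneg j ω) hw hne).congr heq.symm
    have h2 := h1.comp_sub_right (M.τ j ω)
    simpa [waiting] using h2

theorem Implements.wealth_eq {α : ℕ → Ω → ℝ} {c : ℝ≥0 → Ω → ℝ} (h : π.Implements c)
    (hα : ∀ j, π.invest j = α (j + 1)) (x : ℝ) {ω : Ω}
    (hi : ∀ j, cumul (π.rate j ω) (M.waiting j ω) ≠ ⊤) (j : ℕ) :
    IntervalIntegrable (fun t : ℝ => c t.toNNReal ω) volume 0 (M.τ j ω) ∧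
      M.wealth x α c j ω = π.wealth x j ω := by
  induction j with
  | zero => simp [IlliquidMarket.wealth, FeedbackPolicy.wealth, M.τ_zero]
  | succ j ih =>
    have h1 := (h.intervalIntegrable_iff j ω).2 (hi j)
    refine ⟨ih.1.trans h1, ?_⟩
    simp only [FeedbackPolicy.wealth]
    rw [← ih.2, IlliquidMarket.wealth, IlliquidMarket.wealth,
      ← intervalIntegral.integral_add_adjacent_intervals ih.1 h1, h.integral_eq,
      Finset.sum_Icc_succ_top (Nat.le_add_left 1 j), hα]
    ring

theorem Implements.lintegral_Ioc {c : ℝ≥0 → Ω → ℝ} (h : π.Implements c)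
    (ω : Ω) (n : ℕ) :
    ∫⁻ t in Ioc 0 (M.τ n ω), ENNReal.ofReal (Real.exp (-M.rho * t) * M.U (c t.toNNReal ω)) =
      ∑ j ∈ Finset.range n, ENNReal.ofReal (Real.exp (-M.rho * M.τ j ω)) *
        ∫⁻ s in Ioc 0 (M.waiting j ω), M.discountedUtility (π.rate j ω) s := by
  induction n with
  | zero => simp [M.τ_zero]
  | succ n ih =>
    have hle : M.τ n ω ≤ M.τ (n + 1) ω := (M.τ_strictMono ω).monotone n.le_succ
    rw [Finset.sum_range_succ, ← ih, ← Ioc_union_Ioc_eq_Ioc (M.τ_nonneg n ω) hle,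
      lintegral_union measurableSet_Ioc (Ioc_disjoint_Ioc_of_le le_rfl)]
    congr 1
    have hp : (fun s : ℝ => s + M.τ n ω) ⁻¹' Ioc (M.τ n ω) (M.τ (n + 1) ω) =
        Ioc 0 (M.waiting n ω) := by
      ext s
      simp [waiting, le_sub_iff_add_le]
    rw [← (measurePreserving_add_right volume (M.τ n ω)).setLIntegral_comp_preimage_emb
      (measurableEmbedding_addRight _) _ (Ioc (M.τ n ω) _), hp,
      ← lintegral_const_mul' _ _ ENNReal.ofReal_ne_top]
    refine setLIntegral_congr_fun measurableSet_Ioc fun s hs => ?_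
    rw [h n ω s hs.1 hs.2, discountedUtility, ← mul_assoc,
      ← ENNReal.ofReal_mul (Real.exp_pos _).le, ← Real.exp_add,
      ← ENNReal.ofReal_mul (Real.exp_pos _).le]
    congr 3
    ring

variable (π)

theorem measurable_periodUtility (hU : InadaUtility M.U) (j : ℕ) :
    Measurable fun ω => ENNReal.ofReal (Real.exp (-M.rho * M.τ j ω)) *
      ∫⁻ s in Ioc 0 (M.waiting j ω), M.discountedUtility (π.rate j ω) s := by
  have hf : Measurable (Function.uncurry (π.rate j)) :=
    (π.measurable_rate j).mono (sup_le_sup (MeasurableSpace.comap_mono (discreteObs_le j)) le_rfl)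
      le_rfl
  have h1 := measurable_lintegral_Ioc (measurable_discountedUtility hU hf (π.rate_nonneg j))
  exact ((measurable_discount j).mono (discreteObs_le j) le_rfl).mul
    (h1.comp (measurable_id.prodMk (measurable_waiting j)))

variable [IsProbabilityMeasure P] {π}

/-- The expected discounted utility of an implemented policy. -/
theorem Implements.lintegral_eq {c : ℝ≥0 → Ω → ℝ} (h : π.Implements c)
    (hM : M.ReturnAssumptions P k b) (hstat : ∀ t, 0 ≤ t → M.p t = M.p 0)
    (hU : InadaUtility M.U) :
    ∫⁻ ω, (∫⁻ t in Set.Ici (0 : ℝ),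
      ENNReal.ofReal (Real.exp (-M.rho * t) * M.U (c t.toNNReal ω))) ∂P =
      ⨆ n, ∑ j ∈ Finset.range n, π.periodUtility P j := by
  have h1 : ∀ᵐ ω ∂P, ∫⁻ t in Set.Ici (0 : ℝ),
      ENNReal.ofReal (Real.exp (-M.rho * t) * M.U (c t.toNNReal ω)) =
      ⨆ n, ∑ j ∈ Finset.range n, ENNReal.ofReal (Real.exp (-M.rho * M.τ j ω)) *
        ∫⁻ s in Ioc 0 (M.waiting j ω), M.discountedUtility (π.rate j ω) s := by
    filter_upwards [ae_exists_lt_τ hM hstat] with ω hω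
    have hU' : Ioi (0 : ℝ) = ⋃ n, Ioc 0 (M.τ n ω) := by
      ext t
      simp only [mem_Ioi, mem_iUnion, mem_Ioc, exists_and_left, iff_self_and]
      exact fun _ => (hω t).imp fun n hn => hn.le
    rw [setLIntegral_congr Ioi_ae_eq_Ici.symm, hU', setLIntegral_iUnion_of_directed]
    · exact iSup_congr fun n => h.lintegral_Ioc ω n
    · exact Monotone.directed_le fun m n hmn =>
        Ioc_subset_Ioc_right ((M.τ_strictMono ω).monotone hmn)
  rw [lintegral_congr_ae h1, lintegral_iSup]
  · refine iSup_congr fun n => ?_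
    rw [lintegral_finsetSum _ fun j _ => π.measurable_periodUtility hU j]
    rfl
  · exact fun n => Finset.measurable_sum _ fun j _ => π.measurable_periodUtility hU j
  · exact fun m n hmn ω => Finset.sum_le_sum_of_subset (Finset.range_mono hmn)

/-- If the wealth at the next observation is almost surely nonnegative, then the policy is
admissible over the period. -/
theorem ae_isConsumption (hM : M.ReturnAssumptions P k b)
    (hstat : ∀ t, 0 ≤ t → M.p t = M.p 0) (x : ℝ) (j : ℕ)
    (h : ∀ᵐ ω ∂P, cumul (π.rate j ω) (M.waiting j ω) ≠ ⊤ ∧ 0 ≤ π.wealth x (j + 1) ω) :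
    ∀ᵐ ω ∂P, π.invest j ω ∈ M.portfolios ∧
      M.IsConsumption 0 (π.wealth x j ω) (π.invest j ω) (π.rate j ω) := by
  have hp := hM.isProb_zero
  have he := isProbabilityMeasure_expMeasure hM.lam_pos
  let mo : MeasurableSpace (Ω × ℝ × ℝ) := (M.discreteObs j).prod inferInstance
  have hcum : Measurable[mo] fun q : Ω × ℝ × ℝ => cumul (π.rate j q.1) q.2.1 := by
    have h3 : Measurable[(M.discreteObs j).prod inferInstance]
        fun q : Ω × ℝ => cumul (π.rate j q.1) q.2 :=
      @measurable_lintegral_Ioc Ω (M.discreteObs j) _ (π.measurable_rate j).ennreal_ofReal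
    exact h3.comp (@Measurable.prodMk (Ω × ℝ × ℝ) mo Ω ℝ (M.discreteObs j) _ _ _ measurable_fst
      measurable_snd.fst)
  have hwe : Measurable[mo] fun q : Ω × ℝ × ℝ =>
      π.wealth x j q.1 - (cumul (π.rate j q.1) q.2.1).toReal + π.invest j q.1 * q.2.2 :=
    (((π.measurable_wealth x j).comp measurable_fst).sub hcum.ennreal_toReal).add
      (((π.measurable_invest j).comp measurable_fst).mul measurable_snd.snd)
  -- The constraint fails on `B`. Its probability is a triple integral over past, waiting time and
  -- return, so for almost every past it holds for almost all times and returns.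
  let B : Set (Ω × ℝ × ℝ) := {q | cumul (π.rate j q.1) q.2.1 = ⊤} ∪
    {q | π.wealth x j q.1 - (cumul (π.rate j q.1) q.2.1).toReal + π.invest j q.1 * q.2.2 < 0}
  have hB : MeasurableSet[mo] B :=
    (hcum (measurableSet_singleton ⊤)).union (hwe measurableSet_Iio)
  have hF : Measurable[mo] (B.indicator fun _ => (1 : ℝ≥0∞)) := measurable_const.indicator hB
  have h1 := lintegral_next hM hstat j hF
  have h2 : ∫⁻ ω, B.indicator (fun _ => (1 : ℝ≥0∞)) (ω, M.waiting j ω, M.Z (j + 1) ω) ∂P = 0 := by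
    rw [lintegral_congr_ae (g := fun _ => 0), lintegral_zero]
    filter_upwards [h] with ω hω
    refine indicator_of_notMem ?_ _
    rintro (h3 | h3)
    · exact hω.1 h3
    · exact absurd hω.2 (not_le.2 h3)
  rw [h2] at h1
  have hle : mo ≤ mΩ.prod inferInstance :=
    sup_le_sup (MeasurableSpace.comap_mono (discreteObs_le j)) le_rfl
  filter_upwards [ae_of_lintegral_triple_eq_zero (hF.mono hle le_rfl) h1.symm] with ω hω
  have h3 : ∀ᵐ t ∂(expMeasure M.lam), 0 < t ∧ cumul (π.rate j ω) t ≠ ⊤ ∧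
      π.invest j ω ∈ M.portfolios ∧
      M.l (π.invest j ω) ≤ π.wealth x j ω - (cumul (π.rate j ω) t).toReal := by
    filter_upwards [hω, ae_pos_expMeasure] with t ht ht0
    have h4 : ∀ᵐ z ∂(M.p 0), cumul (π.rate j ω) t ≠ ⊤ ∧
        0 ≤ π.wealth x j ω - (cumul (π.rate j ω) t).toReal + π.invest j ω * z := by
      filter_upwards [ht] with z hz
      have h5 : (ω, t, z) ∉ B := by
        intro hmem
        rw [indicator_of_mem hmem] at hz
        exact one_ne_zero hz
      simp only [B, mem_union, mem_ofPred_eq, not_or, not_lt] at h5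
      exact h5
    exact ⟨ht0, h4.exists.choose_spec.1, hM.ae_nonneg_iff.1 (h4.mono fun z hz => hz.2)⟩
  have hr0 := π.rate_nonneg j ω
  have hrm := π.measurable_rate_apply j ω
  -- Cumulative consumption increases, so the budget at an arbitrarily late good time `t` implies it
  -- at `s`.
  have h5 : ∀ s, 0 ≤ s → cumul (π.rate j ω) s ≠ ⊤ ∧
      (cumul (π.rate j ω) s).toReal ≤ π.wealth x j ω - M.l (π.invest j ω) := by
    intro s hs
    obtain ⟨t, hst, ht⟩ := frequently_expMeasure hM.lam_pos h3 (by linarith : 0 < s + 1)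
    have hmono := monotone_setLIntegral_Ioc (fun u => ENNReal.ofReal (π.rate j ω u))
      (by linarith : s ≤ t)
    refine ⟨ne_top_of_le_ne_top ht.2.1 hmono, ?_⟩
    have := ENNReal.toReal_mono ht.2.1 hmono
    have h6 := ht.2.2.2
    simp only [cumul] at h6 ⊢
    linarith
  obtain ⟨t, -, ht⟩ := frequently_expMeasure hM.lam_pos h3 one_pos
  refine ⟨ht.2.2.1, hrm, hr0, fun s hs =>
    intervalIntegrable_of_cumul_ne_top hrm hr0 hs (h5 s hs).1, fun s hs => ?_⟩
  rw [integral_eq_cumul hrm hr0 hs]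
  exact (h5 s hs).2

end FeedbackPolicy

variable [IsProbabilityMeasure P]

/-- The value function is at most the limit of the iterates. -/
theorem value_le_limitValue (hM : M.ReturnAssumptions P k b) (hU : M.UtilityAssumptions k b γ K₁)
    (hstat : ∀ t, 0 ≤ t → M.p t = M.p 0) (x : ℝ) : M.value P x ≤ M.limitValue x := by
  have hI := hU.inadaUtility
  refine iSup_le fun α => iSup₂_le fun c hc => ?_
  obtain ⟨π, hπ, hα⟩ := FeedbackPolicy.exists_implements hc.measurable_α hc.predictable_c hc.nonneg_c
  rw [hπ.lintegral_eq hM hstat hI]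
  have hfin : ∀ᵐ ω ∂P, ∀ j, cumul (π.rate j ω) (M.waiting j ω) ≠ ⊤ := by
    filter_upwards [hc.integrable_c] with ω hω j
    refine (hπ.intervalIntegrable_iff j ω).1 ?_
    have h0 : ∀ j, IntervalIntegrable (fun t : ℝ => c t.toNNReal ω) volume 0 (M.τ j ω) := by
      intro j
      rcases Nat.eq_zero_or_pos j with rfl | hj
      · rw [M.τ_zero]
      · exact hω j hj
    exact (h0 j).symm.trans (h0 (j + 1))
  have hcons : ∀ j, ∀ᵐ ω ∂P, π.invest j ω ∈ M.portfolios ∧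
      M.IsConsumption 0 (π.wealth x j ω) (π.invest j ω) (π.rate j ω) := by
    intro j
    refine FeedbackPolicy.ae_isConsumption hM hstat x j ?_
    filter_upwards [hfin, hc.wealth_nonneg] with ω h1 h2
    refine ⟨h1 j, ?_⟩
    rw [← (hπ.wealth_eq hα x h1 (j + 1)).2]
    exact h2 (j + 1) (Nat.le_add_left 1 j)
  refine iSup_le fun n => le_iSup_of_le n ?_
  -- With `m` periods remaining the terminal reward is the `m`-th iterate; each period played trades
  -- one application of the operator for one period of utility.
  have key : ∀ i m, i + m = n → (∑ j ∈ Finset.range i, π.periodUtility P j) +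
      π.terminalReward P (M.iterValue m) x i ≤ M.iterValue n x := by
    intro i
    induction i with
    | zero =>
      intro m hm
      rw [zero_add] at hm
      subst hm
      simp [FeedbackPolicy.terminalReward, FeedbackPolicy.wealth, M.τ_zero]
    | succ i ih =>
      intro m hm
      refine le_trans ?_ (ih (m + 1) (by omega))
      rw [Finset.sum_range_succ, add_assoc, π.periodUtility_add_terminalReward hM hstat hI
        (iterValue_class hM hU m).mono]
      refine add_le_add_right (lintegral_mono_ae ?_) _
      filter_upwards [hcons i] with ω hω
      refine mul_le_mul_right ((objective_le_controlValue hω.2).trans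
        (controlValue_le_bellman ?_)) _
      exact hM.mem_portfolioInterval.2 ⟨hω.1, hω.2.l_le⟩
  exact le_self_add.trans (key n 0 (by omega))

end IlliquidMarket

/-! ### From feedback selections to admissible pairs: the lower bound -/

namespace IlliquidMarket

variable {Ω : Type*} [mΩ : MeasurableSpace Ω] {M : IlliquidMarket Ω} {P : Measure Ω} {k b γ K₁ : ℝ}

theorem exists_isConsumption_bellman_le (hM : M.ReturnAssumptions P k b)
    (hU : M.UtilityAssumptions k b γ K₁) {w : ℝ → ℝ≥0∞} (hw : M.ValueClass k γ K₁ w) {ε : ℝ≥0∞}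
    (hε : ε ≠ 0) {y : ℝ} (hy : 0 ≤ y) :
    ∃ a c, a ∈ M.portfolioInterval y ∧ M.IsConsumption 0 y a c ∧
      M.bellman w y ≤ M.objective w y a c + ε := by
  by_cases h0 : M.bellman w y = 0
  · refine ⟨0, fun _ => 0, hM.mem_portfolioInterval.2
      ⟨ReturnAssumptions.zero_mem_portfolios, by rwa [ReturnAssumptions.l_zero]⟩,
      IsConsumption.zero (by rwa [ReturnAssumptions.l_zero]), by simp [h0]⟩
  have h1 := ENNReal.sub_lt_self ((hw.bellman hM hU).ne_top y) h0 hε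
  obtain ⟨a, h1⟩ := lt_iSup_iff.1 (lt_of_lt_of_eq h1 (by rw [IlliquidMarket.bellman]))
  obtain ⟨ha, h1⟩ := lt_iSup_iff.1 h1
  obtain ⟨c, h1⟩ := lt_iSup_iff.1 h1
  obtain ⟨hc, h1⟩ := lt_iSup_iff.1 h1
  exact ⟨a, c, ha, hc, tsub_le_iff_right.1 h1.le⟩

/-- Nearly optimal portfolios and consumption rates can be chosen measurably in the wealth. -/
theorem exists_measurable_selection (hM : M.ReturnAssumptions P k b)
    (hU : M.UtilityAssumptions k b γ K₁) {w : ℝ → ℝ≥0∞} (hw : M.ValueClass k γ K₁ w) {ε : ℝ≥0∞}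
    (hε : ε ≠ 0) :
    ∃ (A : ℝ → ℝ) (C : ℝ → ℝ → ℝ), Measurable A ∧ Measurable (Function.uncurry C) ∧
      (∀ y s, 0 ≤ C y s) ∧ ∀ y, 0 ≤ y → A y ∈ M.portfolios ∧ M.IsConsumption 0 y (A y) (C y) ∧
        M.bellman w y ≤ M.objective w y (A y) (C y) + ε := by
  have hε2 : ε / 2 ≠ 0 := (ENNReal.half_pos hε).ne'
  have hb := hw.bellman hM hU
  -- Controls are chosen on the grid `δ ℕ` and used at all wealths in the cell above: they stay
  -- feasible there, and by subadditivity the value exceeds that at the grid point by at most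
  -- `bellman w δ`. Countably many choices make the selection measurable.
  obtain ⟨δ, hδ, hbδ⟩ : ∃ δ : ℝ, 0 < δ ∧ M.bellman w δ < ε / 2 := by
    have h1 : ∀ᶠ y in 𝓝[>] (0 : ℝ), M.bellman w y < ε / 2 :=
      ((hb.tendsto_zero hU).mono_left (nhdsWithin_mono _ Ioi_subset_Ici_self)).eventually_lt_const
        hε2.bot_lt
    exact (eventually_mem_nhdsWithin.and h1).exists
  choose a c ha hc hac using fun i : ℕ =>
    exists_isConsumption_bellman_le hM hU hw hε2 (by positivity : 0 ≤ δ * i)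
  have hf : Measurable fun y : ℝ => ⌊y / δ⌋₊ := Nat.measurable_floor.comp (measurable_id.div_const δ)
  refine ⟨fun y => a ⌊y / δ⌋₊, fun y => c ⌊y / δ⌋₊, (measurable_from_top (f := a)).comp hf, ?_,
    fun y s => (hc _).nonneg s, fun y hy => ?_⟩
  · have h1 : Measurable fun q : ℝ × ℕ => c q.2 q.1 :=
      measurable_from_prod_countable_left fun i => (hc i).measurable
    exact h1.comp (measurable_snd.prodMk (hf.comp measurable_fst))
  · set i := ⌊y / δ⌋₊
    have h1 : δ * i ≤ y := by
      have := Nat.floor_le (div_nonneg hy hδ.le)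
      rw [le_div_iff₀ hδ] at this
      linarith
    have h2 : y ≤ δ * i + δ := by
      have := Nat.lt_floor_add_one (y / δ)
      rw [div_lt_iff₀ hδ] at this
      linarith
    refine ⟨(hM.mem_portfolioInterval.1 (ha i)).1, (hc i).mono (by linarith), ?_⟩
    calc M.bellman w y ≤ M.bellman w (δ * i + δ) := hb.mono h2
      _ ≤ M.bellman w (δ * i) + M.bellman w δ := hb.concave.subadditive (by positivity) hδ.le
      _ ≤ (M.objective w (δ * i) (a i) (c i) + ε / 2) + ε / 2 := add_le_add (hac i) hbδ.le
      _ = M.objective w (δ * i) (a i) (c i) + ε := by rw [add_assoc, ENNReal.add_halves]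
      _ ≤ M.objective w y (a i) (c i) + ε :=
        add_le_add_left (objective_mono hw.mono (fun _ => le_rfl) h1 _ _) _

variable (M) in
/-- The wealth at the observation times under feedback functions of the current wealth. -/
noncomputable def closedLoopWealth (A : ℕ → ℝ → ℝ) (C : ℕ → ℝ → ℝ → ℝ) (x : ℝ) : ℕ → Ω → ℝ
  | 0 => fun _ => x
  | j + 1 => fun ω => closedLoopWealth A C x j ω -
      (cumul (C j (closedLoopWealth A C x j ω)) (M.waiting j ω)).toReal +
      A j (closedLoopWealth A C x j ω) * M.Z (j + 1) ω

theorem measurable_uncurry_comp {j : ℕ} {X : Ω → ℝ} (hX : Measurable[M.discreteObs j] X)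
    {C : ℝ → ℝ → ℝ} (hC : Measurable (Function.uncurry C)) :
    Measurable[(M.discreteObs j).prod inferInstance] (Function.uncurry fun ω => C (X ω)) :=
  hC.comp ((hX.comp measurable_fst).prodMk measurable_snd)

/-- Feedback functions of the wealth define a policy. -/
theorem exists_feedbackPolicy {A : ℕ → ℝ → ℝ} {C : ℕ → ℝ → ℝ → ℝ} (hA : ∀ j, Measurable (A j))
    (hC : ∀ j, Measurable (Function.uncurry (C j))) (hC0 : ∀ j y s, 0 ≤ C j y s) (x : ℝ) :
    ∃ π : M.FeedbackPolicy, ∀ j ω, π.invest j ω = A j (π.wealth x j ω) ∧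
      π.rate j ω = C j (π.wealth x j ω) := by
  have hX : ∀ j, Measurable[M.discreteObs j] (M.closedLoopWealth A C x j) := by
    intro j
    induction j with
    | zero => exact measurable_const
    | succ j ih =>
      exact measurable_nextWealth ih ((hA j).comp ih) (measurable_uncurry_comp ih (hC j))
  let π : M.FeedbackPolicy := ⟨fun j ω => A j (M.closedLoopWealth A C x j ω),
    fun j ω => C j (M.closedLoopWealth A C x j ω), fun j => (hA j).comp (hX j),
    fun j => measurable_uncurry_comp (hX j) (hC j), fun j ω => hC0 j _⟩
  have hπ : ∀ j, π.wealth x j = M.closedLoopWealth A C x j := by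
    intro j
    induction j with
    | zero => rfl
    | succ j ih => rw [FeedbackPolicy.wealth, ih, closedLoopWealth]
  exact ⟨π, fun j ω => by rw [hπ]; exact ⟨rfl, rfl⟩⟩

theorem measurableSet_continuousObs {i : ℕ} (hi : 1 ≤ i) {q : ℝ≥0} {s : ℝ} (hs : s ≤ q) {B : Set ℝ}
    (hB : MeasurableSet B) :
    MeasurableSet[M.continuousObs q] {ω | M.τ i ω ≤ s ∧ M.Z i ω ∈ B} :=
  MeasurableSpace.measurableSet_generateFrom ⟨i, hi, s, hs, B, hB, rfl⟩

theorem measurableSet_τ_le (j : ℕ) (q : ℝ≥0) :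
    MeasurableSet[M.continuousObs q] {ω | M.τ j ω ≤ q} := by
  rcases Nat.eq_zero_or_pos j with rfl | hj
  · simp only [M.τ_zero, NNReal.zero_le_coe, ofPred_true]
    exact @MeasurableSet.univ Ω (M.continuousObs q)
  · simpa using measurableSet_continuousObs (M := M) hj le_rfl (q := q) MeasurableSet.univ

/-- The observation times are stopping times, with `discreteObs j` as the past of `τ j`. -/
theorem measurableSet_inter_τ_le {j : ℕ} {A : Set Ω} (hA : MeasurableSet[M.discreteObs j] A)
    (q : ℝ≥0) : MeasurableSet[M.continuousObs q] ({ω | M.τ j ω ≤ q} ∩ A) := by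
  let mD : MeasurableSpace {ω | M.τ j ω ≤ q} := (M.continuousObs q).comap Subtype.val
  have h1 : Measurable[mD, M.discreteObs j] (Subtype.val : {ω | M.τ j ω ≤ q} → Ω) := by
    refine measurable_iff_comap_le.2 ?_
    rw [discreteObs, MeasurableSpace.comap_iSup]
    refine iSup_le fun i => ?_
    rw [MeasurableSpace.comap_iSup]
    refine iSup_le fun hi => ?_
    rw [MeasurableSpace.comap_comp]
    refine Measurable.comap_le (Measurable.prodMk ?_ ?_)
    -- On `τ j ≤ q` the earlier times are at most `q`, so `r` may be replaced by `min r q`, for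
    -- which the event is observed by time `q`.
    · refine measurable_of_Iic fun r => ?_
      refine ⟨_, measurableSet_continuousObs hi.1 (min_le_right r q) MeasurableSet.univ, ?_⟩
      ext d
      have h2 : M.τ i d.1 ≤ q := ((M.τ_strictMono d.1).monotone hi.2).trans d.2
      simp [h2]
    · intro B hB
      refine ⟨_, measurableSet_continuousObs hi.1 le_rfl hB, ?_⟩
      ext d
      have h2 : M.τ i d.1 ≤ q := ((M.τ_strictMono d.1).monotone hi.2).trans d.2
      simp [h2]
  obtain ⟨A', hA', h2⟩ := h1 hA
  have h3 : {ω | M.τ j ω ≤ q} ∩ A = {ω | M.τ j ω ≤ q} ∩ A' := by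
    ext ω
    refine and_congr_right fun hω => ?_
    exact (Set.ext_iff.1 h2 ⟨ω, hω⟩).symm
  rw [h3]
  exact @MeasurableSet.inter Ω (M.continuousObs q) _ _ (measurableSet_τ_le j q) hA'

/-- The events that `τ j` has passed and that something has been observed at `τ j` are
predictable. -/
theorem measurableSet_predictable_τ_lt {j : ℕ} {A : Set Ω}
    (hA : MeasurableSet[M.discreteObs j] A) :
    MeasurableSet[M.continuousObs.predictable] {q : ℝ≥0 × Ω | M.τ j q.2 < q.1 ∧ q.2 ∈ A} := by
  have h1 : {q : ℝ≥0 × Ω | M.τ j q.2 < q.1 ∧ q.2 ∈ A} =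
      -- A rational time separates `τ j` from `t`, which yields countably many predictable
      -- rectangles.
      ⋃ r : ℚ, Ioi (r : ℝ).toNNReal ×ˢ ({ω | M.τ j ω ≤ (r : ℝ).toNNReal} ∩ A) := by
    ext ⟨t, ω⟩
    simp only [mem_ofPred_eq, mem_iUnion, mem_prod, mem_Ioi, mem_inter_iff]
    constructor
    · rintro ⟨h, hA⟩
      obtain ⟨r, h2, h3⟩ := exists_rat_btwn h
      have hr : (0 : ℝ) ≤ r := (M.τ_nonneg j ω).trans h2.le
      refine ⟨r, ?_, ?_, hA⟩
      · rwa [← NNReal.coe_lt_coe, Real.coe_toNNReal _ hr]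
      · rw [Real.coe_toNNReal _ hr]
        exact h2.le
    · rintro ⟨r, h2, h3, hA⟩
      exact ⟨lt_of_le_of_lt h3 (by exact_mod_cast h2), hA⟩
  rw [h1]
  refine @MeasurableSet.iUnion _ _ M.continuousObs.predictable _ _ fun r => ?_
  exact measurableSet_predictable_Ioi_prod (measurableSet_inter_τ_le hA _)

/-- The converse of the factorisation over a period: after `τ j`, functions of time and of the
observations up to `τ j` are predictable. -/
theorem measurable_predictable_indicator {j : ℕ} {g : Ω × ℝ → ℝ}
    (hg : Measurable[(M.discreteObs j).prod inferInstance] g) :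
    Measurable[M.continuousObs.predictable]
      ({q : ℝ≥0 × Ω | M.τ j q.2 < q.1}.indicator fun q => g (q.2, q.1)) := by
  let mp : MeasurableSpace (ℝ≥0 × Ω) := M.continuousObs.predictable
  set D := {q : ℝ≥0 × Ω | M.τ j q.2 < q.1} with hD
  have hDm : MeasurableSet[mp] D := by
    have := measurableSet_predictable_τ_lt (@MeasurableSet.univ Ω (M.discreteObs j))
    simpa only [mem_univ, and_true] using this
  have h1 : Measurable[mp.comap Subtype.val, M.discreteObs j] fun d : D => d.1.2 := by
    intro A hA
    refine ⟨_, measurableSet_predictable_τ_lt hA, ?_⟩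
    ext d
    have h2 : M.τ j d.1.2 < d.1.1 := d.2
    simp [h2]
  have h2 : Measurable[mp] fun q : ℝ≥0 × Ω => (q.1 : ℝ) := by
    refine measurable_coe_nnreal_real.comp (measurable_of_Ioi fun s => ?_)
    have h3 : (Prod.fst : ℝ≥0 × Ω → ℝ≥0) ⁻¹' Ioi s = Ioi s ×ˢ univ := by
      ext
      simp
    rw [h3]
    exact measurableSet_predictable_Ioi_prod (@MeasurableSet.univ Ω (M.continuousObs s))
  have h3 : Measurable[mp.comap Subtype.val, (M.discreteObs j).prod inferInstance]
      fun d : D => (d.1.2, (d.1.1 : ℝ)) :=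
    @Measurable.prodMk D (mp.comap Subtype.val) Ω ℝ (M.discreteObs j) _ _ _ h1
      (h2.comp (comap_measurable _))
  refine measurable_of_restrict_of_restrict_compl hDm ?_ ?_
  · rw [show D.domRestrict (D.indicator fun q => g (q.2, q.1)) =
      g ∘ fun d : D => (d.1.2, (d.1.1 : ℝ)) from funext fun d => indicator_of_mem d.2 _]
    exact hg.comp h3
  · rw [show Dᶜ.domRestrict (D.indicator fun q => g (q.2, q.1)) = fun _ => 0 from
      funext fun d => indicator_of_notMem d.2 _]
    exact measurable_const

namespace FeedbackPolicy

variable (π : M.FeedbackPolicy)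

/-- Every policy is implemented by a predictable consumption process. -/
theorem exists_predictable_implements : ∃ c : ℝ≥0 → Ω → ℝ,
    IsStronglyPredictable M.continuousObs c ∧ (∀ t ω, 0 ≤ c t ω) ∧ π.Implements c := by
  let D : ℕ → Set (ℝ≥0 × Ω) := fun j => {q | M.τ j q.2 < q.1}
  -- `G j` is the rate of period `j`, cut off outside `(τ j, τ (j + 1)]`; at most one term of the
  -- sum is nonzero. Summing in `[0, ∞]` gives measurability without a summability condition.
  let G : ℕ → ℝ≥0 × Ω → ℝ := fun j =>
    (D (j + 1))ᶜ.indicator ((D j).indicator fun q => π.rate j q.2 (q.1 - M.τ j q.2))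
  have hD : ∀ j, MeasurableSet[M.continuousObs.predictable] (D j) := by
    intro j
    have := measurableSet_predictable_τ_lt (@MeasurableSet.univ Ω (M.discreteObs j))
    simpa only [mem_univ, and_true] using this
  have hG : ∀ j, Measurable[M.continuousObs.predictable] (G j) := by
    intro j
    refine Measurable.indicator ?_ (@MeasurableSet.compl _ _ M.continuousObs.predictable (hD _))
    refine measurable_predictable_indicator (g := fun q => π.rate j q.1 (q.2 - M.τ j q.1)) ?_
    let mo : MeasurableSpace (Ω × ℝ) := (M.discreteObs j).prod inferInstance
    have h1 : Measurable[mo] fun q : Ω × ℝ => q.2 - M.τ j q.1 :=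
      measurable_snd.sub ((measurable_discreteObs_τ le_rfl).comp measurable_fst)
    exact (π.measurable_rate j).comp (@Measurable.prodMk (Ω × ℝ) mo Ω ℝ (M.discreteObs j) _ _ _
      measurable_fst h1)
  refine ⟨fun t ω => (∑' j, ENNReal.ofReal (G j (t, ω))).toReal, ?_, fun _ _ =>
    ENNReal.toReal_nonneg, fun j ω s hs hsw => ?_⟩
  · let mp : MeasurableSpace (ℝ≥0 × Ω) := M.continuousObs.predictable
    have h0 : Measurable[mp] fun q : ℝ≥0 × Ω => ∑' j, ENNReal.ofReal (G j q) := by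
      refine Measurable.tsum (f := fun j q => ENNReal.ofReal (G j q)) fun j => ?_
      exact (hG j).ennreal_ofReal
    have h1 := h0.ennreal_toReal
    exact h1.stronglyMeasurable
  · have ht : 0 ≤ s + M.τ j ω := add_nonneg hs.le (M.τ_nonneg j ω)
    rw [waiting] at hsw
    have hmono := (M.τ_strictMono ω).monotone
    simp only
    rw [tsum_eq_single j]
    · have h1 : ((s + M.τ j ω).toNNReal, ω) ∈ D j := by
        simp only [D, mem_ofPred_eq, Real.coe_toNNReal _ ht]
        linarith
      have h2 : ((s + M.τ j ω).toNNReal, ω) ∈ (D (j + 1))ᶜ := by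
        simp only [D, mem_compl_iff, mem_ofPred_eq, Real.coe_toNNReal _ ht]
        linarith
      simp only [G, indicator_of_mem h1, indicator_of_mem h2, Real.coe_toNNReal _ ht,
        add_sub_cancel_right]
      exact ENNReal.toReal_ofReal (π.rate_nonneg j ω s)
    · intro i hij
      rcases lt_or_gt_of_ne hij with h | h
      · have h1 : ((s + M.τ j ω).toNNReal, ω) ∉ (D (i + 1))ᶜ := by
          have : M.τ (i + 1) ω ≤ M.τ j ω := hmono h
          simp only [D, mem_compl_iff, mem_ofPred_eq, Real.coe_toNNReal _ ht, not_not]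
          linarith
        simp only [G, indicator_of_notMem h1, ENNReal.ofReal_zero]
      · have h1 : ((s + M.τ j ω).toNNReal, ω) ∉ D i := by
          have : M.τ (j + 1) ω ≤ M.τ i ω := hmono h
          simp only [D, mem_ofPred_eq, Real.coe_toNNReal _ ht]
          linarith
        by_cases h2 : ((s + M.τ j ω).toNNReal, ω) ∈ (D (i + 1))ᶜ
        · simp only [G, indicator_of_mem h2, indicator_of_notMem h1, ENNReal.ofReal_zero]
        · simp only [G, indicator_of_notMem h2, ENNReal.ofReal_zero]

variable [IsProbabilityMeasure P] {π}

theorem measurePreserving_Z (hM : M.ReturnAssumptions P k b)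
    (hstat : ∀ t, 0 ≤ t → M.p t = M.p 0) (n : ℕ) :
    MeasurePreserving (M.Z (n + 1)) P (M.p 0) := by
  have := hM.isProb_zero
  have := isProbabilityMeasure_expMeasure hM.lam_pos
  refine ⟨M.measurable_Z _, Measure.ext fun C hC => ?_⟩
  have h := measure_inter_eq hM hstat n (@MeasurableSet.univ Ω (M.discreteObs n))
    (MeasurableSet.univ (α := ℝ)) hC
  rw [Measure.map_apply (M.measurable_Z _) hC]
  simpa using h

/-- A policy with admissible decisions keeps the wealth nonnegative. -/
theorem ae_wealth_nonneg (hM : M.ReturnAssumptions P k b)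
    (hstat : ∀ t, 0 ≤ t → M.p t = M.p 0) {x : ℝ} (hx : 0 ≤ x)
    (h : ∀ j ω, 0 ≤ π.wealth x j ω → π.invest j ω ∈ M.portfolios ∧
      M.IsConsumption 0 (π.wealth x j ω) (π.invest j ω) (π.rate j ω)) :
    ∀ᵐ ω ∂P, ∀ j, 0 ≤ π.wealth x j ω := by
  have hZ : ∀ᵐ ω ∂P, ∀ j, -M.zlow ≤ M.Z (j + 1) ω ∧ (M.Z (j + 1) ω : EReal) ≤ M.zbar :=
    ae_all_iff.2 fun j => (measurePreserving_Z hM hstat j).quasiMeasurePreserving.ae hM.ae_return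
  filter_upwards [hZ] with ω hω j
  induction j with
  | zero => exact hx
  | succ j ih =>
    obtain ⟨ha, hc⟩ := h j ω ih
    have h1 := hc.integral_le (M.waiting j ω) (waiting_pos j ω).le
    rw [integral_eq_cumul hc.measurable hc.nonneg (waiting_pos j ω).le] at h1
    have h2 : -M.l (π.invest j ω) ≤ π.invest j ω * M.Z (j + 1) ω :=
      hM.neg_l_le_mul ha (hω j).1 (hω j).2
    simp only [FeedbackPolicy.wealth]
    linarith

/-- The value of a policy with admissible decisions is at most the value function. -/
theorem sum_periodUtility_le_value (hM : M.ReturnAssumptions P k b)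
    (hstat : ∀ t, 0 ≤ t → M.p t = M.p 0) (hU : InadaUtility M.U) {x : ℝ} (hx : 0 ≤ x)
    (h : ∀ j ω, 0 ≤ π.wealth x j ω → π.invest j ω ∈ M.portfolios ∧
      M.IsConsumption 0 (π.wealth x j ω) (π.invest j ω) (π.rate j ω)) (n : ℕ) :
    ∑ j ∈ Finset.range n, π.periodUtility P j ≤ M.value P x := by
  obtain ⟨c, hc, hc0, hπ⟩ := π.exists_predictable_implements
  -- The amount indexed by `j` is decided at `τ (j - 1)`, hence the shift; the truncated index at `j
  -- = 0` plays no role.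
  have hX : ∀ᵐ ω ∂P, ∀ j, 0 ≤ π.wealth x j ω ∧
      IntervalIntegrable (fun t : ℝ => c t.toNNReal ω) volume 0 (M.τ j ω) ∧
      M.wealth x (fun j => π.invest (j - 1)) c j ω = π.wealth x j ω := by
    filter_upwards [ae_wealth_nonneg hM hstat hx h] with ω hω j
    refine ⟨hω j, hπ.wealth_eq (fun _ => rfl) x (fun i => ?_) j⟩
    exact cumul_ne_top (waiting_pos i ω).le ((h i ω (hω i)).2.integrable _ (waiting_pos i ω).le)
  have hadm : M.IsAdmissible P x (fun j => π.invest (j - 1)) c := by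
    refine ⟨fun j => π.measurable_invest j, hc, hc0, ?_, ?_⟩
    · filter_upwards [hX] with ω hω j _ using (hω j).2.1
    · filter_upwards [hX] with ω hω j _
      rw [(hω j).2.2]
      exact (hω j).1
  refine le_trans ?_ (le_iSup_of_le _ (le_iSup₂_of_le c hadm le_rfl))
  rw [hπ.lintegral_eq hM hstat hU]
  exact le_iSup (fun n => ∑ j ∈ Finset.range n, π.periodUtility P j) n

end FeedbackPolicy

variable [IsProbabilityMeasure P]

/-- Stage `j` uses an `ε`-optimal selection for the iterate with `n - 1 - j` periods left.
Discounting does not increase the errors, so they add up to at most `n ε`. -/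
theorem iterValue_le_value (hM : M.ReturnAssumptions P k b) (hU : M.UtilityAssumptions k b γ K₁)
    (hstat : ∀ t, 0 ≤ t → M.p t = M.p 0) {x : ℝ} (hx : 0 ≤ x) (n : ℕ) :
    M.iterValue n x ≤ M.value P x := by
  have hI := hU.inadaUtility
  refine ENNReal.le_of_forall_pos_le_add fun e he _ => ?_
  -- Dividing by `n + 1` keeps the quotient meaningful when `n = 0`.
  set ε : ℝ≥0∞ := e / (n + 1 : ℕ) with hεd
  have hε : ε ≠ 0 := by
    simp [hεd, he.ne', ENNReal.div_eq_zero_iff]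
  choose A C hA hC hC0 hAC using fun j : ℕ =>
    exists_measurable_selection hM hU (iterValue_class hM hU (n - 1 - j)) hε
  obtain ⟨π, hπ⟩ := exists_feedbackPolicy (M := M) hA hC hC0 x
  have hadm : ∀ j ω, 0 ≤ π.wealth x j ω → π.invest j ω ∈ M.portfolios ∧
      M.IsConsumption 0 (π.wealth x j ω) (π.invest j ω) (π.rate j ω) := by
    intro j ω hω
    rw [(hπ j ω).1, (hπ j ω).2]
    exact ⟨(hAC j _ hω).1, (hAC j _ hω).2.1⟩
  have key : ∀ i m, i + m = n → M.iterValue n x ≤ (∑ j ∈ Finset.range i, π.periodUtility P j) +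
      π.terminalReward P (M.iterValue m) x i + i * ε := by
    intro i
    induction i with
    | zero =>
      intro m hm
      rw [zero_add] at hm
      subst hm
      simp [FeedbackPolicy.terminalReward, FeedbackPolicy.wealth, M.τ_zero]
    | succ i ih =>
      intro m hm
      refine (ih (m + 1) (by omega)).trans ?_
      have hstep : π.terminalReward P (M.iterValue (m + 1)) x i ≤
          π.periodUtility P i + π.terminalReward P (M.iterValue m) x (i + 1) + ε := by
        rw [π.periodUtility_add_terminalReward hM hstat hI (iterValue_class hM hU m).mono]
        calc π.terminalReward P (M.iterValue (m + 1)) x i ≤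
            ∫⁻ ω, (ENNReal.ofReal (Real.exp (-M.rho * M.τ i ω)) * M.objective (M.iterValue m)
              (π.wealth x i ω) (π.invest i ω) (π.rate i ω) + ε) ∂P := by
              refine lintegral_mono_ae ?_
              filter_upwards [FeedbackPolicy.ae_wealth_nonneg hM hstat hx hadm] with ω hω
              have h1 := (hAC i _ (hω i)).2.2
              rw [← (hπ i ω).1, ← (hπ i ω).2, show n - 1 - i = m by omega] at h1
              have h2 : ENNReal.ofReal (Real.exp (-M.rho * M.τ i ω)) ≤ 1 := by
                rw [ENNReal.ofReal_le_one, Real.exp_le_one_iff]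
                nlinarith [hU.rho_pos, M.τ_nonneg i ω]
              refine (mul_le_mul_right h1 _).trans ?_
              rw [mul_add]
              exact add_le_add_right (mul_le_of_le_one_left zero_le h2) _
          _ = _ := by rw [lintegral_add_right _ measurable_const, lintegral_const, measure_univ,
              mul_one]
      rw [Finset.sum_range_succ]
      push_cast
      calc _ ≤ (∑ j ∈ Finset.range i, π.periodUtility P j) + (π.periodUtility P i +
            π.terminalReward P (M.iterValue m) x (i + 1) + ε) + i * ε := by gcongr
        _ = _ := by ring
  have h1 := key n 0 rfl
  have h2 : π.terminalReward P (M.iterValue 0) x n = 0 := by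
    simp [FeedbackPolicy.terminalReward, iterValue]
  rw [h2, add_zero] at h1
  refine h1.trans (add_le_add (FeedbackPolicy.sum_periodUtility_le_value hM hstat hI hx hadm n) ?_)
  calc (n : ℝ≥0∞) * ε ≤ (n + 1 : ℕ) * ε := by gcongr; exact n.le_succ
    _ ≤ e := ENNReal.mul_div_le

/-- The value function is the limit of the iterates of the dynamic programming operator. -/
theorem value_eq_limitValue (hM : M.ReturnAssumptions P k b) (hU : M.UtilityAssumptions k b γ K₁)
    (hstat : ∀ t, 0 ≤ t → M.p t = M.p 0) : M.value P = M.limitValue := by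
  funext x
  refine le_antisymm (value_le_limitValue hM hU hstat x) (iSup_le fun n => ?_)
  rcases le_or_gt 0 x with hx | hx
  · exact iterValue_le_value hM hU hstat hx n
  · cases n with
    | zero => exact zero_le
    -- For negative wealth no portfolio is admissible, as `l` is nonnegative, and the supremum over
    -- the empty set is `0`.
    | succ n =>
      refine iSup₂_le fun a ha => ?_
      obtain ⟨h1, h2⟩ := hM.mem_portfolioInterval.1 ha
      exact absurd ((hM.l_nonneg h1).trans h2) (not_le.2 hx)

end IlliquidMarket

theorem mainTheorem1 {Ω : Type*} [MeasurableSpace Ω] (P : Measure Ω) [IsProbabilityMeasure P]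
    (M : IlliquidMarket Ω) (k b γ K₁ : ℝ)
    (hM : M.ReturnAssumptions P k b) (hU : M.UtilityAssumptions k b γ K₁)
    (hstat : ∀ t, 0 ≤ t → M.p t = M.p 0) :
    -- both value functions are finite, and `v(x)` is the supremum of `v̂(0,x,a)`
    (∀ x, 0 ≤ x → M.value P x < ⊤) ∧
    (∀ t x a, 0 ≤ t → a ∈ M.portfolios → M.l a ≤ x → M.auxValue P t x a < ⊤) ∧
    (∀ x, 0 ≤ x → M.value P x = ⨆ a ∈ M.portfolioInterval x, M.auxValue P 0 x a) ∧
    -- `v ∈ C¹(0,∞)` and `v'(0+) = +∞`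
    ContDiffOn ℝ 1 (fun x => (M.value P x).toReal) (Set.Ioi 0) ∧
    Tendsto (deriv fun x => (M.value P x).toReal) (𝓝[>] 0) atTop ∧
    -- every maximiser is interior (relatively to the set of portfolios)
    (∀ x, 0 < x → ∀ a ∈ M.portfolioInterval x,
      IsMaxOn (fun a' => M.auxValue P 0 x a') (M.portfolioInterval x) a →
        M.l a < x ∧ M.portfolioInterval x ∈ 𝓝[M.portfolios] a) ∧
    -- `v̂(t,·,a) ∈ C²(l(a),∞)` and `∂ₓv̂(t,l(a)+,a) = +∞`
    (∀ t, 0 ≤ t → ∀ a ∈ M.portfolios,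
      ContDiffOn ℝ 2 (fun x => (M.auxValue P t x a).toReal) (Set.Ioi (M.l a)) ∧
      Tendsto (deriv fun x => (M.auxValue P t x a).toReal) (𝓝[>] (M.l a)) atTop) :=
  IlliquidMarket.regularity_of_value_eq hM hU hstat
    (IlliquidMarket.value_eq_limitValue hM hU hstat)
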